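/- Setting. Sensors $1,\dots,N$ observe $y_{i,k}=H_{i,k}\theta+w_{i,k}\in\mathbb R^{m_i}$, $k\ge 1$, where $\theta\in\mathbb R^n$ is deterministic. The random matrices $H_{i,k}$ and vectors $w_{i,k}$ (all $i,k$) are mutually independent, $\mathbb E H_{i,k}=\bar H_i$, $\mathbb E w_{i,k}=0$, $\sup_{i,k}\mathbb E\|w_{i,k}\|^\rho<\infty$ and $\sup_{i,k}\mathbb E\|H_{i,k}-\bar H_i\|^\rho<\infty$ for some $\rho>2$, and $\sum_i \bar H_i^\top\bar H_i$ is invertible. The communication graph at time $k$ is $\mathcal G^{(\mathtt m_k)}$, where $(\mathtt m_k)$ is a homogeneous Markov chain on $\{1,\dots,M\}$ and $\mathcal G^{(u)}$ has the symmetric nonnegative weight matrix $(a^{(u)}_{ij})$ and the edge set $\mathcal E^{(u)}=\{(i,j):a^{(u)}_{ij}>0\}$; the weights are determined by the edge set, that is, $\mathcal E^{(u)}=\mathcal E^{(v)}$ implies $a^{(u)}=a^{(v)}$. The graph sequence is independent of all $H_{i,k},w_{i,k}$. Put $\mathtt E_k=\mathcal E^{(\mathtt m_k)}$, $\mathtt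 a_{ij,k}=a_{ij}^{(\mathtt m_k)}$ and $\mathcal E=\bigcup_u\mathcal E^{(u)}$. Algorithm. Let $\hat\theta_{i,0}$ be deterministic, let $\varphi_k$ be the standard basis vector $e_l$ of $\mathbb R^n$ with $l\equiv k \pmod n$, and let $x_{i,k}=\varphi_k^\top\hat\theta_{i,k-1}$. For $(i,j)\in\mathtt E_k$ sensor $i$ sends to sensor $j$ the signal $s_{ij,k}=1$ if $x_{i,k}+d_{ij,k}\le C_{ij}$ and $s_{ij,k}=-1$ otherwise, and then $$\hat\theta_{i,k}=\hat\theta_{i,k-1}+\varphi_k\sum_{j:(i,j)\in\mathtt E_k}\alpha_{ij,k}\mathtt a_{ij,k}(s_{ij,k}-s_{ji,k})+\beta_{i,k}\bar H_i^\top\big(y_{i,k}-\bar H_i\hat\theta_{i,k-1}\big).$$ Here $C_{ij}=C_{ji}\in\mathbb R$, $\alpha_{ij,k}=\alpha_{ji,k}>0$ and $\beta_{i,k}\ge0$. The privacy noises $d_{ij,k}$, $(i,j)\in\mathcal E$, $k\ge1$, are mutually independent, independent of $\{H_{i,k},w_{i,k}\}$ and the graph sequence jointly, and Gaussian with means $\mu_{ij,k}=\mu_{ji,k}$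 and variances $\sigma_{ij,k}^2=\sigma_{ji,k}^2>0$. Let $f_{ij,k}$ and $F_{ij,k}$ be the density and the distribution function of $d_{ij,k}$, let $\eta_{ij,k}=\sup_{x\in\mathbb R} f_{ij,k}(x)^2/\big(F_{ij,k}(x)(1-F_{ij,k}(x))\big)$, $Q_i=\bar H_i^\top\bar H_i$, and let $\lambda_{\max}(Q_i)$ and $\lambda_{\min}^+(Q_i)$ be its largest and its smallest positive eigenvalue. Assume $\sum_k\beta_{i,k}^2<\infty$, $\beta_{i,k}=O(\beta_{i,k+1})$ and $\beta_{i,k}\lambda_{\max}(Q_i)<1$ for all $i,k$, and $$\sum_{t=1}^\infty \eta_{ij,t}\prod_{l=1}^t\big(1-\lambda_{\min}^+(Q_i)\beta_{i,l}\big)^2<\infty\qquad\text{for all }(i,j)\in\mathcal E\text{ with }\bar H_i\neq0 .$$ Fisher information. Let $\mathtt S=\{s_{ij,k}:(i,j)\in\mathtt E_k,\ k\ge1\}$ be the family of all transmitted binary signals, and $\bar{\mathtt X}=\{x_{i,k}+d_{ij,k}:(i,j)\in\mathtt E_k,\ k\ge1\}$ the family of the corresponding unquantized noisy signals. For $\mathtt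 Z\in\{\mathtt S,\bar{\mathtt X}\}$, let $p(\cdot\mid x,y)$ be the density, with respect to a common dominating measure, of the conditional law of $\mathtt Z$ given $\{y_{i,t}:t\ne k\}=x$ and $y_{i,k}=y$ (namely the law of $\mathtt Z$ when the observations of sensor $i$ are fixed to these values). The conditional Fisher information is the random matrix $$\mathcal I_{\mathtt Z}\big(y_{i,k}\,\big|\,\{y_{i,t}:t\neq k\}\big)=\mathbb E\Big[\tfrac{\partial\ln p(\mathtt Z\mid x,y)}{\partial y}\Big(\tfrac{\partial\ln p(\mathtt Z\mid x,y)}{\partial y}\Big)^{\!\top}\Big|\;y\Big]\quad\text{at } y=y_{i,k},\ x=\{y_{i,t}:t\ne k\}.$$ Theorem. For every sensor $i$ and every $k\ge1$, both conditional Fisher informations exist, with square-integrable scores, and almost surely, in the order of symmetric matrices given by positive semidefiniteness, $$\mathcal I_{\mathtt S}\big(y_{i,k}\,\big|\,\{y_{i,t}:t\neq k\}\big)\ \le\ \frac2\pi\,\mathcal I_{\bar{\mathtt X}}\big(y_{i,k}\,\big|\,\{y_{i,t}:t\neq k\}\big).$$ -/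

import Mathlib

open MeasureTheory ProbabilityTheory Filter Topology
open scoped NNReal ENNReal

namespace PrivEst

/-- Column vectors of length `n` with the Euclidean norm. -/
abbrev Vec (n : ℕ) := EuclideanSpace ℝ (Fin n)

/-! ### Fisher information -/

section Fisher

variable {Ω S : Type*} [MeasurableSpace Ω] [MeasurableSpace S] {m : ℕ}

/-- `ℓ` is the score `∂ ln p(s ∣ y) / ∂ y` at the point `y` of the family of laws `L y'`,
`y' ∈ ℝᵐ`: the family has densities `p y'` with respect to a common `σ`-finite measure, and for
almost every `s` under `L y`, the likelihood `y' ↦ p y' s` is positive near `y` and its logarithm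
has gradient `ℓ s` at `y`. Up to `L y`-null sets, the score does not depend on the choice
of the dominating measure or of the densities. -/
def IsScoreAt (L : Vec m → Measure S) (y : Vec m) (ℓ : S → Vec m) : Prop :=
  ∃ (ν : Measure S) (p : Vec m → S → ℝ), SigmaFinite ν ∧
    (∀ y', Measurable (p y')) ∧ (∀ y' s, 0 ≤ p y' s) ∧
    (∀ y', L y' = ν.withDensity fun s => ENNReal.ofReal (p y' s)) ∧
    ∀ᵐ s ∂(L y), (∀ᶠ y' in 𝓝 y, 0 < p y' s) ∧
      HasGradientAt (fun y' => Real.log (p y' s)) (ℓ s) y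

/-- Let `obs` be a random sequence of vectors, `out` a random output, and `L` a version of the
regular conditional law of `out` given the whole sequence `obs`.
`ℓ η s` is the conditional score of `out` with respect to the `k`-th entry of `obs`,
given the other entries, when `obs = η` and `out = s`: only the `k`-th entry of `η` is varied. -/
structure IsCondScore (μ : Measure Ω) (obs : Ω → ℕ → Vec m) (out : Ω → S)
    (L : (ℕ → Vec m) → Measure S) (k : ℕ) (ℓ : (ℕ → Vec m) → S → Vec m) : Prop where
  /-- `L` is a regular conditional law of `out` given `obs`. -/
  condLaw : ∃ κ : Kernel (ℕ → Vec m) S, IsMarkovKernel κ ∧ (∀ η, κ η = L η) ∧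
    HasCondDistrib out obs κ μ
  measurable : Measurable (Function.uncurry ℓ)
  score : ∀ᵐ η ∂(μ.map obs), IsScoreAt (fun y => L (Function.update η k y)) (η k) (ℓ η)

/-- `I` is (a version of) the conditional Fisher information matrix of `out` about the `k`-th
entry `y = obs k`, given the other entries `x` of `obs`:
`I = E [ (∂ ln P(out ∣ x, y) / ∂ y) (∂ ln P(out ∣ x, y) / ∂ y)ᵀ ∣ y ]`.
It is a random `m × m` matrix, unique up to almost sure equality; being such a matrix includes
that the score exists and is square-integrable. -/
def IsCondFisherInfo (μ : Measure Ω) (obs : Ω → ℕ → Vec m) (out : Ω → S)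
    (L : (ℕ → Vec m) → Measure S) (k : ℕ) (I : Ω → Matrix (Fin m) (Fin m) ℝ) : Prop :=
  ∃ ℓ : (ℕ → Vec m) → S → Vec m, IsCondScore μ obs out L k ℓ ∧
    ∀ a b : Fin m,
      Integrable (fun ω => ℓ (obs ω) (out ω) a * ℓ (obs ω) (out ω) b) μ ∧
      (fun ω => I ω a b) =ᵐ[μ]
        condExp (MeasurableSpace.comap (fun ω => obs ω k) inferInstance) μ
          (fun ω => ℓ (obs ω) (out ω) a * ℓ (obs ω) (out ω) b)

end Fisher

/-! ### The algorithm

Time is indexed from `0`: the index `k : ℕ` stands for the `(k + 1)`-st time step, and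
`estimate k` is the estimate available before that step (so `estimate 0` is the initial one). -/

/-- The data of the algorithm: initial estimates, quantization thresholds, the two families of
step sizes, and the mean measurement matrices (as linear maps). -/
structure Algorithm (N n : ℕ) (dim : Fin N → ℕ) where
  init : Fin N → Vec n
  threshold : Fin N → Fin N → ℝ
  alpha : Fin N → Fin N → ℕ → ℝ
  beta : Fin N → ℕ → ℝ
  Hbar : ∀ i, Vec n →L[ℝ] Vec (dim i)

/-- The compressing vectors: the standard basis vectors, taken cyclically. -/
noncomputable def compressor (n k : ℕ) : Vec n :=
  WithLp.toLp 2 fun l : Fin n => if (l : ℕ) = k % n then 1 else 0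

/-- The binary quantizer with threshold `c`. -/
noncomputable def quantize (c z : ℝ) : ℝ := if z ≤ c then 1 else -1

namespace Algorithm

variable {N n : ℕ} {dim : Fin N → ℕ} (P : Algorithm N n dim)

/-- `Q_i = H̄_iᵀ H̄_i`. -/
noncomputable def Q (i : Fin N) : Vec n →L[ℝ] Vec n :=
  (ContinuousLinearMap.adjoint (P.Hbar i)).comp (P.Hbar i)

/-- All estimates at all times, as a function of the weighted adjacency matrices `G k`, the
privacy noises `d i j k` and the observations `y i k`. -/
noncomputable def estimate (G : ℕ → Matrix (Fin N) (Fin N) ℝ) (d : Fin N → Fin N → ℕ → ℝ)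
    (y : ∀ i, ℕ → Vec (dim i)) : ℕ → Fin N → Vec n
  | 0 => P.init
  | k + 1 => fun i =>
    let est := estimate G d y k
    let s := fun a b => quantize (P.threshold a b) (inner ℝ (compressor n k) (est a) + d a b k)
    est i
      + (∑ j, if 0 < G k i j then P.alpha i j k * G k i j * (s i j - s j i) else 0) •
          compressor n k
      + P.beta i k • ContinuousLinearMap.adjoint (P.Hbar i) (y i k - P.Hbar i (est i))

/-- The family of unquantized noisy signals `x_{i,k} + d_{ij,k}` over the active edges `(i, j)`
of all time steps `k`; the entry of an inactive edge is `Sum.inl ()`. The estimates behind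
them are those of the algorithm above. -/
noncomputable def noisySignals (G : ℕ → Matrix (Fin N) (Fin N) ℝ) (d : Fin N → Fin N → ℕ → ℝ)
    (y : ∀ i, ℕ → Vec (dim i)) : ℕ → Fin N → Fin N → Unit ⊕ ℝ :=
  fun k i j =>
    if 0 < G k i j then
      Sum.inr (inner ℝ (compressor n k) (P.estimate G d y k i) + d i j k)
    else Sum.inl ()

/-- The family of binary signals `s_{ij,k}` that are transmitted over the active edges `(i, j)`
of all time steps `k`; the entry of an inactive edge is `Sum.inl ()`. -/
noncomputable def binarySignals (G : ℕ → Matrix (Fin N) (Fin N) ℝ) (d : Fin N → Fin N → ℕ → ℝ)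
    (y : ∀ i, ℕ → Vec (dim i)) : ℕ → Fin N → Fin N → Unit ⊕ ℝ :=
  fun k i j =>
    if 0 < G k i j then
      Sum.inr (quantize (P.threshold i j)
        (inner ℝ (compressor n k) (P.estimate G d y k i) + d i j k))
    else Sum.inl ()

end Algorithm

/-! ### The random model -/

section Model

variable {Ω : Type*} [MeasurableSpace Ω] {N n M : ℕ} {dim : Fin N → ℕ}

/-- The observations `y_{i,k} = H_{i,k} θ + w_{i,k}`. -/
noncomputable def observation (θ : Vec n) (H : ∀ i, ℕ → Ω → (Vec n →L[ℝ] Vec (dim i)))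
    (w : ∀ i, ℕ → Ω → Vec (dim i)) (ω : Ω) (i : Fin N) (k : ℕ) : Vec (dim i) :=
  H i k ω θ + w i k ω

/-- `(i, j)` is an edge of the union graph. -/
def UnionEdge (A : Fin M → Matrix (Fin N) (Fin N) ℝ) (e : Fin N × Fin N) : Prop :=
  ∃ u, 0 < A u e.1 e.2

/-- `η = sup_x f(x)² / (F(x) (1 - F(x)))` for the Gaussian law with mean `c` and variance `v`;
this supremum is finite when `v ≠ 0`. -/
noncomputable def etaGaussian (c : ℝ) (v : ℝ≥0) : ℝ :=
  ⨆ x : ℝ, gaussianPDFReal c v x ^ 2 /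
    (cdf (gaussianReal c v) x * (1 - cdf (gaussianReal c v) x))

/-- The largest eigenvalue. -/
noncomputable def lambdaMax (T : Vec n →L[ℝ] Vec n) : ℝ :=
  sSup {l : ℝ | Module.End.HasEigenvalue T.toLinearMap l}

/-- The smallest positive eigenvalue (of a map that has one). -/
noncomputable def lambdaMinPos (T : Vec n →L[ℝ] Vec n) : ℝ :=
  sInf {l : ℝ | 0 < l ∧ Module.End.HasEigenvalue T.toLinearMap l}

/-- The switching communication graph: the weighted adjacency matrices are symmetric and
nonnegative, two of them with the same edges are equal, and the index of the
current graph is a homogeneous Markov chain with some transition matrix. -/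
structure GraphModel (μ : Measure Ω) (A : Fin M → Matrix (Fin N) (Fin N) ℝ)
    (r : ℕ → Ω → Fin M) : Prop where
  symm : ∀ u, (A u).IsSymm
  nonneg : ∀ u i j, 0 ≤ A u i j
  weights_of_edges : ∀ u v, (∀ i j, 0 < A u i j ↔ 0 < A v i j) → A u = A v
  measurable : ∀ k, Measurable (r k)
  markov : ∃ p : Matrix (Fin M) (Fin M) ℝ, (∀ u v, 0 ≤ p u v) ∧ (∀ u, ∑ v, p u v = 1) ∧
    ∀ (k : ℕ) (c : ℕ → Fin M),
      μ.real {ω | ∀ l ≤ k + 1, r l ω = c l} = μ.real {ω | ∀ l ≤ k, r l ω = c l} * p (c k) (c (k + 1))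

/-- The `σ`-algebra generated by all measurement matrices and observation noises. -/
noncomputable abbrev sourceSigma (H : ∀ i, ℕ → Ω → (Vec n →L[ℝ] Vec (dim i)))
    (w : ∀ i, ℕ → Ω → Vec (dim i)) : MeasurableSpace Ω :=
  ⨆ q : Fin N × ℕ, MeasurableSpace.comap (w q.1 q.2) inferInstance ⊔
    MeasurableSpace.comap (H q.1 q.2) inferInstance

/-- The `σ`-algebra generated by the graph sequence. -/
abbrev graphSigma (A : Fin M → Matrix (Fin N) (Fin N) ℝ) (r : ℕ → Ω → Fin M) : MeasurableSpace Ω :=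
  ⨆ k, MeasurableSpace.comap (fun ω => A (r k ω)) ⊤

/-- The observation model: `E H_{i,k} = H̄_i`, `∑ H̄_iᵀ H̄_i` is invertible, the `w_{i,k}` have
mean zero, the `w_{i,k}` and `H_{i,k} - H̄_i` have uniformly bounded moments of some order
`ρ > 2`, and all of them are mutually independent and independent of the graphs. -/
structure ObservationModel (μ : Measure Ω) (P : Algorithm N n dim)
    (A : Fin M → Matrix (Fin N) (Fin N) ℝ) (r : ℕ → Ω → Fin M)
    (H : ∀ i, ℕ → Ω → (Vec n →L[ℝ] Vec (dim i))) (w : ∀ i, ℕ → Ω → Vec (dim i)) : Prop where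
  measurable_H : ∀ i k, Measurable (H i k)
  measurable_w : ∀ i k, Measurable (w i k)
  mean_H : ∀ i k, ∫ ω, H i k ω ∂μ = P.Hbar i
  mean_w : ∀ i k, ∫ ω, w i k ω ∂μ = 0
  observable : IsUnit (∑ i, P.Q i)
  moments : ∃ (ρ : ℝ) (B : ℝ≥0), 2 < ρ ∧
    (∀ i k, ∫⁻ ω, ‖w i k ω‖ₑ ^ ρ ∂μ ≤ B) ∧
    (∀ i k, ∫⁻ ω, ‖H i k ω - P.Hbar i‖ₑ ^ ρ ∂μ ≤ B)
  indep : iIndep (fun q : (Fin N × ℕ) ⊕ (Fin N × ℕ) =>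
    Sum.elim (fun a => MeasurableSpace.comap (w a.1 a.2) inferInstance)
      (fun a => MeasurableSpace.comap (H a.1 a.2) inferInstance) q) μ
  indep_graph : Indep (sourceSigma H w) (graphSigma A r) μ

/-- The privacy noises over the union graph: `d_{ij,k}` is Gaussian with mean `c_{ij,k}` and
variance `v_{ij,k} ≠ 0`, the laws of `d_{ij,k}` and `d_{ji,k}` agree, all noises are mutually
independent, and independent of the observation model and of the graphs. -/
structure GaussianPrivacyNoise (μ : Measure Ω) (A : Fin M → Matrix (Fin N) (Fin N) ℝ)
    (r : ℕ → Ω → Fin M) (H : ∀ i, ℕ → Ω → (Vec n →L[ℝ] Vec (dim i)))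
    (w : ∀ i, ℕ → Ω → Vec (dim i)) (d : Fin N → Fin N → ℕ → Ω → ℝ)
    (c : Fin N → Fin N → ℕ → ℝ) (v : Fin N → Fin N → ℕ → ℝ≥0) : Prop where
  measurable : ∀ i j k, Measurable (d i j k)
  law : ∀ i j k, UnionEdge A (i, j) → μ.map (d i j k) = gaussianReal (c i j k) (v i j k)
  var_ne_zero : ∀ i j k, UnionEdge A (i, j) → v i j k ≠ 0
  mean_symm : ∀ i j k, c i j k = c j i k
  var_symm : ∀ i j k, v i j k = v j i k
  indep : iIndepFun (fun (q : {e : Fin N × Fin N // UnionEdge A e} × ℕ) =>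
    d q.1.1.1 q.1.1.2 q.2) μ
  indep_model : Indep
    (⨆ q : {e : Fin N × Fin N // UnionEdge A e} × ℕ,
      MeasurableSpace.comap (d q.1.1.1 q.1.1.2 q.2) inferInstance)
    (sourceSigma H w ⊔ graphSigma A r) μ

/-- The conditions on thresholds and step sizes. The last one is
`∑_t η_{ij,t} ∏_{l ≤ t} (1 - λ⁺_min(Q_i) β_{i,l})² < ∞`; it concerns only sensors with
`H̄_i ≠ 0`, for which `Q_i` has a positive eigenvalue. -/
structure StepConditions (P : Algorithm N n dim) (A : Fin M → Matrix (Fin N) (Fin N) ℝ)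
    (c : Fin N → Fin N → ℕ → ℝ) (v : Fin N → Fin N → ℕ → ℝ≥0) : Prop where
  threshold_symm : ∀ i j, P.threshold i j = P.threshold j i
  alpha_symm : ∀ i j k, P.alpha i j k = P.alpha j i k
  alpha_pos : ∀ i j k, UnionEdge A (i, j) → 0 < P.alpha i j k
  beta_nonneg : ∀ i k, 0 ≤ P.beta i k
  beta_sq : ∀ i, Summable fun k => P.beta i k ^ 2
  beta_growth : ∀ i, (fun k => P.beta i k) =O[atTop] fun k => P.beta i (k + 1)
  beta_lt : ∀ i k, P.beta i k * lambdaMax (P.Q i) < 1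
  eta_summable : ∀ i j, UnionEdge A (i, j) → P.Hbar i ≠ 0 →
    Summable fun t => etaGaussian (c i j t) (v i j t) *
      ∏ l ∈ Finset.range (t + 1), (1 - lambdaMinPos (P.Q i) * P.beta i l) ^ 2

end Model

/-- The law of the output `signals G d y` when sensor `i` observes the fixed sequence `η`, while
the graphs, the privacy noises and the observations of the other sensors keep their joint law.
That this is a regular conditional law given the observations of sensor `i` is part of
`IsCondScore`. -/
noncomputable def lawGivenObs {Ω S : Type*} [MeasurableSpace Ω] [MeasurableSpace S]
    {N n M : ℕ} {dim : Fin N → ℕ} (μ : Measure Ω)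
    (signals : (ℕ → Matrix (Fin N) (Fin N) ℝ) → (Fin N → Fin N → ℕ → ℝ) →
      (∀ i, ℕ → Vec (dim i)) → S)
    (A : Fin M → Matrix (Fin N) (Fin N) ℝ) (r : ℕ → Ω → Fin M)
    (d : Fin N → Fin N → ℕ → Ω → ℝ) (θ : Vec n)
    (H : ∀ i, ℕ → Ω → (Vec n →L[ℝ] Vec (dim i))) (w : ∀ i, ℕ → Ω → Vec (dim i))
    (i : Fin N) (η : ℕ → Vec (dim i)) : Measure S :=
  μ.map fun ω => signals (fun l => A (r l ω)) (fun a b l => d a b l ω)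
    (Function.update (observation θ H w ω) i η)

/-- `I` is the conditional Fisher information of the signals about the observation `y_{i,k}`,
given the other observations `y_{i,t}`, `t ≠ k`, of sensor `i`. -/
def IsSignalFisherInfo {Ω S : Type*} [MeasurableSpace Ω] [MeasurableSpace S]
    {N n M : ℕ} {dim : Fin N → ℕ} (μ : Measure Ω)
    (signals : (ℕ → Matrix (Fin N) (Fin N) ℝ) → (Fin N → Fin N → ℕ → ℝ) →
      (∀ i, ℕ → Vec (dim i)) → S)
    (A : Fin M → Matrix (Fin N) (Fin N) ℝ) (r : ℕ → Ω → Fin M)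
    (d : Fin N → Fin N → ℕ → Ω → ℝ) (θ : Vec n)
    (H : ∀ i, ℕ → Ω → (Vec n →L[ℝ] Vec (dim i))) (w : ∀ i, ℕ → Ω → Vec (dim i))
    (i : Fin N) (k : ℕ) (I : Ω → Matrix (Fin (dim i)) (Fin (dim i)) ℝ) : Prop :=
  IsCondFisherInfo μ (fun ω => observation θ H w ω i)
    (fun ω => signals (fun l => A (r l ω)) (fun a b l => d a b l ω) (observation θ H w ω))
    (lawGivenObs μ signals A r d θ H w i) k I

end PrivEst

/-! Fix sensor `i` and time `k`. The observation `y_{i,k}` reaches the signals only through the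
estimate of sensor `i`. If it is replaced by `y_{i,k} + h` while all signals are held fixed, the
estimate of sensor `i` at time `t` moves by `J_t h` with a deterministic linear map `J_t`
(`sensitivity`); and the signals do stay fixed if at the same time every noise `d_{ij,t}` is lowered
by `φ_tᵀ J_t h` (`estimate_perturb`). Write `e_q`, `q = (j, t)`, for the standardized noises of
sensor `i`. A change of the observation by `h` then has the same effect on the output as adding
`⟨b_q, h⟩` to each `e_q`, where `b_q = J_tᵀ φ_t / σ_{ij,t}`. So both families of output laws come
from one Gaussian shift family.

The step-size condition gives `∑ ‖b_q‖² < ∞` (`summable_norm_shiftDir_sq`): `J_t` takes values in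
the range of `H̄_iᵀ`, where `1 - β Q_i` contracts by the factor `1 - λ⁺_min β`, and `η ≥ 2 / (π
σ²)`.

By the Cameron–Martin formula (`map_add_stdGaussianPi`) the shifted noise has density `exp(⟨U, h⟩ -
∑ ⟨b_q, h⟩² / 2)` with `U = ∑ e_q b_q`. Conditioning this density on the output gives the likelihood
of the output, and its logarithmic gradient at `h = 0` is the score `E[U ∣ output]`
(`isScoreAt_scoreFun`). Conditional expectation is continuous on `L²`, so the score is the series `∑
M_q b_q` with `M_q = E[e_q ∣ output]`.

The output shows which edges are active, the edges determine the weights, and sensor `i` can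
therefore replay its own estimates from its observations and the binary signals
(`reconstruct_binarySignals`). This makes `M_q` explicit. On an inactive edge it is `0`. On an
active edge it is `e_q` itself for the unquantized signals, and for the binary signals it is the
mean of a standard Gaussian given the side of `u` on which it lies, where `u` depends only on the
background and on earlier noises (`halfMean`). The order of time makes the `M_q` orthogonal, hence
`E⟨score, h⟩² = ∑ ⟨b_q, h⟩² E M_q²` for both outputs (`IsCoordMean.hasSum_integral_scoreFun_sq`).

The comparison is now termwise and reduces to `f(u)² ≤ (2/π) F(u) (1 - F(u))` for the standard
Gaussian (`sq_gaussianPDFReal_le`). It holds for every fixed observation sequence, so it survives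
conditioning on `y_{i,k}`; uniqueness of scores (`IsScoreAt.ae_eq`) transfers it to all versions of
the two Fisher informations. -/

namespace PrivEst

/-! ### Countable products of standard Gaussian laws -/

/-- The product of standard Gaussian laws over the index set `Q`. -/
noncomputable def stdGaussianPi (Q : Type*) : Measure (Q → ℝ) :=
  Measure.infinitePi fun _ : Q => gaussianReal 0 1

section GaussianPi

variable {Q : Type*}

instance : IsProbabilityMeasure (stdGaussianPi Q) := by
  unfold stdGaussianPi; infer_instance

lemma measurePreserving_eval (q : Q) :
    MeasurePreserving (fun e : Q → ℝ => e q) (stdGaussianPi Q) (gaussianReal 0 1) :=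
  measurePreserving_eval_infinitePi _ q

/-- Independence of the coordinates in resampling form. Every later argument that integrates out a
single `e_q` first rests on it. -/
lemma measurePreserving_update [DecidableEq Q] (q : Q) :
    MeasurePreserving (fun p : (Q → ℝ) × ℝ => Function.update p.1 q p.2)
      ((stdGaussianPi Q).prod (gaussianReal 0 1)) (stdGaussianPi Q) := by
  have hm : Measurable (fun p : (Q → ℝ) × ℝ => Function.update p.1 q p.2) := by
    refine measurable_pi_lambda _ fun i => ?_
    by_cases h : i = q
    · subst h; simpa using measurable_snd
    · simp only [Function.update_of_ne h]
      exact (measurable_pi_apply i).comp measurable_fst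
  refine ⟨hm, Measure.eq_infinitePi _ fun s t ht => ?_⟩
  rw [Measure.map_apply hm (MeasurableSet.pi s.countable_toSet fun i _ => ht i)]
  by_cases hq : q ∈ s
  · have : (fun p : (Q → ℝ) × ℝ => Function.update p.1 q p.2) ⁻¹' ((s : Set Q).pi t) =
        (((s.erase q : Finset Q) : Set Q).pi t) ×ˢ t q := by
      ext ⟨e, x⟩
      simp only [Set.mem_preimage, Set.mem_pi, Finset.mem_coe, Set.mem_prod, Finset.mem_erase]
      constructor
      · intro h
        refine ⟨fun i hi => ?_, ?_⟩
        · simpa [Function.update_of_ne hi.1] using h i hi.2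
        · simpa using h q hq
      · rintro ⟨h1, h2⟩ i hi
        by_cases hiq : i = q
        · subst hiq; simpa using h2
        · simpa [Function.update_of_ne hiq] using h1 i ⟨hiq, hi⟩
    rw [this, Measure.prod_prod, stdGaussianPi, Measure.infinitePi_pi _ fun i _ => ht i,
      mul_comm, Finset.mul_prod_erase s (fun i => gaussianReal 0 1 (t i)) hq]
  · have : (fun p : (Q → ℝ) × ℝ => Function.update p.1 q p.2) ⁻¹' ((s : Set Q).pi t) =
        ((s : Set Q).pi t) ×ˢ Set.univ := by
      ext ⟨e, x⟩
      simp only [Set.mem_preimage, Set.mem_pi, Finset.mem_coe, Set.mem_prod, Set.mem_univ, and_true]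
      refine forall₂_congr fun i hi => ?_
      have : i ≠ q := fun h => hq (h ▸ hi)
      simp [Function.update_of_ne this]
    rw [this, Measure.prod_prod, stdGaussianPi, Measure.infinitePi_pi _ fun i _ => ht i]
    simp

lemma memLp_coord (q : Q) : MemLp (fun e : Q → ℝ => e q) 2 (stdGaussianPi Q) :=
  (memLp_id_gaussianReal' 2 (by simp)).comp_measurePreserving (measurePreserving_eval q)

/-- The `q`-th coordinate as an element of `L²`. -/
noncomputable def coordLp (q : Q) : Lp ℝ 2 (stdGaussianPi Q) := (memLp_coord q).toLp _

lemma coordLp_coeFn (q : Q) : coordLp q =ᵐ[stdGaussianPi Q] fun e => e q :=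
  (memLp_coord q).coeFn_toLp

lemma integral_sq_gaussianReal : ∫ x, x ^ 2 ∂gaussianReal 0 1 = 1 := by
  have h := variance_fun_id_gaussianReal (μ := 0) (v := 1)
  rw [variance_eq_integral (by fun_prop)] at h
  simpa [integral_id_gaussianReal] using h

variable {Ξ : Type*} [MeasurableSpace Ξ] (P₀ : Measure Ξ) [IsProbabilityMeasure P₀]

/-- Resampling one Gaussian coordinate does not change an expectation. -/
lemma integral_update [DecidableEq Q] (q : Q) {F : Ξ × (Q → ℝ) → ℝ}
    (hF : Integrable F (P₀.prod (stdGaussianPi Q))) :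
    ∫ z, F z ∂(P₀.prod (stdGaussianPi Q)) =
      ∫ z, ∫ x, F (z.1, Function.update z.2 q x) ∂gaussianReal 0 1
        ∂(P₀.prod (stdGaussianPi Q)) := by
  have h1 : MeasurePreserving
      (fun w : Ξ × ((Q → ℝ) × ℝ) => (w.1, Function.update w.2.1 q w.2.2))
      (P₀.prod ((stdGaussianPi Q).prod (gaussianReal 0 1))) (P₀.prod (stdGaussianPi Q)) :=
    (MeasurePreserving.id P₀).prod (measurePreserving_update q)
  have h2 : MeasurePreserving (MeasurableEquiv.prodAssoc : (Ξ × (Q → ℝ)) × ℝ ≃ᵐ _)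
      ((P₀.prod (stdGaussianPi Q)).prod (gaussianReal 0 1))
      (P₀.prod ((stdGaussianPi Q).prod (gaussianReal 0 1))) :=
    ⟨MeasurableEquiv.measurable _, Measure.prodAssoc_prod⟩
  have h3 := h1.comp h2
  have hF' := h3.integrable_comp_of_integrable hF
  rw [← h3.map_eq, integral_map h3.measurable.aemeasurable (by rw [h3.map_eq]; exact hF.1)]
  rw [h3.map_eq]
  exact integral_prod _ hF'

lemma integral_coord_mul_eq_zero [DecidableEq Q] (q : Q) {G : Ξ × (Q → ℝ) → ℝ}
    (hG : ∀ ξ e x, G (ξ, Function.update e q x) = G (ξ, e)) :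
    ∫ z, z.2 q * G z ∂(P₀.prod (stdGaussianPi Q)) = 0 := by
  by_cases hi : Integrable (fun z : Ξ × (Q → ℝ) => z.2 q * G z) (P₀.prod (stdGaussianPi Q))
  · rw [integral_update P₀ q hi]
    simp [hG, integral_mul_const, integral_id_gaussianReal]
  · exact integral_undef hi

lemma integral_coord_mul_coord [DecidableEq Q] (q q' : Q) :
    ∫ e : Q → ℝ, e q * e q' ∂(stdGaussianPi Q) = if q = q' then 1 else 0 := by
  split_ifs with h
  · subst h
    have h := integral_map (μ := stdGaussianPi Q) (φ := fun e : Q → ℝ => e q)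
      (measurable_pi_apply q).aemeasurable (f := fun x : ℝ => x ^ 2) (by fun_prop)
    rw [(measurePreserving_eval q).map_eq, integral_sq_gaussianReal] at h
    simpa [sq] using h.symm
  · have h0 := integral_coord_mul_eq_zero (Measure.dirac ()) q (G := fun z : Unit × (Q → ℝ) => z.2 q')
      (fun ξ e x => by simp [Function.update_of_ne (Ne.symm h)])
    have h1 := integral_map (μ := (Measure.dirac ()).prod (stdGaussianPi Q)) (φ := Prod.snd) measurable_snd.aemeasurable
      (f := fun e : Q → ℝ => e q * e q') (by
        exact ((measurable_pi_apply q).mul (measurable_pi_apply q')).aestronglyMeasurable)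
    rw [← Measure.snd, Measure.snd_prod] at h1
    rw [h1, h0]

lemma orthonormal_coordLp : Orthonormal ℝ (coordLp : Q → Lp ℝ 2 (stdGaussianPi Q)) := by
  classical
  rw [orthonormal_iff_ite]
  intro q q'
  rw [← integral_coord_mul_coord, L2.inner_def]
  refine integral_congr_ae ?_
  filter_upwards [coordLp_coeFn q, coordLp_coeFn q'] with e h h'
  simp [h, h', mul_comm]

/-- The linear functional `∑ a_q e_q` of the coordinates, as an element of `L²`. -/
noncomputable def linLp (a : Q → ℝ) : Lp ℝ 2 (stdGaussianPi Q) := ∑' q, a q • coordLp q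

/-- Orthonormality of the coordinates turns square summability of the coefficients into convergence
in `L²`. -/
lemma hasSum_linLp {a : Q → ℝ} (ha : Summable fun q => a q ^ 2) :
    HasSum (fun q => a q • coordLp q) (linLp a) := by
  refine Summable.hasSum ?_
  have h := (orthonormal_coordLp (Q := Q)).orthogonalFamily.summable_iff_norm_sq_summable a
  simp only [LinearIsometry.toSpanSingleton_apply] at h
  rw [h]
  simpa using ha

end GaussianPi

/-! ### The Cameron–Martin formula -/

section CameronMartin

variable {Q : Type*}

/-- Completing the square: an exponential tilt moves the centre of the Gaussian from `0` to `a`. -/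
lemma setLIntegral_exp_mul_gaussianReal (a : ℝ) {t : Set ℝ} (ht : MeasurableSet t) :
    ∫⁻ x in t, ENNReal.ofReal (Real.exp (a * x)) ∂gaussianReal 0 1 =
      ENNReal.ofReal (Real.exp (a ^ 2 / 2)) * gaussianReal a 1 t := by
  rw [gaussianReal_of_var_ne_zero _ one_ne_zero, gaussianReal_of_var_ne_zero _ one_ne_zero,
    withDensity_apply _ ht, setLIntegral_withDensity_eq_setLIntegral_mul _ (measurable_gaussianPDF _ _)
      (by fun_prop) ht, ← lintegral_const_mul _ (measurable_gaussianPDF _ _)]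
  refine lintegral_congr fun x => ?_
  simp only [Pi.mul_apply, gaussianPDF, gaussianPDFReal]
  rw [← ENNReal.ofReal_mul (by positivity), ← ENNReal.ofReal_mul (by positivity)]
  congr 1
  rw [mul_assoc, ← Real.exp_add, mul_left_comm, ← Real.exp_add]
  congr 2
  simp
  ring

lemma setLIntegral_exp_sum [DecidableEq Q] (a : Q → ℝ) {F s : Finset Q} (hs : s ⊆ F)
    {t : Q → Set ℝ} (ht : ∀ q, MeasurableSet (t q)) :
    ∫⁻ e in (s : Set Q).pi t, ENNReal.ofReal (Real.exp (∑ q ∈ F, a q * e q)) ∂stdGaussianPi Q =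
      ENNReal.ofReal (Real.exp ((∑ q ∈ F, a q ^ 2) / 2)) * ∏ q ∈ s, gaussianReal (a q) 1 (t q) := by
  -- Coordinates in `F` outside `s` receive the trivial constraint, so that the integrand factors
  -- over all of `F` and independence applies.
  let u : Q → Set ℝ := fun q => if q ∈ s then t q else Set.univ
  have hu : ∀ q, MeasurableSet (u q) := fun q => by
    by_cases h : q ∈ s <;> simp [u, h, ht]
  let f : Q → ℝ → ℝ≥0∞ := fun q => (u q).indicator fun x => ENNReal.ofReal (Real.exp (a q * x))
  have hf : ∀ q, Measurable (f q) := fun q => Measurable.indicator (by fun_prop) (hu q)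
  have h1 : ∀ e : Q → ℝ, ((s : Set Q).pi t).indicator
      (fun e => ENNReal.ofReal (Real.exp (∑ q ∈ F, a q * e q))) e = ∏ q ∈ F, f q (e q) := by
    intro e
    by_cases he : e ∈ (s : Set Q).pi t
    · rw [Set.indicator_of_mem he, Real.exp_sum, ENNReal.ofReal_prod_of_nonneg (fun _ _ => by positivity)]
      refine Finset.prod_congr rfl fun q _ => ?_
      have : e q ∈ u q := by
        by_cases h : q ∈ s
        · simpa [u, h] using he q h
        · simp [u, h]
      simp [f, this]
    · rw [Set.indicator_of_notMem he]
      simp only [Set.mem_pi, not_forall] at he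
      obtain ⟨q, hq, hqt⟩ := he
      refine (Finset.prod_eq_zero (hs hq) ?_).symm
      have : e q ∉ u q := by simpa [u, Finset.mem_coe.1 hq] using hqt
      simp [f, this]
  rw [← lintegral_indicator (MeasurableSet.pi s.countable_toSet fun i _ => ht i)]
  simp_rw [h1]
  have h0 : iIndepFun (fun q (e : Q → ℝ) => f q (e q)) (stdGaussianPi Q) := iIndepFun_infinitePi hf
  rw [lintegral_prod_eq_prod_lintegral_of_indepFun F (fun q (e : Q → ℝ) => f q (e q)) h0
    fun q => (hf q).comp (measurable_pi_apply q)]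
  have h2 : ∀ q, ∫⁻ e, f q (e q) ∂stdGaussianPi Q =
      ENNReal.ofReal (Real.exp (a q ^ 2 / 2)) * gaussianReal (a q) 1 (u q) := by
    intro q
    rw [← setLIntegral_exp_mul_gaussianReal _ (hu q), ← lintegral_indicator (hu q)]
    exact (measurePreserving_eval q).lintegral_comp (hf q)
  change ∏ q ∈ F, ∫⁻ e, f q (e q) ∂stdGaussianPi Q = _
  simp_rw [h2]
  rw [Finset.prod_mul_distrib, Finset.sum_div, Real.exp_sum,
    ENNReal.ofReal_prod_of_nonneg (fun _ _ => by positivity)]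
  congr 1
  rw [← Finset.prod_subset hs (f := fun q => gaussianReal (a q) 1 (u q)) fun q _ hq => by simp [u, hq]]
  exact Finset.prod_congr rfl fun q hq => by simp [u, hq]

lemma lintegral_exp_sum [DecidableEq Q] (a : Q → ℝ) (F : Finset Q) :
    ∫⁻ e, ENNReal.ofReal (Real.exp (∑ q ∈ F, a q * e q)) ∂stdGaussianPi Q =
      ENNReal.ofReal (Real.exp ((∑ q ∈ F, a q ^ 2) / 2)) := by
  have := setLIntegral_exp_sum a (Finset.empty_subset F) (t := fun _ => Set.univ) (by simp)
  simpa using this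

/-- For the partial sum `S` over `F`, `E exp(2S) = exp(2 ∑ a_q²)`. The resulting bound does not
depend on `F`, which is what the passage to the limit requires. -/
lemma eLpNorm_exp_sum_le {a : Q → ℝ} (ha : Summable fun q => a q ^ 2) (F : Finset Q) :
    eLpNorm (fun e : Q → ℝ => Real.exp (∑ q ∈ F, a q * e q)) 2 (stdGaussianPi Q) ≤
      ENNReal.ofReal (Real.exp (∑' q, a q ^ 2)) := by
  classical
  rw [eLpNorm_eq_lintegral_rpow_enorm_toReal (by simp) (by simp)]
  have h : ∀ e : Q → ℝ, ‖Real.exp (∑ q ∈ F, a q * e q)‖ₑ ^ (2 : ℝ≥0∞).toReal =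
      ENNReal.ofReal (Real.exp (∑ q ∈ F, (2 * a q) * e q)) := by
    intro e
    rw [Real.enorm_eq_ofReal (by positivity), ENNReal.toReal_ofNat,
      ENNReal.ofReal_rpow_of_nonneg (by positivity) (by norm_num), ← Real.exp_mul, Finset.sum_mul]
    congr 2
    exact Finset.sum_congr rfl fun q _ => by ring
  simp_rw [h]
  rw [lintegral_exp_sum, ENNReal.ofReal_rpow_of_nonneg (by positivity) (by norm_num), ← Real.exp_mul]
  refine ENNReal.ofReal_le_ofReal (Real.exp_le_exp.2 ?_)
  have : ∑ q ∈ F, (2 * a q) ^ 2 = 4 * ∑ q ∈ F, a q ^ 2 := by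
    rw [Finset.mul_sum]; exact Finset.sum_congr rfl fun q _ => by ring
  rw [this, ENNReal.toReal_ofNat]
  have := ha.sum_le_tsum F fun _ _ => sq_nonneg _
  linarith

lemma abs_exp_sub_exp_le (x y : ℝ) :
    |Real.exp x - Real.exp y| ≤ |x - y| * (Real.exp x + Real.exp y) := by
  wlog h : y ≤ x generalizing x y
  · rw [abs_sub_comm, abs_sub_comm x, add_comm]
    exact this y x (le_of_not_ge h)
  rw [abs_of_nonneg (sub_nonneg.2 (Real.exp_le_exp.2 h)), abs_of_nonneg (sub_nonneg.2 h)]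
  have h1 := Real.add_one_le_exp (y - x)
  have h2 : Real.exp y = Real.exp x * Real.exp (y - x) := by rw [← Real.exp_add]; congr 1; ring
  have h3 := Real.exp_pos x
  have h4 := mul_nonneg (sub_nonneg.2 h) (Real.exp_pos y).le
  nlinarith

lemma coeFn_sum_smul_coordLp (a : Q → ℝ) (F : Finset Q) :
    (∑ q ∈ F, a q • coordLp q : Lp ℝ 2 (stdGaussianPi Q)) =ᵐ[stdGaussianPi Q]
      fun e => ∑ q ∈ F, a q * e q := by
  classical
  induction F using Finset.induction_on with
  | empty => simpa using! Lp.coeFn_zero ℝ 2 (stdGaussianPi Q)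
  | insert q F hq ih =>
    rw [Finset.sum_insert hq]
    filter_upwards [Lp.coeFn_add (a q • coordLp q) (∑ q ∈ F, a q • coordLp q),
      Lp.coeFn_smul (a q) (coordLp q), coordLp_coeFn q, ih] with e h1 h2 h3 h4
    rw [h1, Pi.add_apply, h2, h4, Finset.sum_insert hq, Pi.smul_apply, h3, smul_eq_mul]

lemma integrable_exp_sum (a : Q → ℝ) (F : Finset Q) :
    Integrable (fun e : Q → ℝ => Real.exp (∑ q ∈ F, a q * e q)) (stdGaussianPi Q) := by
  classical
  refine ⟨Measurable.aestronglyMeasurable (by fun_prop), ?_⟩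
  rw [hasFiniteIntegral_iff_ofReal (Eventually.of_forall fun _ => by positivity), lintegral_exp_sum]
  simp

variable [Countable Q]

/-- Partial sums along which the exponentials converge in `L¹`. -/
lemma exists_seq_tendsto_exp {a : Q → ℝ} (ha : Summable fun q => a q ^ 2) :
    ∃ F : ℕ → Finset Q, Tendsto F atTop atTop ∧
      Tendsto (fun n => eLpNorm ((fun e => Real.exp (∑ q ∈ F n, a q * e q)) -
        fun e => Real.exp (linLp a e)) 1 (stdGaussianPi Q)) atTop (𝓝 0) := by
  have hsum : Tendsto (fun F : Finset Q => ∑ q ∈ F, a q • coordLp q) atTop (𝓝 (linLp a)) :=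
    hasSum_linLp ha
  obtain ⟨F, hF, hae⟩ := (tendstoInMeasure_of_tendsto_Lp hsum).exists_seq_tendsto_ae'
  refine ⟨F, hF, ?_⟩
  have hL2 := (Lp.tendsto_Lp_iff_tendsto_eLpNorm' _ _).1 (hsum.comp hF)
  set K := ENNReal.ofReal (Real.exp (∑' q, a q ^ 2))
  have hm : ∀ n, AEStronglyMeasurable (fun e : Q → ℝ => Real.exp (∑ q ∈ F n, a q * e q))
      (stdGaussianPi Q) := fun n => by
    refine Measurable.aestronglyMeasurable ?_
    fun_prop
  have hm' : AEStronglyMeasurable (fun e : Q → ℝ => Real.exp (linLp a e)) (stdGaussianPi Q) :=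
    Real.continuous_exp.comp_aestronglyMeasurable (Lp.aestronglyMeasurable _)
  have hall : ∀ᵐ e ∂stdGaussianPi Q, ∀ n,
      (∑ q ∈ F n, a q • coordLp q : Lp ℝ 2 (stdGaussianPi Q)) e = ∑ q ∈ F n, a q * e q :=
    ae_all_iff.2 fun n => coeFn_sum_smul_coordLp a (F n)
  -- Fatou along the almost everywhere convergent partial sums carries the uniform `L²` bound over
  -- to the limit.
  have hlim : eLpNorm (fun e => Real.exp (linLp a e)) 2 (stdGaussianPi Q) ≤ K := by
    refine (Lp.eLpNorm_lim_le_liminf_eLpNorm hm _ ?_).trans ?_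
    · filter_upwards [hae, hall] with e h1 h2
      simp only [h2] at h1
      exact (Real.continuous_exp.tendsto _).comp h1
    · refine (liminf_le_liminf (v := fun _ => K) (Eventually.of_forall fun n => eLpNorm_exp_sum_le ha _)).trans ?_
      simp
  -- `|exp x - exp y| ≤ |x - y| (exp x + exp y)` and Hölder: an `L²` distance tending to zero times
  -- a bounded `L²` norm.
  have hbound : ∀ n, eLpNorm ((fun e => Real.exp (∑ q ∈ F n, a q * e q)) -
        fun e => Real.exp (linLp a e)) 1 (stdGaussianPi Q) ≤
      eLpNorm (⇑(∑ q ∈ F n, a q • coordLp q : Lp ℝ 2 (stdGaussianPi Q)) - ⇑(linLp a)) 2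
        (stdGaussianPi Q) * (K + K) := by
    intro n
    have h1 : eLpNorm ((fun e => Real.exp (∑ q ∈ F n, a q * e q)) -
        fun e => Real.exp (linLp a e)) 1 (stdGaussianPi Q) ≤
        eLpNorm ((⇑(∑ q ∈ F n, a q • coordLp q : Lp ℝ 2 (stdGaussianPi Q)) - ⇑(linLp a)) •
          ((fun e => Real.exp (∑ q ∈ F n, a q * e q)) + fun e => Real.exp (linLp a e))) 1
          (stdGaussianPi Q) := by
      refine eLpNorm_mono_ae ?_
      filter_upwards [coeFn_sum_smul_coordLp a (F n)] with e he
      simp only [Pi.sub_apply, Pi.smul_apply', Pi.add_apply, he, Real.norm_eq_abs, smul_eq_mul,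
        abs_mul]
      refine (abs_exp_sub_exp_le _ _).trans (mul_le_mul_of_nonneg_left (le_abs_self _) (abs_nonneg _))
    refine h1.trans ((eLpNorm_smul_le_mul_eLpNorm (p := 2) (q := 2) ((hm n).add hm')
      ((Lp.aestronglyMeasurable _).sub (Lp.aestronglyMeasurable _))).trans ?_)
    refine mul_le_mul_right ((eLpNorm_add_le (hm n) hm' (by norm_num)).trans ?_) _
    exact add_le_add (eLpNorm_exp_sum_le ha _) hlim
  refine tendsto_of_tendsto_of_tendsto_of_le_of_le tendsto_const_nhds
    (h := fun n => eLpNorm (⇑(∑ q ∈ F n, a q • coordLp q : Lp ℝ 2 (stdGaussianPi Q)) - ⇑(linLp a)) 2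
        (stdGaussianPi Q) * (K + K)) ?_ (fun _ => zero_le) hbound
  have : K + K ≠ ∞ := by simp [K]
  simpa using ENNReal.Tendsto.mul_const hL2 (Or.inr this)

lemma integrable_exp_linLp {a : Q → ℝ} (ha : Summable fun q => a q ^ 2) :
    Integrable (fun e => Real.exp (linLp a e)) (stdGaussianPi Q) := by
  obtain ⟨F, -, h⟩ := exists_seq_tendsto_exp ha
  have hm' : AEStronglyMeasurable (fun e : Q → ℝ => Real.exp (linLp a e)) (stdGaussianPi Q) :=
    Real.continuous_exp.comp_aestronglyMeasurable (Lp.aestronglyMeasurable _)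
  obtain ⟨n, hn⟩ := (h.eventually (gt_mem_nhds (show (0 : ℝ≥0∞) < 1 by norm_num))).exists
  have h1 : MemLp ((fun e => Real.exp (∑ q ∈ F n, a q * e q)) -
        fun e => Real.exp (linLp a e)) 1 (stdGaussianPi Q) :=
    ⟨(integrable_exp_sum a _).1.sub hm', hn.trans (by simp)⟩
  have := (integrable_exp_sum a (F n)).sub (memLp_one_iff_integrable.1 h1)
  simpa using this

/-- **Cameron–Martin formula** for a countable product of standard Gaussian laws. -/
theorem map_add_stdGaussianPi {a : Q → ℝ} (ha : Summable fun q => a q ^ 2) :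
    (stdGaussianPi Q).map (fun e => e + a) = (stdGaussianPi Q).withDensity fun e =>
      ENNReal.ofReal (Real.exp (linLp a e - (∑' q, a q ^ 2) / 2)) := by
  classical
  have h1 : (stdGaussianPi Q).map (fun e => e + a) =
      Measure.infinitePi fun q => gaussianReal (a q) 1 := by
    have := Measure.infinitePi_map_pi (fun _ : Q => gaussianReal 0 1) (f := fun q x => x + a q)
      (fun q => by fun_prop)
    simp only [gaussianReal_map_add_const, zero_add] at this
    exact this
  rw [h1]
  symm
  refine Measure.eq_infinitePi _ fun s t ht => ?_
  have hA : MeasurableSet ((s : Set Q).pi t) := MeasurableSet.pi s.countable_toSet fun i _ => ht i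
  rw [withDensity_apply _ hA]
  obtain ⟨F, hF, hlim⟩ := exists_seq_tendsto_exp ha
  have hm' : AEStronglyMeasurable (fun e : Q → ℝ => Real.exp (linLp a e)) (stdGaussianPi Q) :=
    Real.continuous_exp.comp_aestronglyMeasurable (Lp.aestronglyMeasurable _)
  -- Two limits of the same integrals over a cylinder: `L¹` convergence gives the integral of the
  -- limit, while the explicit formula is available as soon as `F n` contains `s`.
  have h2 := tendsto_setIntegral_of_L1' _ hm' (Eventually.of_forall fun n => integrable_exp_sum a (F n))
    hlim ((s : Set Q).pi t)
  have h3 : ∀ᶠ n in atTop, ∫ e in (s : Set Q).pi t, Real.exp (∑ q ∈ F n, a q * e q) ∂stdGaussianPi Q =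
      Real.exp ((∑ q ∈ F n, a q ^ 2) / 2) * (∏ q ∈ s, gaussianReal (a q) 1 (t q)).toReal := by
    filter_upwards [hF.eventually (eventually_ge_atTop s)] with n hn
    rw [integral_eq_lintegral_of_nonneg_ae (Eventually.of_forall fun _ => by positivity)
      (integrable_exp_sum a (F n)).1.restrict, setLIntegral_exp_sum a hn ht, ENNReal.toReal_mul,
      ENNReal.toReal_ofReal (by positivity)]
  have h4 : Tendsto (fun n => Real.exp ((∑ q ∈ F n, a q ^ 2) / 2) *
      (∏ q ∈ s, gaussianReal (a q) 1 (t q)).toReal) atTop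
      (𝓝 (Real.exp ((∑' q, a q ^ 2) / 2) * (∏ q ∈ s, gaussianReal (a q) 1 (t q)).toReal)) :=
    (((Real.continuous_exp.tendsto _).comp ((ha.hasSum.comp hF).div_const 2))).mul_const _
  have h5 := tendsto_nhds_unique (h2.congr' h3) h4
  have h6 : ∀ e, Real.exp (linLp a e - (∑' q, a q ^ 2) / 2) =
      Real.exp (-((∑' q, a q ^ 2) / 2)) * Real.exp (linLp a e) := fun e => by
    rw [← Real.exp_add]; congr 1; ring
  simp_rw [h6]
  rw [← ofReal_integral_eq_lintegral_ofReal ((integrable_exp_linLp ha).const_mul _).restrict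
    (Eventually.of_forall fun _ => by positivity), integral_const_mul, h5, ← mul_assoc, ← Real.exp_add]
  have hfin : ∏ q ∈ s, gaussianReal (a q) 1 (t q) ≠ ∞ := ENNReal.prod_ne_top fun q _ => measure_ne_top _ _
  rw [neg_add_cancel, Real.exp_zero, one_mul, ENNReal.ofReal_toReal hfin]

end CameronMartin

/-! ### Vector-valued linear functionals and their exponential moments -/

section VectorFunctional

variable {Q : Type*} {m : ℕ}

lemma summable_inner_sq {b : Q → Vec m} (hb : Summable fun q => ‖b q‖ ^ 2) (h : Vec m) :
    Summable fun q => inner ℝ (b q) h ^ 2 := by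
  refine Summable.of_nonneg_of_le (fun _ => sq_nonneg _) (fun q => ?_) (hb.mul_right (‖h‖ ^ 2))
  rw [← mul_pow]
  exact sq_le_sq' (by linarith [neg_le_of_abs_le (abs_real_inner_le_norm (b q) h)])
    (real_inner_le_norm _ _)

lemma tsum_inner_sq_le {b : Q → Vec m} (hb : Summable fun q => ‖b q‖ ^ 2) (h : Vec m) :
    ∑' q, inner ℝ (b q) h ^ 2 ≤ (∑' q, ‖b q‖ ^ 2) * ‖h‖ ^ 2 := by
  rw [← tsum_mul_right]
  refine (summable_inner_sq hb h).tsum_le_tsum (fun q => ?_) (hb.mul_right (‖h‖ ^ 2))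
  rw [← mul_pow]
  exact sq_le_sq' (by linarith [neg_le_of_abs_le (abs_real_inner_le_norm (b q) h)])
    (real_inner_le_norm _ _)

lemma summable_apply_sq {b : Q → Vec m} (hb : Summable fun q => ‖b q‖ ^ 2) (a : Fin m) :
    Summable fun q => b q a ^ 2 := by
  simpa [EuclideanSpace.inner_single_right] using
    summable_inner_sq hb (EuclideanSpace.single a (1 : ℝ))

/-- The random vector `∑ e_q b_q`. -/
noncomputable def linVec (b : Q → Vec m) (e : Q → ℝ) : Vec m :=
  WithLp.toLp 2 fun a => linLp (fun q => b q a) e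

lemma measurable_linVec (b : Q → Vec m) : Measurable (linVec b) := by
  refine (WithLp.measurable_toLp 2 _).comp (measurable_pi_lambda _ fun a => ?_)
  exact (Lp.stronglyMeasurable _).measurable

lemma linLp_smul (c : ℝ) {a : Q → ℝ} (ha : Summable fun q => a q ^ 2) :
    linLp (fun q => c * a q) = c • linLp a := by
  have h2 : Summable fun q => (c * a q) ^ 2 := by
    simpa [mul_pow] using ha.mul_left (c ^ 2)
  refine (hasSum_linLp h2).unique ?_
  simpa [mul_smul] using (hasSum_linLp ha).const_smul c

/-- Only an almost everywhere statement: `linVec` is assembled from fixed representatives of its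
coordinates, whereas the right-hand side is a separate `L²` limit for each `h`. -/
lemma inner_linVec {b : Q → Vec m} (hb : Summable fun q => ‖b q‖ ^ 2) (h : Vec m) :
    (fun e => inner ℝ (linVec b e) h) =ᵐ[stdGaussianPi Q] linLp fun q => inner ℝ (b q) h := by
  have h1 : linLp (fun q => inner ℝ (b q) h) = ∑ a, h a • linLp (fun q => b q a) := by
    refine (hasSum_linLp (summable_inner_sq hb h)).unique ?_
    have := hasSum_sum (s := Finset.univ) fun a _ =>
      (hasSum_linLp (summable_apply_sq hb a)).const_smul (h a)
    refine this.congr_fun ?_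
    intro q
    simp only [smul_smul, ← Finset.sum_smul]
    rw [PiLp.inner_apply]
    rfl
  rw [h1]
  have h2 : ∀ s : Finset (Fin m), (∑ a ∈ s, h a • linLp (fun q => b q a) :
      Lp ℝ 2 (stdGaussianPi Q)) =ᵐ[stdGaussianPi Q]
        fun e => ∑ a ∈ s, h a * linLp (fun q => b q a) e := by
    classical
    intro s
    induction s using Finset.induction_on with
    | empty => simpa using! Lp.coeFn_zero ℝ 2 (stdGaussianPi Q)
    | insert a s ha ih =>
      rw [Finset.sum_insert ha]
      filter_upwards [Lp.coeFn_add (h a • linLp (fun q => b q a)) (∑ a ∈ s, h a • linLp (fun q => b q a)),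
        Lp.coeFn_smul (h a) (linLp (fun q => b q a)), ih] with e h1 h2 h4
      rw [h1, Pi.add_apply, h2, h4, Finset.sum_insert ha, Pi.smul_apply, smul_eq_mul]
  filter_upwards [h2 Finset.univ] with e he
  rw [he, PiLp.inner_apply]
  rfl

lemma exists_norm_le_card_mul (u : Vec m) (hu : u ≠ 0) : ∃ a, ‖u‖ ≤ m * |u a| := by
  have hm : (Finset.univ : Finset (Fin m)).Nonempty := by
    by_contra h
    rw [Finset.not_nonempty_iff_eq_empty, Finset.univ_eq_empty_iff] at h
    exact hu (Subsingleton.elim _ _)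
  obtain ⟨a, -, ha⟩ := Finset.exists_max_image Finset.univ (fun a => |u a|) hm
  refine ⟨a, ?_⟩
  have h1 : ‖u‖ ≤ ∑ c, |u c| := by
    rw [EuclideanSpace.norm_eq]
    refine Real.sqrt_le_iff.2 ⟨Finset.sum_nonneg fun _ _ => abs_nonneg _, ?_⟩
    simpa using Finset.sum_sq_le_sq_sum_of_nonneg (s := Finset.univ) (f := fun c => |u c|) fun _ _ => abs_nonneg _
  refine h1.trans ((Finset.sum_le_sum fun c hc => ha c hc).trans ?_)
  simp

/-- Density of the shifted Gaussian product with respect to the original one. -/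
noncomputable def shiftDensity (b : Q → Vec m) (h : Vec m) (e : Q → ℝ) : ℝ :=
  Real.exp (inner ℝ (linVec b e) h - (∑' q, inner ℝ (b q) h ^ 2) / 2)

lemma shiftDensity_pos (b : Q → Vec m) (h : Vec m) (e : Q → ℝ) : 0 < shiftDensity b h e :=
  Real.exp_pos _

lemma measurable_shiftDensity (b : Q → Vec m) (h : Vec m) :
    Measurable (shiftDensity b h) := by
  have := measurable_linVec b
  unfold shiftDensity
  fun_prop

variable [Countable Q]

/-- The norm is at most `m` times the largest coordinate in absolute value, so one-dimensional
exponential moments suffice. A bound on the norm itself yields domination uniformly over directions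
`h` in the unit ball. -/
lemma integrable_exp_norm_linVec {b : Q → Vec m} (hb : Summable fun q => ‖b q‖ ^ 2) {c : ℝ}
    (hc : 0 ≤ c) : Integrable (fun e => Real.exp (c * ‖linVec b e‖)) (stdGaussianPi Q) := by
  have h1 : ∀ (t : ℝ) (a : Fin m),
      Integrable (fun e => Real.exp (t * linVec b e a)) (stdGaussianPi Q) := by
    intro t a
    have h := summable_apply_sq hb a
    refine (integrable_exp_linLp (a := fun q => t * b q a)
      (by simpa [mul_pow] using h.mul_left (t ^ 2))).congr ?_
    rw [linLp_smul t h]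
    filter_upwards [Lp.coeFn_smul t (linLp fun q => b q a)] with e he
    rw [he]
    rfl
  -- The summand `1` covers the case `linVec b e = 0`, in particular `m = 0`, when the sum is empty.
  have h2 : Integrable (fun e => 1 + ∑ a, (Real.exp ((c * m) * linVec b e a) +
      Real.exp ((-(c * m)) * linVec b e a))) (stdGaussianPi Q) :=
    (integrable_const _).add (integrable_finsetSum _ fun a _ => (h1 _ a).add (h1 _ a))
  refine h2.mono' ?_ (Eventually.of_forall fun e => ?_)
  · have := (measurable_linVec b).norm
    exact Measurable.aestronglyMeasurable (by fun_prop)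
  rw [Real.norm_of_nonneg (by positivity)]
  by_cases hu : linVec b e = 0
  · rw [hu]
    simp only [norm_zero, mul_zero, Real.exp_zero]
    have : 0 ≤ ∑ a : Fin m, (Real.exp ((c * m) * (0 : Vec m) a) +
      Real.exp ((-(c * m)) * (0 : Vec m) a)) := by positivity
    linarith
  obtain ⟨a, ha⟩ := exists_norm_le_card_mul _ hu
  have h3 : Real.exp (c * ‖linVec b e‖) ≤ Real.exp ((c * m) * linVec b e a) +
      Real.exp ((-(c * m)) * linVec b e a) := by
    have h4 : c * ‖linVec b e‖ ≤ c * m * |linVec b e a| := by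
      rw [mul_assoc]; exact mul_le_mul_of_nonneg_left ha hc
    rcases abs_cases (linVec b e a) with ⟨h, -⟩ | ⟨h, -⟩
    · rw [h] at h4
      have := Real.exp_le_exp.2 h4
      have := Real.exp_pos ((-(c * m)) * linVec b e a)
      linarith
    · rw [h, mul_neg, ← neg_mul] at h4
      have := Real.exp_le_exp.2 h4
      have := Real.exp_pos ((c * m) * linVec b e a)
      linarith
  have h5 := Finset.single_le_sum (s := Finset.univ) (f := fun a => Real.exp ((c * m) * linVec b e a) +
      Real.exp ((-(c * m)) * linVec b e a)) (fun _ _ => by positivity) (Finset.mem_univ a)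
  simp only at h5
  linarith

lemma map_add_inner {b : Q → Vec m} (hb : Summable fun q => ‖b q‖ ^ 2) (h : Vec m) :
    (stdGaussianPi Q).map (fun e => e + fun q => inner ℝ (b q) h) =
      (stdGaussianPi Q).withDensity fun e => ENNReal.ofReal (shiftDensity b h e) := by
  rw [map_add_stdGaussianPi (summable_inner_sq hb h)]
  refine withDensity_congr_ae ?_
  filter_upwards [inner_linVec hb h] with e he
  rw [shiftDensity, ← he]

end VectorFunctional

/-! ### Differentiating the logarithm of a moment generating function -/

section Gradient

variable {E : Type*} [MeasurableSpace E] {m : ℕ}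

lemma abs_exp_sub_one_sub_le (x : ℝ) : |Real.exp x - 1 - x| ≤ x ^ 2 * Real.exp |x| := by
  have h1 := Real.add_one_le_exp x
  have h2 := Real.add_one_le_exp (-x)
  have h3 : Real.exp x * Real.exp (-x) = 1 := by rw [← Real.exp_add]; simp
  have h4 := Real.exp_pos x
  rw [abs_of_nonneg (by linarith)]
  rcases le_total 0 x with h | h
  · rw [abs_of_nonneg h]
    nlinarith [mul_le_mul_of_nonneg_left h2 h4.le, mul_nonneg h h4.le]
  · rw [abs_of_nonpos h]
    have h5 : (1 : ℝ) ≤ Real.exp (-x) := Real.one_le_exp (by linarith)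
    nlinarith [mul_le_mul_of_nonneg_left h2 h4.le, mul_nonneg (sq_nonneg x) (sub_nonneg.2 h5)]

/-- Second-order remainder with a majorant `‖h‖² · const · exp(2‖u‖)`, up to an additive constant in
the second factor, that can be integrated in `u`. The correction `r` is itself quadratic in `h` and
does not affect the first-order term. -/
lemma abs_exp_sub_half_sub_one_sub_le {m : ℕ} {u h : Vec m} {r K : ℝ} (hr : 0 ≤ r)
    (hrK : r ≤ K * ‖h‖ ^ 2) (hK : 0 ≤ K) (hh : ‖h‖ ≤ 1) :
    |Real.exp (inner ℝ u h - r / 2) - 1 - inner ℝ u h| ≤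
      ‖h‖ ^ 2 * (2 * Real.exp (2 * K) * Real.exp (2 * ‖u‖) + K) := by
  set t := ‖u‖ + K with ht
  have ht0 : 0 ≤ t := by positivity
  have h1 : |inner ℝ u h - r / 2| ≤ ‖h‖ * t := by
    have h2 := abs_le.1 (abs_real_inner_le_norm u h)
    have h3 : K * ‖h‖ ^ 2 ≤ K * ‖h‖ := by
      refine mul_le_mul_of_nonneg_left ?_ hK
      nlinarith [norm_nonneg h]
    rw [abs_le]
    constructor <;> nlinarith [norm_nonneg h, norm_nonneg u]
  have h4 : ‖h‖ * t ≤ t := by nlinarith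
  have h5 := abs_exp_sub_one_sub_le (inner ℝ u h - r / 2)
  have h6 : (inner ℝ u h - r / 2) ^ 2 ≤ ‖h‖ ^ 2 * t ^ 2 := by
    rw [← mul_pow, ← sq_abs]
    exact pow_le_pow_left₀ (abs_nonneg _) h1 2
  have h7 : Real.exp |inner ℝ u h - r / 2| ≤ Real.exp t := Real.exp_le_exp.2 (h1.trans h4)
  -- Absorbs the polynomial factor into one more exponential; this is why the exponent `2‖u‖`
  -- appears.
  have h8 : t ^ 2 ≤ 2 * Real.exp t := by
    have := Real.quadratic_le_exp_of_nonneg ht0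
    nlinarith
  have h9 : (inner ℝ u h - r / 2) ^ 2 * Real.exp |inner ℝ u h - r / 2| ≤
      ‖h‖ ^ 2 * (2 * Real.exp (2 * K) * Real.exp (2 * ‖u‖)) := by
    calc _ ≤ (‖h‖ ^ 2 * t ^ 2) * Real.exp t := by gcongr
      _ ≤ (‖h‖ ^ 2 * (2 * Real.exp t)) * Real.exp t := by gcongr
      _ = _ := by
        have : Real.exp t * Real.exp t = Real.exp (2 * K) * Real.exp (2 * ‖u‖) := by
          rw [← Real.exp_add, ← Real.exp_add]; congr 1; rw [ht]; ring
        rw [mul_assoc 2, ← this]; ring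
  have h10 := abs_le.1 (h5.trans h9)
  rw [abs_le]
  constructor <;> nlinarith [sq_nonneg ‖h‖]

lemma integrable_exp_inner_sub (ρ : Measure E) [IsProbabilityMeasure ρ] {U : E → Vec m}
    (hU : Measurable U) (hint : Integrable (fun e => Real.exp (2 * ‖U e‖)) ρ) (r : ℝ) {h : Vec m}
    (hh : ‖h‖ ≤ 1) : Integrable (fun e => Real.exp (inner ℝ (U e) h - r)) ρ := by
  refine (hint.const_mul (Real.exp (-r))).mono' (Measurable.aestronglyMeasurable (by fun_prop))
    (Eventually.of_forall fun e => ?_)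
  rw [Real.norm_of_nonneg (by positivity), ← Real.exp_add]
  refine Real.exp_le_exp.2 ?_
  have := real_inner_le_norm (U e) h
  nlinarith [norm_nonneg (U e), norm_nonneg h]

lemma integrable_of_integrable_exp_norm (ρ : Measure E) [IsProbabilityMeasure ρ] {U : E → Vec m}
    (hU : Measurable U) (hint : Integrable (fun e => Real.exp (2 * ‖U e‖)) ρ) :
    Integrable U ρ := by
  refine hint.mono' hU.aestronglyMeasurable (Eventually.of_forall fun e => ?_)
  have := Real.add_one_le_exp (2 * ‖U e‖)
  linarith [norm_nonneg (U e)]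

/-- A moment generating function with a quadratic correction has gradient `E U` at the origin. -/
lemma hasGradientAt_log_integral_exp (ρ : Measure E) [IsProbabilityMeasure ρ] {U : E → Vec m}
    (hU : Measurable U) (hint : Integrable (fun e => Real.exp (2 * ‖U e‖)) ρ)
    {g : Vec m → ℝ} {K : ℝ} (hK : 0 ≤ K) (hg0 : ∀ h, 0 ≤ g h) (hg : ∀ h, g h ≤ K * ‖h‖ ^ 2)
    (y : Vec m) :
    (∀ᶠ y' in 𝓝 y, 0 < ∫ e, Real.exp (inner ℝ (U e) (y' - y) - g (y' - y) / 2) ∂ρ) ∧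
      HasGradientAt
        (fun y' => Real.log (∫ e, Real.exp (inner ℝ (U e) (y' - y) - g (y' - y) / 2) ∂ρ))
        (∫ e, U e ∂ρ) y := by
  have hnear : ∀ᶠ y' in 𝓝 y, ‖y' - y‖ ≤ 1 := by
    filter_upwards [Metric.closedBall_mem_nhds y one_pos] with y' hy'
    simpa [dist_eq_norm] using hy'
  have hUi := integrable_of_integrable_exp_norm ρ hU hint
  refine ⟨?_, ?_⟩
  · filter_upwards [hnear] with y' hy'
    exact integral_exp_pos (integrable_exp_inner_sub ρ hU hint _ hy')
  set G : Vec m → ℝ := fun y' => ∫ e, Real.exp (inner ℝ (U e) (y' - y) - g (y' - y) / 2) ∂ρ with hG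
  have hg00 : g 0 = 0 := le_antisymm (by simpa using hg 0) (hg0 0)
  have hG1 : G y = 1 := by simp [hG, hg00]
  set C := ∫ e, (2 * Real.exp (2 * K) * Real.exp (2 * ‖U e‖) + K) ∂ρ
  have hbound : ∀ᶠ y' in 𝓝 y, |G y' - G y - inner ℝ (∫ e, U e ∂ρ) (y' - y)| ≤ C * ‖y' - y‖ ^ 2 := by
    filter_upwards [hnear] with y' hy'
    have h1 := integrable_exp_inner_sub ρ hU hint (g (y' - y) / 2) hy'
    have h2 : inner ℝ (∫ e, U e ∂ρ) (y' - y) = ∫ e, inner ℝ (U e) (y' - y) ∂ρ := by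
      rw [real_inner_comm, ← integral_inner hUi]
      simp_rw [real_inner_comm]
    have h3 : Integrable (fun e => inner ℝ (U e) (y' - y)) ρ := hUi.inner_const _
    have h4 : G y' - G y - inner ℝ (∫ e, U e ∂ρ) (y' - y) =
        ∫ e, (Real.exp (inner ℝ (U e) (y' - y) - g (y' - y) / 2) - 1 - inner ℝ (U e) (y' - y)) ∂ρ := by
      have h5 : Integrable (fun e => Real.exp (inner ℝ (U e) (y' - y) - g (y' - y) / 2) - 1) ρ :=
        h1.sub (integrable_const 1)
      rw [integral_sub h5 h3, integral_sub h1 (integrable_const 1), h2, hG1]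
      simp [hG]
    rw [h4, ← Real.norm_eq_abs, mul_comm, ← integral_const_mul]
    refine norm_integral_le_of_norm_le
      (((hint.const_mul _).add (integrable_const _)).const_mul _) (Eventually.of_forall fun e => ?_)
    exact abs_exp_sub_half_sub_one_sub_le (hg0 _) (hg _) hK hy'
  have hderiv : HasFDerivAt G (InnerProductSpace.toDual ℝ (Vec m) (∫ e, U e ∂ρ)) y := by
    rw [hasFDerivAt_iff_isLittleO]
    have hO : (fun y' => G y' - G y - InnerProductSpace.toDual ℝ (Vec m) (∫ e, U e ∂ρ) (y' - y))
        =O[𝓝 y] fun y' => ‖y' - y‖ ^ 2 := by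
      refine Asymptotics.IsBigO.of_bound C ?_
      filter_upwards [hbound] with y' hy'
      simpa using hy'
    refine hO.trans_isLittleO ?_
    have : Tendsto (fun y' : Vec m => y' - y) (𝓝 y) (𝓝 0) :=
      tendsto_sub_nhds_zero_iff.2 tendsto_id
    exact (Asymptotics.isLittleO_norm_pow_id one_lt_two).comp_tendsto this
  rw [hasGradientAt_iff_hasFDerivAt]
  -- Since `G y = 1`, passing to the logarithm leaves the derivative unchanged.
  have := hderiv.log (by rw [hG1]; exact one_ne_zero)
  rwa [hG1, inv_one, one_smul] at this

end Gradient

/-! ### The score of an output driven by shifted Gaussian noise -/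

section Score

variable {X Q Ξ S : Type*} [MeasurableSpace X] [MeasurableSpace Ξ] [MeasurableSpace S] {m : ℕ}

/-- The joint law of the output and the Gaussian coordinates, as a kernel in the observations. -/
noncomputable def jointKernel (P₀ : Measure Ξ) (out : X × Ξ × (Q → ℝ) → S) :
    Kernel X (S × (Q → ℝ)) :=
  (Kernel.id ×ₖ Kernel.const X (P₀.prod (stdGaussianPi Q))).map fun p => (out p, p.2.2)

/-- The law of the output, as a kernel in the observations. -/
noncomputable def outKernel (P₀ : Measure Ξ) (out : X × Ξ × (Q → ℝ) → S) : Kernel X S :=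
  (Kernel.id ×ₖ Kernel.const X (P₀.prod (stdGaussianPi Q))).map out

variable {P₀ : Measure Ξ} [IsProbabilityMeasure P₀] {out : X × Ξ × (Q → ℝ) → S}

lemma isMarkovKernel_jointKernel (hout : Measurable out) :
    IsMarkovKernel (jointKernel P₀ out) :=
  Kernel.IsMarkovKernel.map _ (hout.prodMk measurable_snd.snd)

lemma isMarkovKernel_outKernel (hout : Measurable out) : IsMarkovKernel (outKernel P₀ out) :=
  Kernel.IsMarkovKernel.map _ hout

lemma jointKernel_apply (hout : Measurable out) (η : X) :
    jointKernel P₀ out η = (P₀.prod (stdGaussianPi Q)).map fun z => (out (η, z), z.2) := by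
  rw [jointKernel, Kernel.map_apply _ (hout.prodMk measurable_snd.snd), Kernel.prod_apply,
    Kernel.id_apply, Kernel.const_apply, Measure.dirac_prod, Measure.map_map
      (hout.prodMk measurable_snd.snd) measurable_prodMk_left]
  rfl

lemma outKernel_apply (hout : Measurable out) (η : X) :
    outKernel P₀ out η = (P₀.prod (stdGaussianPi Q)).map fun z => out (η, z) := by
  rw [outKernel, Kernel.map_apply _ hout, Kernel.prod_apply,
    Kernel.id_apply, Kernel.const_apply, Measure.dirac_prod, Measure.map_map
      hout measurable_prodMk_left]
  rfl

lemma fst_jointKernel (hout : Measurable out) :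
    (jointKernel P₀ out).fst = outKernel P₀ out := by
  ext1 η
  have hm : Measurable fun z : Ξ × (Q → ℝ) => (out (η, z), z.2) :=
    (hout.comp measurable_prodMk_left).prodMk measurable_snd
  rw [Kernel.fst_apply, jointKernel_apply hout, outKernel_apply hout,
    Measure.map_map measurable_fst hm]
  rfl

variable [Countable Q] [MeasurableSpace.CountablyGenerated S]

/-- The conditional law of the Gaussian coordinates given the output. -/
noncomputable def noiseKernel (P₀ : Measure Ξ) [IsProbabilityMeasure P₀]
    {out : X × Ξ × (Q → ℝ) → S} (hout : Measurable out) : Kernel (X × S) (Q → ℝ) :=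
  haveI := isMarkovKernel_jointKernel (P₀ := P₀) hout
  (jointKernel P₀ out).condKernel

instance (hout : Measurable out) : IsMarkovKernel (noiseKernel P₀ hout) := by
  have := isMarkovKernel_jointKernel (P₀ := P₀) hout
  unfold noiseKernel; infer_instance

lemma outKernel_compProd_noiseKernel (hout : Measurable out) :
    outKernel P₀ out ⊗ₖ noiseKernel P₀ hout = jointKernel P₀ out := by
  have := isMarkovKernel_jointKernel (P₀ := P₀) hout
  rw [← fst_jointKernel hout, noiseKernel, Kernel.disintegrate]

lemma map_out_prodMk (hout : Measurable out) (η : X) :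
    (P₀.prod (stdGaussianPi Q)).map (fun z => (out (η, z), z.2)) =
      outKernel P₀ out η ⊗ₘ Kernel.sectR (noiseKernel P₀ hout) η := by
  have := isMarkovKernel_outKernel (P₀ := P₀) hout
  rw [← jointKernel_apply hout, ← outKernel_compProd_noiseKernel hout]
  ext s hs
  rw [Kernel.compProd_apply hs, Measure.compProd_apply hs]
  rfl

/-- Integrals of functions of output and noise by conditioning on the output. -/
lemma integral_out_noise (hout : Measurable out) (η : X) {f : S × (Q → ℝ) → ℝ} (hf : Measurable f)
    (hi : Integrable (fun z => f (out (η, z), z.2)) (P₀.prod (stdGaussianPi Q))) :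
    ∫ z, f (out (η, z), z.2) ∂(P₀.prod (stdGaussianPi Q)) =
      ∫ s, ∫ e, f (s, e) ∂(noiseKernel P₀ hout (η, s)) ∂(outKernel P₀ out η) := by
  have := isMarkovKernel_outKernel (P₀ := P₀) hout
  have hm : Measurable fun z : Ξ × (Q → ℝ) => (out (η, z), z.2) :=
    (hout.comp measurable_prodMk_left).prodMk measurable_snd
  rw [← integral_map (f := f) hm.aemeasurable hf.aestronglyMeasurable]
  have hi' := (integrable_map_measure hf.aestronglyMeasurable hm.aemeasurable).2 hi
  rw [map_out_prodMk hout] at hi' ⊢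
  exact Measure.integral_compProd hi'

lemma ae_integrable_noise (hout : Measurable out) (η : X) {f : (Q → ℝ) → ℝ}
    (hi : Integrable f (stdGaussianPi Q)) (hf : Measurable f) :
    ∀ᵐ s ∂(outKernel P₀ out η), Integrable f (noiseKernel P₀ hout (η, s)) := by
  have := isMarkovKernel_outKernel (P₀ := P₀) hout
  have hm : Measurable fun z : Ξ × (Q → ℝ) => (out (η, z), z.2) :=
    (hout.comp measurable_prodMk_left).prodMk measurable_snd
  have h1 : Integrable (fun z : Ξ × (Q → ℝ) => f z.2) (P₀.prod (stdGaussianPi Q)) := hi.comp_snd P₀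
  have hi' := (integrable_map_measure (f := fun z : Ξ × (Q → ℝ) => (out (η, z), z.2))
    (g := fun p : S × (Q → ℝ) => f p.2) (hf.comp measurable_snd).aestronglyMeasurable hm.aemeasurable).2 h1
  rw [map_out_prodMk hout] at hi'
  exact ((Measure.integrable_compProd_iff hi'.1).1 hi').1

/-- The conditional expectation of the linear functional `linVec b` given the output. -/
noncomputable def scoreFun (b : Q → Vec m) (hout : Measurable out) (η : X) (s : S) : Vec m :=
  ∫ e, linVec b e ∂(noiseKernel P₀ hout (η, s))

lemma measurable_scoreFun (b : Q → Vec m) (hout : Measurable out) :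
    Measurable (Function.uncurry (scoreFun (P₀ := P₀) b hout)) := by
  have : StronglyMeasurable (Function.uncurry fun (_ : X × S) (e : Q → ℝ) => linVec b e) :=
    ((measurable_linVec b).comp measurable_snd).stronglyMeasurable
  exact this.integral_kernel_prod_right.measurable

/-- If moving the parameter amounts to shifting the Gaussian noise, then the score is the
conditional expectation of the linear functional of the shift directions. -/
theorem isScoreAt_scoreFun {b : Q → Vec m} (hb : Summable fun q => ‖b q‖ ^ 2)
    (hout : Measurable out) (η : X) (param : Vec m → X) (y : Vec m) (hy : param y = η)
    (hshift : ∀ y' ξ e, out (param y', ξ, e) = out (η, ξ, e + fun q => inner ℝ (b q) (y' - y))) :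
    IsScoreAt (fun y' => outKernel P₀ out (param y')) y (scoreFun (P₀ := P₀) b hout η) := by
  have := isMarkovKernel_outKernel (P₀ := P₀) hout
  have hexp := ae_integrable_noise (P₀ := P₀) hout η
    (integrable_exp_norm_linVec hb (c := 2) (by norm_num))
    (by have := measurable_linVec b; fun_prop)
  have hpmeas : ∀ h, Measurable fun s => ∫ e, shiftDensity b h e ∂(noiseKernel P₀ hout (η, s)) := by
    intro h
    have : StronglyMeasurable (Function.uncurry fun (_ : X × S) (e : Q → ℝ) => shiftDensity b h e) :=
      ((measurable_shiftDensity b h).comp measurable_snd).stronglyMeasurable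
    exact this.integral_kernel_prod_right.measurable.comp measurable_prodMk_left
  -- The law at the base point serves as dominating measure, and the density at `y'` is the
  -- Cameron–Martin density averaged over the noise given the output.
  refine ⟨outKernel P₀ out η, fun y' s => ∫ e, shiftDensity b (y' - y) e ∂(noiseKernel P₀ hout (η, s)),
    inferInstance, fun y' => hpmeas _, fun y' s => integral_nonneg fun e => (shiftDensity_pos b _ e).le,
    fun y' => ?_, ?_⟩
  · set h := y' - y
    have hint : Integrable (shiftDensity b h) (stdGaussianPi Q) := by
      refine ⟨(measurable_shiftDensity b h).aestronglyMeasurable, ?_⟩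
      rw [hasFiniteIntegral_iff_ofReal (Eventually.of_forall fun e => (shiftDensity_pos b h e).le)]
      have h1 := congrArg (fun ν => ν Set.univ) (map_add_inner hb h)
      simp only [withDensity_apply _ MeasurableSet.univ, Measure.restrict_univ] at h1
      rw [← h1]
      exact measure_lt_top _ _
    have hmadd : Measurable fun e : Q → ℝ => e + fun q => inner ℝ (b q) h := by fun_prop
    have hprod : (P₀.prod (stdGaussianPi Q)).map
        (fun z : Ξ × (Q → ℝ) => (z.1, z.2 + fun q => inner ℝ (b q) h)) =
        (P₀.prod (stdGaussianPi Q)).withDensity fun z => ENNReal.ofReal (shiftDensity b h z.2) := by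
      rw [← prod_withDensity_right (measurable_shiftDensity b h).ennreal_ofReal, ← map_add_inner hb h]
      have := Measure.map_prod_map P₀ (stdGaussianPi Q) measurable_id hmadd
      rw [Measure.map_id] at this
      rw [this]
      rfl
    have hmout : Measurable fun z : Ξ × (Q → ℝ) => out (η, z) := hout.comp measurable_prodMk_left
    ext A hA
    have h2 : (fun z : Ξ × (Q → ℝ) => out (param y', z)) =
        (fun z => out (η, z)) ∘ fun z => (z.1, z.2 + fun q => inner ℝ (b q) h) := by
      funext z
      exact hshift y' z.1 z.2
    beta_reduce
    rw [outKernel_apply hout (param y'), h2, ← Measure.map_map hmout (by fun_prop), hprod,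
      Measure.map_apply hmout hA, withDensity_apply _ (hmout hA), withDensity_apply _ hA]
    have hg : Measurable fun p : S × (Q → ℝ) =>
        A.indicator (fun _ => (1 : ℝ≥0∞)) p.1 * ENNReal.ofReal (shiftDensity b h p.2) :=
      ((measurable_const.indicator hA).comp measurable_fst).mul
        ((measurable_shiftDensity b h).ennreal_ofReal.comp measurable_snd)
    have h3 := lintegral_map (μ := P₀.prod (stdGaussianPi Q)) hg (hmout.prodMk measurable_snd)
    rw [map_out_prodMk hout, Measure.lintegral_compProd hg] at h3
    have h4 : ∫⁻ z in (fun z => out (η, z)) ⁻¹' A, ENNReal.ofReal (shiftDensity b h z.2)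
        ∂(P₀.prod (stdGaussianPi Q)) = ∫⁻ z, A.indicator (fun _ => (1 : ℝ≥0∞)) (out (η, z)) *
          ENNReal.ofReal (shiftDensity b h z.2) ∂(P₀.prod (stdGaussianPi Q)) := by
      rw [← lintegral_indicator (hmout hA)]
      refine lintegral_congr fun z => ?_
      by_cases hz : out (η, z) ∈ A
      · rw [Set.indicator_of_mem (show z ∈ (fun z => out (η, z)) ⁻¹' A from hz),
          Set.indicator_of_mem hz, one_mul]
      · rw [Set.indicator_of_notMem (show z ∉ (fun z => out (η, z)) ⁻¹' A from hz),
          Set.indicator_of_notMem hz, zero_mul]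
    rw [h4, ← h3, ← lintegral_indicator hA]
    refine lintegral_congr_ae ?_
    filter_upwards [ae_integrable_noise (P₀ := P₀) hout η hint (measurable_shiftDensity b h)] with s hs
    by_cases hsA : s ∈ A
    · simp only [Set.indicator_of_mem hsA, one_mul]
      rw [ofReal_integral_eq_lintegral_ofReal hs
        (Eventually.of_forall fun e => (shiftDensity_pos b h e).le)]
      rfl
    · simp [Set.indicator_of_notMem hsA]
  · beta_reduce
    rw [hy]
    -- One null set works for all `y'`: it is the set where the single function `exp(2‖linVec b‖)`
    -- fails to be integrable under the conditional law of the noise.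
    filter_upwards [hexp] with s hs
    exact hasGradientAt_log_integral_exp _ (measurable_linVec b) hs
      (g := fun h => ∑' q, inner ℝ (b q) h ^ 2) (tsum_nonneg fun q => sq_nonneg ‖b q‖)
      (fun h => tsum_nonneg fun q => sq_nonneg _) (tsum_inner_sq_le hb) y

end Score

/-! ### The second moment of the score -/

section SecondMoment

variable {X Q Ξ S : Type*} [MeasurableSpace X] [MeasurableSpace Ξ] [MeasurableSpace S] {m : ℕ}
  {P₀ : Measure Ξ} [IsProbabilityMeasure P₀] {out : X × Ξ × (Q → ℝ) → S}

lemma measurePreserving_out (hout : Measurable out) (η : X) :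
    MeasurePreserving (fun z : Ξ × (Q → ℝ) => out (η, z)) (P₀.prod (stdGaussianPi Q))
      (outKernel P₀ out η) :=
  ⟨hout.comp measurable_prodMk_left, (outKernel_apply hout η).symm⟩

lemma measurePreserving_snd_noise :
    MeasurePreserving (Prod.snd : Ξ × (Q → ℝ) → (Q → ℝ)) (P₀.prod (stdGaussianPi Q))
      (stdGaussianPi Q) :=
  measurePreserving_snd

/-- Conditional expectation given the output, of square-integrable functions of the noise. -/
noncomputable def condOut (P₀ : Measure Ξ) [IsProbabilityMeasure P₀] {out : X × Ξ × (Q → ℝ) → S}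
    (hout : Measurable out) (η : X) :
    Lp ℝ 2 (stdGaussianPi Q) →L[ℝ] Lp ℝ 2 (outKernel P₀ out η) :=
  (ContinuousLinearMap.adjoint (Lp.compMeasurePreservingₗᵢ ℝ _
      (measurePreserving_out (P₀ := P₀) hout η)).toContinuousLinearMap).comp
    (Lp.compMeasurePreservingₗᵢ ℝ _ (measurePreserving_snd_noise (P₀ := P₀))).toContinuousLinearMap

/-- Pairing the adjoint with the indicator of `A` gives the defining property of conditional
expectation given the output. -/
lemma setIntegral_condOut (hout : Measurable out) (η : X) (f : Lp ℝ 2 (stdGaussianPi Q)) {A : Set S}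
    (hA : MeasurableSet A) :
    ∫ s in A, condOut P₀ hout η f s ∂(outKernel P₀ out η) =
      ∫ z in (fun z => out (η, z)) ⁻¹' A, f z.2 ∂(P₀.prod (stdGaussianPi Q)) := by
  have := isMarkovKernel_outKernel (P₀ := P₀) hout
  have hAfin : outKernel P₀ out η A ≠ ∞ := measure_ne_top _ _
  rw [← L2.inner_indicatorConstLp_one (𝕜 := ℝ) hA hAfin, real_inner_comm, condOut,
    ContinuousLinearMap.comp_apply, ContinuousLinearMap.adjoint_inner_left]
  change inner ℝ (Lp.compMeasurePreserving Prod.snd _ f)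
    (Lp.compMeasurePreserving _ (measurePreserving_out (P₀ := P₀) hout η) (indicatorConstLp 2 hA hAfin 1)) = _
  have h1 := Lp.indicatorConstLp_compMeasurePreserving (p := 2) hA hAfin (1 : ℝ)
    (measurePreserving_out (P₀ := P₀) hout η)
  rw [h1, real_inner_comm, L2.inner_indicatorConstLp_one]
  refine setIntegral_congr_ae ((measurePreserving_out (P₀ := P₀) hout η).measurable hA) ?_
  filter_upwards [Lp.coeFn_compMeasurePreserving f (measurePreserving_snd_noise (P₀ := P₀))] with z hz _
  rw [hz]
  rfl

lemma integrable_Lp_two {α : Type*} [MeasurableSpace α] {ν : Measure α} [IsFiniteMeasure ν]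
    (f : Lp ℝ 2 ν) : Integrable f ν :=
  (Lp.memLp f).integrable (by norm_num)

lemma condOut_ae_eq (hout : Measurable out) (η : X) (f : Lp ℝ 2 (stdGaussianPi Q)) {g : S → ℝ}
    (hg : Integrable g (outKernel P₀ out η))
    (h : ∀ A, MeasurableSet A → ∫ z in (fun z => out (η, z)) ⁻¹' A, f z.2 ∂(P₀.prod (stdGaussianPi Q)) =
      ∫ s in A, g s ∂(outKernel P₀ out η)) :
    condOut P₀ hout η f =ᵐ[outKernel P₀ out η] g := by
  have := isMarkovKernel_outKernel (P₀ := P₀) hout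
  refine Integrable.ae_eq_of_forall_setIntegral_eq _ _ (integrable_Lp_two _) hg fun A hA _ => ?_
  rw [setIntegral_condOut hout η f hA, h A hA]

variable [Countable Q] [MeasurableSpace.CountablyGenerated S]

lemma integrable_linVec {b : Q → Vec m} (hb : Summable fun q => ‖b q‖ ^ 2) :
    Integrable (linVec b) (stdGaussianPi Q) :=
  integrable_of_integrable_exp_norm _ (measurable_linVec b)
    (integrable_exp_norm_linVec hb (by norm_num))

/-- Links the two descriptions of the score: the kernel integral, which is defined pointwise and was
needed for the gradient, and the bounded `L²` operator, which can be applied to a series term by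
term. -/
lemma condOut_linLp {b : Q → Vec m} (hb : Summable fun q => ‖b q‖ ^ 2) (hout : Measurable out)
    (η : X) (h : Vec m) :
    condOut P₀ hout η (linLp fun q => inner ℝ (b q) h) =ᵐ[outKernel P₀ out η]
      fun s => inner ℝ (scoreFun (P₀ := P₀) b hout η s) h := by
  have := isMarkovKernel_outKernel (P₀ := P₀) hout
  have hm : Measurable fun z : Ξ × (Q → ℝ) => out (η, z) := hout.comp measurable_prodMk_left
  have hlm := measurable_linVec b
  have hi : Integrable (fun e => inner ℝ (linVec b e) h) (stdGaussianPi Q) :=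
    (integrable_linVec hb).inner_const h
  have hi2 : Integrable (fun z : Ξ × (Q → ℝ) => inner ℝ (linVec b z.2) h)
      (P₀.prod (stdGaussianPi Q)) := hi.comp_snd P₀
  have hscore : (fun s => inner ℝ (scoreFun (P₀ := P₀) b hout η s) h) =ᵐ[outKernel P₀ out η]
      fun s => ∫ e, inner ℝ (linVec b e) h ∂(noiseKernel P₀ hout (η, s)) := by
    filter_upwards [ae_integrable_noise (P₀ := P₀) hout η (integrable_linVec hb).norm hlm.norm] with s hs
    have hs' : Integrable (linVec b) (noiseKernel P₀ hout (η, s)) :=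
      (integrable_norm_iff hlm.aestronglyMeasurable).1 hs
    rw [scoreFun, real_inner_comm, ← integral_inner hs']
    simp_rw [real_inner_comm]
  have hJ : Integrable (fun p : S × (Q → ℝ) => inner ℝ (linVec b p.2) h)
      (outKernel P₀ out η ⊗ₘ Kernel.sectR (noiseKernel P₀ hout) η) := by
    rw [← map_out_prodMk hout, integrable_map_measure (Measurable.aestronglyMeasurable (by fun_prop))
      (hm.prodMk measurable_snd).aemeasurable]
    exact hi2
  refine EventuallyEq.trans ?_ hscore.symm
  refine condOut_ae_eq hout η _ hJ.integral_compProd fun A hA => ?_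
  have h1 : ∫ z in (fun z => out (η, z)) ⁻¹' A, linLp (fun q => inner ℝ (b q) h) z.2
      ∂(P₀.prod (stdGaussianPi Q)) =
      ∫ z, A.indicator (fun _ => (1 : ℝ)) (out (η, z)) * inner ℝ (linVec b z.2) h
        ∂(P₀.prod (stdGaussianPi Q)) := by
    rw [← integral_indicator (hm hA)]
    refine integral_congr_ae ?_
    have := (measurePreserving_snd_noise (P₀ := P₀) (Q := Q)).quasiMeasurePreserving.ae_eq_comp
      (inner_linVec hb h)
    filter_upwards [this] with z hz
    simp only [Function.comp_apply] at hz
    by_cases hzA : out (η, z) ∈ A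
    · rw [Set.indicator_of_mem (show z ∈ (fun z => out (η, z)) ⁻¹' A from hzA),
        Set.indicator_of_mem hzA, one_mul, hz]
    · rw [Set.indicator_of_notMem (show z ∉ (fun z => out (η, z)) ⁻¹' A from hzA),
        Set.indicator_of_notMem hzA, zero_mul]
  have h2 := integral_out_noise (P₀ := P₀) hout η
    (f := fun p : S × (Q → ℝ) => A.indicator (fun _ => (1 : ℝ)) p.1 * inner ℝ (linVec b p.2) h)
    (((measurable_const.indicator hA).comp measurable_fst).mul (by fun_prop)) (by
      refine hi2.bdd_mul (c := 1)
        ((measurable_const.indicator hA).comp hm).aestronglyMeasurable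
        (Eventually.of_forall fun z => ?_)
      by_cases hz : out (η, z) ∈ A <;> simp [hz])
  rw [h1, h2, ← integral_indicator hA]
  refine integral_congr_ae (Eventually.of_forall fun s => ?_)
  simp only [integral_const_mul]
  by_cases hs : s ∈ A <;> simp [hs]

/-- The second moment of the score when the Gaussian coordinates have mutually orthogonal
conditional expectations `M q` given the output. -/
theorem hasSum_integral_scoreFun_sq {b : Q → Vec m} (hb : Summable fun q => ‖b q‖ ^ 2)
    (hout : Measurable out) (η : X) {M : Q → S → ℝ}
    (hM : ∀ q, MemLp (M q) 2 (outKernel P₀ out η))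
    (hcond : ∀ q A, MeasurableSet A →
      ∫ z in (fun z => out (η, z)) ⁻¹' A, z.2 q ∂(P₀.prod (stdGaussianPi Q)) =
        ∫ s in A, M q s ∂(outKernel P₀ out η))
    (horth : ∀ q q', q ≠ q' → ∫ s, M q s * M q' s ∂(outKernel P₀ out η) = 0) (h : Vec m) :
    MemLp (fun s => inner ℝ (scoreFun (P₀ := P₀) b hout η s) h) 2 (outKernel P₀ out η) ∧
      HasSum (fun q => inner ℝ (b q) h ^ 2 * ∫ s, M q s ^ 2 ∂(outKernel P₀ out η))
        (∫ s, inner ℝ (scoreFun (P₀ := P₀) b hout η s) h ^ 2 ∂(outKernel P₀ out η)) := by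
  have := isMarkovKernel_outKernel (P₀ := P₀) hout
  have hscore := condOut_linLp (P₀ := P₀) hb hout η h
  have hMq : ∀ q, condOut P₀ hout η (coordLp q) =ᵐ[outKernel P₀ out η] M q := fun q => by
    refine condOut_ae_eq hout η _ ((hM q).integrable (by norm_num)) fun A hA => ?_
    rw [← hcond q A hA]
    refine integral_congr_ae (ae_restrict_of_ae ?_)
    exact (measurePreserving_snd_noise (P₀ := P₀) (Q := Q)).quasiMeasurePreserving.ae_eq_comp
      (coordLp_coeFn q)
  set T := condOut P₀ hout η
  have hinner : ∀ q q', inner ℝ (T (coordLp q)) (T (coordLp q')) =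
      ∫ s, M q s * M q' s ∂(outKernel P₀ out η) := by
    intro q q'
    rw [L2.inner_def]
    refine integral_congr_ae ?_
    filter_upwards [hMq q, hMq q'] with s h1 h2
    simp [h1, h2, mul_comm]
  have hsum := (hasSum_linLp (summable_inner_sq hb h)).mapL T
  refine ⟨(Lp.memLp _).ae_eq hscore, ?_⟩
  have hval : ∫ s, inner ℝ (scoreFun (P₀ := P₀) b hout η s) h ^ 2 ∂(outKernel P₀ out η) =
      inner ℝ (T (linLp fun q => inner ℝ (b q) h)) (T (linLp fun q => inner ℝ (b q) h)) := by
    rw [L2.inner_def]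
    refine integral_congr_ae ?_
    filter_upwards [hscore] with s h1
    simp [h1, sq]
  rw [hval]
  have h3 := hsum.mapL (innerSL ℝ (T (linLp fun q => inner ℝ (b q) h)))
  simp only [innerSL_apply_apply] at h3
  refine h3.congr_fun ?_
  intro q
  -- Pairing the series with `T (coordLp q)` leaves, by orthogonality, only its `q`-th term.
  have h4 := hsum.mapL (innerSL ℝ (T (coordLp q)))
  simp only [innerSL_apply_apply, map_smul, hinner] at h4
  have h5 := h4.unique (hasSum_single q fun q' hq' => by rw [horth q q' hq'.symm, smul_zero])
  rw [map_smul, inner_smul_right, real_inner_comm (T (coordLp q)), h5, smul_eq_mul, ← mul_assoc,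
    ← sq]
  simp_rw [← sq]

end SecondMoment

/-! ### A Gaussian inequality -/

section GaussianInequality

lemma gaussianPDFReal_std (x : ℝ) :
    gaussianPDFReal 0 1 x = (√(2 * Real.pi))⁻¹ * Real.exp (-(x ^ 2 / 2)) := by
  rw [gaussianPDFReal]; congr 2 <;> simp [neg_div]

lemma integrableOn_id_gaussianPDFReal_and_integral_Ioi (u : ℝ) :
    IntegrableOn (fun x => x * gaussianPDFReal 0 1 x) (Set.Ioi u) ∧
      ∫ x in Set.Ioi u, x * gaussianPDFReal 0 1 x = gaussianPDFReal 0 1 u := by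
  have hd : ∀ x, HasDerivAt (fun x => -gaussianPDFReal 0 1 x) (x * gaussianPDFReal 0 1 x) x := by
    intro x
    have h : HasDerivAt (fun x : ℝ => -((√(2 * Real.pi))⁻¹ * Real.exp (-(x ^ 2 / 2))))
        (-((√(2 * Real.pi))⁻¹ * (Real.exp (-(x ^ 2 / 2)) * (-((2 * x) / 2))))) x := by
      have := ((((hasDerivAt_pow 2 x).div_const 2).neg).exp.const_mul (√(2 * Real.pi))⁻¹).neg
      simpa using! this
    have h2 : (fun x => -gaussianPDFReal 0 1 x) =
        fun x : ℝ => -((√(2 * Real.pi))⁻¹ * Real.exp (-(x ^ 2 / 2))) := by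
      funext x; rw [gaussianPDFReal_std]
    rw [h2, gaussianPDFReal_std]
    convert h using 1
    ring
  have hint : Integrable (fun x => x * gaussianPDFReal 0 1 x) := by
    have h := (memLp_id_gaussianReal (μ := 0) (v := 1) 1).integrable le_rfl
    rw [gaussianReal_of_var_ne_zero _ one_ne_zero,
      integrable_withDensity_iff_integrable_smul₀' (measurable_gaussianPDF _ _).aemeasurable
        (Eventually.of_forall fun _ => by simp [gaussianPDF])] at h
    refine h.congr (Eventually.of_forall fun x => ?_)
    simp [gaussianPDF, ENNReal.toReal_ofReal (gaussianPDFReal_nonneg 0 1 x), mul_comm]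
  have hlim : Tendsto (fun x => -gaussianPDFReal 0 1 x) atTop (𝓝 0) := by
    have h1 : Tendsto (fun x : ℝ => x ^ 2 / 2) atTop atTop :=
      (tendsto_pow_atTop two_ne_zero).atTop_div_const two_pos
    have h2 := ((Real.tendsto_exp_neg_atTop_nhds_zero.comp h1).const_mul (√(2 * Real.pi))⁻¹).neg
    simp only [mul_zero, neg_zero] at h2
    refine h2.congr fun x => ?_
    rw [gaussianPDFReal_std]; rfl
  refine ⟨hint.integrableOn, ?_⟩
  have := integral_Ioi_of_hasDerivAt_of_tendsto (a := u) (hd u).continuousAt.continuousWithinAt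
    (fun x _ => hd x) hint.integrableOn hlim
  rw [this]; ring

lemma setIntegral_Ioi_gaussianReal (u : ℝ) :
    ∫ x in Set.Ioi u, x ∂gaussianReal 0 1 = gaussianPDFReal 0 1 u := by
  rw [← (integrableOn_id_gaussianPDFReal_and_integral_Ioi u).2, ← integral_indicator measurableSet_Ioi,
    integral_gaussianReal_eq_integral_smul one_ne_zero, ← integral_indicator measurableSet_Ioi]
  refine integral_congr_ae (Eventually.of_forall fun x => ?_)
  by_cases h : x ∈ Set.Ioi u <;> simp [h, mul_comm]

lemma integrable_id_gaussianReal : Integrable (fun x : ℝ => x) (gaussianReal 0 1) :=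
  (memLp_id_gaussianReal (μ := 0) (v := 1) 1).integrable le_rfl

lemma setIntegral_Iic_gaussianReal (u : ℝ) :
    ∫ x in Set.Iic u, x ∂gaussianReal 0 1 = -gaussianPDFReal 0 1 u := by
  have h := integral_add_compl (μ := gaussianReal 0 1) (measurableSet_Iic (a := u))
    integrable_id_gaussianReal
  rw [Set.compl_Iic, setIntegral_Ioi_gaussianReal] at h
  have h2 : ∫ x, x ∂gaussianReal 0 1 = 0 := integral_id_gaussianReal
  linarith

lemma real_Ioi_gaussianReal (u : ℝ) :
    (gaussianReal 0 1).real (Set.Ioi u) = 1 - (gaussianReal 0 1).real (Set.Iic u) := by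
  rw [← Set.compl_Iic, probReal_compl_eq_one_sub measurableSet_Iic]

lemma real_Iic_neg_gaussianReal (u : ℝ) :
    (gaussianReal 0 1).real (Set.Iic (-u)) = (gaussianReal 0 1).real (Set.Ioi u) := by
  have := nullSingletonClass_gaussianReal (μ := 0) (v := 1) one_ne_zero
  have h : (gaussianReal 0 1).map (fun x => -x) = gaussianReal 0 1 := by
    rw [gaussianReal_map_neg, neg_zero]
  conv_lhs => rw [← h]
  rw [map_measureReal_apply measurable_neg measurableSet_Iic]
  have : (fun x : ℝ => -x) ⁻¹' Set.Iic (-u) = Set.Ici u := by ext; simp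
  rw [this]
  exact measureReal_congr Ioi_ae_eq_Ici.symm

/-- The two-dimensional standard Gaussian mass of the complement of a disc. -/
lemma gaussianReal_prod_compl_disc {u : ℝ} (hu : 0 ≤ u) :
    ((gaussianReal 0 1).prod (gaussianReal 0 1)) {p : ℝ × ℝ | 2 * u ^ 2 < p.1 ^ 2 + p.2 ^ 2} =
      ENNReal.ofReal (Real.exp (-u ^ 2)) := by
  have hB : MeasurableSet {p : ℝ × ℝ | 2 * u ^ 2 < p.1 ^ 2 + p.2 ^ 2} :=
    measurableSet_lt (by fun_prop) (by fun_prop)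
  have hm := measurable_gaussianPDF 0 1
  rw [gaussianReal_of_var_ne_zero _ one_ne_zero, prod_withDensity hm hm, withDensity_apply _ hB,
    ← lintegral_indicator hB]
  change ∫⁻ p, _ ∂(volume : Measure (ℝ × ℝ)) = _
  rw [← lintegral_comp_polarCoord_symm]
  have hdens : ∀ x y : ℝ, gaussianPDF 0 1 x * gaussianPDF 0 1 y =
      ENNReal.ofReal ((2 * Real.pi)⁻¹ * Real.exp (-((x ^ 2 + y ^ 2) / 2))) := by
    intro x y
    rw [gaussianPDF, gaussianPDF, ← ENNReal.ofReal_mul (gaussianPDFReal_nonneg _ _ _),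
      gaussianPDFReal_std, gaussianPDFReal_std]
    congr 1
    have h1 : (√(2 * Real.pi))⁻¹ * (√(2 * Real.pi))⁻¹ = (2 * Real.pi)⁻¹ := by
      rw [← mul_inv, Real.mul_self_sqrt (by positivity)]
    have h2 : Real.exp (-((x ^ 2 + y ^ 2) / 2)) = Real.exp (-(x ^ 2 / 2)) * Real.exp (-(y ^ 2 / 2)) := by
      rw [← Real.exp_add]; congr 1; ring
    rw [← h1, h2]; ring
  have hsqrt : 0 ≤ √2 * u := by positivity
  -- In polar coordinates the integrand depends on the radius alone, and the region becomes `r > √2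
  -- u`.
  have hpoint : ∀ p ∈ polarCoord.target, ENNReal.ofReal p.1 • Set.indicator
      {p : ℝ × ℝ | 2 * u ^ 2 < p.1 ^ 2 + p.2 ^ 2}
      (fun z : ℝ × ℝ => gaussianPDF 0 1 z.1 * gaussianPDF 0 1 z.2) (polarCoord.symm p) =
      (Set.Ioi (√2 * u)).indicator (fun r => ENNReal.ofReal ((√(2 * Real.pi))⁻¹ *
        (r * gaussianPDFReal 0 1 r))) p.1 := by
    intro p hp
    rw [polarCoord_target] at hp
    have hr : 0 < p.1 := hp.1
    have hsq : (p.1 * Real.cos p.2) ^ 2 + (p.1 * Real.sin p.2) ^ 2 = p.1 ^ 2 := by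
      have := Real.cos_sq_add_sin_sq p.2
      nlinarith
    have hiff : 2 * u ^ 2 < p.1 ^ 2 ↔ √2 * u < p.1 := by
      rw [← pow_lt_pow_iff_left₀ hsqrt hr.le two_ne_zero, mul_pow, Real.sq_sqrt (by norm_num)]
    rw [polarCoord_symm_apply]
    by_cases h : √2 * u < p.1
    · rw [Set.indicator_of_mem (by simpa [hsq] using hiff.2 h), Set.indicator_of_mem (by exact h)]
      simp only
      rw [hdens, hsq, smul_eq_mul, ← ENNReal.ofReal_mul hr.le, gaussianPDFReal_std]
      congr 1
      have h1 : (√(2 * Real.pi))⁻¹ * (√(2 * Real.pi))⁻¹ = (2 * Real.pi)⁻¹ := by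
        rw [← mul_inv, Real.mul_self_sqrt (by positivity)]
      rw [← h1]; ring
    · rw [Set.indicator_of_notMem (by simpa [hsq] using not_lt.1 fun h' => h (hiff.1 h')),
        Set.indicator_of_notMem (by exact h), smul_zero]
  rw [setLIntegral_congr_fun polarCoord.open_target.measurableSet hpoint, polarCoord_target,
    Measure.volume_eq_prod, ← Measure.prod_restrict]
  have hmeas : Measurable fun r => ENNReal.ofReal ((√(2 * Real.pi))⁻¹ * (r * gaussianPDFReal 0 1 r)) := by
    have := measurable_gaussianPDFReal 0 1
    fun_prop
  have hfac := lintegral_prod_mul (μ := volume.restrict (Set.Ioi (0 : ℝ)))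
    (ν := volume.restrict (Set.Ioo (-Real.pi) Real.pi)) (hmeas.indicator
      (measurableSet_Ioi (a := √2 * u))).aemeasurable (g := fun _ => 1) aemeasurable_const
  simp only [mul_one, lintegral_const, Measure.restrict_apply MeasurableSet.univ, Set.univ_inter,
    one_mul, Real.volume_Ioo] at hfac
  have hinter : Set.Ioi (√2 * u) ∩ Set.Ioi 0 = Set.Ioi (√2 * u) :=
    Set.inter_eq_left.2 (Set.Ioi_subset_Ioi hsqrt)
  obtain ⟨hi, hval⟩ := integrableOn_id_gaussianPDFReal_and_integral_Ioi (√2 * u)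
  rw [hfac, lintegral_indicator measurableSet_Ioi, Measure.restrict_restrict measurableSet_Ioi, hinter,
    ← ofReal_integral_eq_lintegral_ofReal (hi.const_mul _) ?_, integral_const_mul, hval,
    ← ENNReal.ofReal_mul ?_, gaussianPDFReal_std]
  · congr 1
    have h1 : (√(2 * Real.pi))⁻¹ * (√(2 * Real.pi))⁻¹ = (2 * Real.pi)⁻¹ := by
      rw [← mul_inv, Real.mul_self_sqrt (by positivity)]
    have h2 : (√2 * u) ^ 2 / 2 = u ^ 2 := by
      rw [mul_pow, Real.sq_sqrt (by norm_num)]; ring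
    rw [← mul_assoc, h1, h2]
    have := Real.pi_pos
    field_simp
    ring
  · have := gaussianPDFReal_nonneg 0 1 (√2 * u)
    positivity
  · refine (ae_restrict_mem measurableSet_Ioi).mono fun r hr => ?_
    have := gaussianPDFReal_nonneg 0 1 r
    have : 0 ≤ r := hsqrt.trans (le_of_lt hr)
    simp only [Pi.zero_apply]
    positivity

/-- With `p = F(u)`, the claim reads `exp(-u²) ≤ 4p(1 - p) = 1 - (2p - 1)²` for `u ≥ 0`. In the
plane the right side is the Gaussian mass outside the square `[-u, u]²`, the left side the mass
outside the disc of radius `√2 u`, and the square lies in the disc. -/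
lemma sq_gaussianPDFReal_le (u : ℝ) : gaussianPDFReal 0 1 u ^ 2 ≤
    2 / Real.pi * ((gaussianReal 0 1).real (Set.Iic u) * (gaussianReal 0 1).real (Set.Ioi u)) := by
  wlog hu : 0 ≤ u generalizing u
  · have h := this (-u) (by linarith)
    rw [real_Iic_neg_gaussianReal] at h
    have h1 : (gaussianReal 0 1).real (Set.Ioi (-u)) = (gaussianReal 0 1).real (Set.Iic u) := by
      rw [← real_Iic_neg_gaussianReal, neg_neg]
    have h2 : gaussianPDFReal 0 1 (-u) = gaussianPDFReal 0 1 u := by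
      simp [gaussianPDFReal_std]
    rw [h1, h2] at h
    linarith
  set p := (gaussianReal 0 1).real (Set.Iic u) with hp
  have hsq : (gaussianReal 0 1).real (Set.Icc (-u) u) = 2 * p - 1 := by
    have := nullSingletonClass_gaussianReal (μ := 0) (v := 1) one_ne_zero
    have h1 : (gaussianReal 0 1).real (Set.Icc (-u) u) = (gaussianReal 0 1).real (Set.Ioc (-u) u) :=
      measureReal_congr Ioc_ae_eq_Icc.symm
    have h2 : Set.Ioc (-u) u = Set.Iic u \ Set.Iic (-u) := by ext; simp [and_comm]
    rw [h1, h2, measureReal_sdiff (Set.Iic_subset_Iic.2 (by linarith)) measurableSet_Iic,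
      real_Iic_neg_gaussianReal, real_Ioi_gaussianReal]
    ring
  have hdisc : Real.exp (-u ^ 2) ≤ 1 - (2 * p - 1) ^ 2 := by
    have h1 : ((gaussianReal 0 1).prod (gaussianReal 0 1)).real
        {p : ℝ × ℝ | 2 * u ^ 2 < p.1 ^ 2 + p.2 ^ 2} = Real.exp (-u ^ 2) := by
      rw [measureReal_def, gaussianReal_prod_compl_disc hu, ENNReal.toReal_ofReal (by positivity)]
    have h2 : ((gaussianReal 0 1).prod (gaussianReal 0 1)).real
        ((Set.Icc (-u) u) ×ˢ (Set.Icc (-u) u))ᶜ = 1 - (2 * p - 1) ^ 2 := by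
      rw [probReal_compl_eq_one_sub (measurableSet_Icc.prod measurableSet_Icc), measureReal_prod_prod,
        hsq, sq]
    rw [← h1, ← h2]
    refine measureReal_mono ?_
    rintro ⟨x, y⟩ hxy ⟨hx, hy⟩
    simp only [Set.mem_ofPred_eq] at hxy
    have := sq_le_sq' hx.1 hx.2
    have := sq_le_sq' hy.1 hy.2
    linarith
  rw [real_Ioi_gaussianReal, ← hp, gaussianPDFReal_std, mul_pow, inv_pow,
    Real.sq_sqrt (by positivity), ← Real.exp_nat_mul]
  have h3 : ((2 : ℕ) : ℝ) * -(u ^ 2 / 2) = -u ^ 2 := by push_cast; ring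
  rw [h3]
  calc (2 * Real.pi)⁻¹ * Real.exp (-u ^ 2) ≤ (2 * Real.pi)⁻¹ * (1 - (2 * p - 1) ^ 2) := by gcongr
    _ = 2 / Real.pi * (p * (1 - p)) := by field_simp; ring

/-- The density is positive, so the preceding inequality cannot have a vanishing right-hand side. -/
lemma real_Iic_gaussianReal_pos (u : ℝ) : 0 < (gaussianReal 0 1).real (Set.Iic u) := by
  by_contra h
  have h0 : (gaussianReal 0 1).real (Set.Iic u) = 0 := le_antisymm (not_lt.1 h) measureReal_nonneg
  have := sq_gaussianPDFReal_le u
  have := pow_pos (gaussianPDFReal_pos 0 1 u one_ne_zero) 2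
  simp_all

lemma real_Ioi_gaussianReal_pos (u : ℝ) : 0 < (gaussianReal 0 1).real (Set.Ioi u) := by
  rw [← real_Iic_neg_gaussianReal]
  exact real_Iic_gaussianReal_pos _

end GaussianInequality

/-! ### Lower bound for `η` in terms of the variance -/

section EtaBound

lemma gaussianReal_eq_map_std (c : ℝ) (v : ℝ≥0) :
    gaussianReal c v = (gaussianReal 0 1).map fun x => √v * x + c := by
  have h1 : (fun x : ℝ => √v * x + c) = (fun x => x + c) ∘ fun x => √v * x := rfl
  rw [h1, ← Measure.map_map (by fun_prop) (by fun_prop), gaussianReal_map_const_mul,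
    gaussianReal_map_add_const]
  congr 1
  · simp
  · ext; simp

lemma cdf_gaussianReal (c : ℝ) {v : ℝ≥0} (hv : v ≠ 0) (x : ℝ) :
    cdf (gaussianReal c v) x = (gaussianReal 0 1).real (Set.Iic ((x - c) / √v)) := by
  have hs : 0 < √(v : ℝ) := Real.sqrt_pos.2 (by positivity)
  rw [cdf_eq_real, gaussianReal_eq_map_std, map_measureReal_apply (by fun_prop) measurableSet_Iic]
  congr 1
  ext y
  simp only [Set.mem_preimage, Set.mem_Iic]
  rw [le_div_iff₀ hs, mul_comm]
  constructor <;> intro h <;> linarith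

lemma gaussianPDFReal_eq_std (c : ℝ) (v : ℝ≥0) (x : ℝ) :
    gaussianPDFReal c v x = (√v)⁻¹ * gaussianPDFReal 0 1 ((x - c) / √v) := by
  rw [gaussianPDFReal_std, gaussianPDFReal, Real.sqrt_mul (by positivity), mul_inv, div_pow,
    Real.sq_sqrt (by positivity), mul_comm (√(2 * Real.pi))⁻¹, mul_assoc]
  congr 3
  rw [neg_div, div_div, mul_comm (2 : ℝ)]

lemma etaGaussian_term_le (c : ℝ) {v : ℝ≥0} (hv : v ≠ 0) (x : ℝ) :
    gaussianPDFReal c v x ^ 2 /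
      (cdf (gaussianReal c v) x * (1 - cdf (gaussianReal c v) x)) ≤ 2 / Real.pi / v := by
  rw [cdf_gaussianReal c hv, ← real_Ioi_gaussianReal, gaussianPDFReal_eq_std, mul_pow, inv_pow,
    Real.sq_sqrt (by positivity), div_le_iff₀
      (mul_pos (real_Iic_gaussianReal_pos _) (real_Ioi_gaussianReal_pos _)), div_eq_mul_inv _ (v : ℝ),
    mul_comm _ (v : ℝ)⁻¹, mul_assoc]
  exact mul_le_mul_of_nonneg_left (sq_gaussianPDFReal_le _) (by positivity)

/-- Evaluate at the mean, where `F = 1/2` and `f² = 1 / (2πv)`. The upper bound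
`etaGaussian_term_le` is needed for the real supremum to be a genuine one. -/
lemma two_div_pi_div_le_etaGaussian (c : ℝ) {v : ℝ≥0} (hv : v ≠ 0) :
    2 / Real.pi / v ≤ etaGaussian c v := by
  have hbdd : BddAbove (Set.range fun x : ℝ => gaussianPDFReal c v x ^ 2 /
      (cdf (gaussianReal c v) x * (1 - cdf (gaussianReal c v) x))) :=
    ⟨2 / Real.pi / v, by rintro _ ⟨x, rfl⟩; exact etaGaussian_term_le c hv x⟩
  refine le_trans (le_of_eq ?_) (le_ciSup hbdd c)
  have h1 : (gaussianReal 0 1).real (Set.Iic (0 : ℝ)) = 1 / 2 := by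
    have h2 := real_Iic_neg_gaussianReal 0
    rw [neg_zero, real_Ioi_gaussianReal] at h2
    linarith
  rw [cdf_gaussianReal c hv, gaussianPDFReal_eq_std, sub_self, zero_div, h1, gaussianPDFReal_std,
    mul_pow, mul_pow, inv_pow, inv_pow, Real.sq_sqrt (by positivity), Real.sq_sqrt (by positivity)]
  have := Real.pi_pos
  have : (v : ℝ) ≠ 0 := by exact_mod_cast hv
  norm_num
  field_simp
  norm_num

end EtaBound

/-! ### Conditional means of one Gaussian coordinate -/

section HalfMean

/-- The conditional mean of a standard Gaussian variable given on which side of `u` it lies. -/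
noncomputable def halfMean (u x : ℝ) : ℝ :=
  if x ≤ u then -gaussianPDFReal 0 1 u / (gaussianReal 0 1).real (Set.Iic u)
  else gaussianPDFReal 0 1 u / (gaussianReal 0 1).real (Set.Ioi u)

lemma integral_eq_Iic_add_Ioi {f : ℝ → ℝ} (hf : Integrable f (gaussianReal 0 1)) (u : ℝ) :
    ∫ x, f x ∂gaussianReal 0 1 =
      ∫ x in Set.Iic u, f x ∂gaussianReal 0 1 + ∫ x in Set.Ioi u, f x ∂gaussianReal 0 1 := by
  rw [← Set.compl_Iic, integral_add_compl measurableSet_Iic hf]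

lemma measurable_of_sides {u : ℝ} {f : ℝ → ℝ} {c c' : ℝ} (h1 : ∀ x ≤ u, f x = c)
    (h2 : ∀ x, u < x → f x = c') : Measurable f := by
  have : f = fun x => if x ≤ u then c else c' := by
    funext x
    split_ifs with h
    · exact h1 x h
    · exact h2 x (not_le.1 h)
  rw [this]
  exact Measurable.ite measurableSet_Iic measurable_const measurable_const

lemma integrable_of_sides {u : ℝ} {f : ℝ → ℝ} {c c' : ℝ} (h1 : ∀ x ≤ u, f x = c)
    (h2 : ∀ x, u < x → f x = c') : Integrable f (gaussianReal 0 1) := by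
  refine Integrable.of_bound (measurable_of_sides h1 h2).aestronglyMeasurable (max |c| |c'|)
    (Eventually.of_forall fun x => ?_)
  rcases le_or_gt x u with h | h
  · rw [h1 x h]; exact le_max_left _ _
  · rw [h2 x h]; exact le_max_right _ _

lemma integral_sides {u : ℝ} {f : ℝ → ℝ} {c c' : ℝ} (h1 : ∀ x ≤ u, f x = c)
    (h2 : ∀ x, u < x → f x = c') : ∫ x, f x ∂gaussianReal 0 1 =
      c * (gaussianReal 0 1).real (Set.Iic u) + c' * (gaussianReal 0 1).real (Set.Ioi u) := by
  rw [integral_eq_Iic_add_Ioi (integrable_of_sides h1 h2) u,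
    setIntegral_congr_fun measurableSet_Iic (g := fun _ => c) fun x hx => h1 x hx,
    setIntegral_congr_fun measurableSet_Ioi (g := fun _ => c') fun x hx => h2 x hx]
  simp [mul_comm]

lemma halfMean_of_le {u x : ℝ} (h : x ≤ u) :
    halfMean u x = -gaussianPDFReal 0 1 u / (gaussianReal 0 1).real (Set.Iic u) := if_pos h

lemma halfMean_of_lt {u x : ℝ} (h : u < x) :
    halfMean u x = gaussianPDFReal 0 1 u / (gaussianReal 0 1).real (Set.Ioi u) :=
  if_neg (not_le.2 h)

/-- A function of the side alone takes two values, and on each side the integral of `x` is `∓` the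
density at `u`. -/
lemma integral_mul_halfMean {u : ℝ} {f : ℝ → ℝ} (hf : ∀ x x', (x ≤ u ↔ x' ≤ u) → f x = f x') :
    ∫ x, f x * x ∂gaussianReal 0 1 = ∫ x, f x * halfMean u x ∂gaussianReal 0 1 := by
  have h1 : ∀ x ≤ u, f x = f u := fun x hx => hf _ _ (by simp [hx])
  have h2 : ∀ x, u < x → f x = f (u + 1) := fun x hx =>
    hf _ _ (by simp [not_le.2 hx, not_le.2 (lt_add_one u)])
  have hval := integral_sides (u := u) (f := fun x => f x * halfMean u x) (c := f u * (-gaussianPDFReal 0 1 u / (gaussianReal 0 1).real (Set.Iic u)))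
    (c' := f (u + 1) * (gaussianPDFReal 0 1 u / (gaussianReal 0 1).real (Set.Ioi u)))
    (fun x hx => by simp only [h1 x hx, halfMean_of_le hx])
    (fun x hx => by simp only [h2 x hx, halfMean_of_lt hx])
  have hint : Integrable (fun x => f x * x) (gaussianReal 0 1) := by
    refine integrable_id_gaussianReal.bdd_mul (c := max |f u| |f (u + 1)|)
      (measurable_of_sides h1 h2).aestronglyMeasurable (Eventually.of_forall fun x => ?_)
    rcases le_or_gt x u with h | h
    · rw [h1 x h]; exact le_max_left _ _
    · rw [h2 x h]; exact le_max_right _ _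
  rw [hval, integral_eq_Iic_add_Ioi hint u,
    setIntegral_congr_fun measurableSet_Iic (g := fun x => f u * x) fun x hx => by
      simp only [h1 x hx],
    setIntegral_congr_fun measurableSet_Ioi (g := fun x => f (u + 1) * x) fun x hx => by
      simp only [h2 x hx],
    integral_const_mul, integral_const_mul, setIntegral_Iic_gaussianReal, setIntegral_Ioi_gaussianReal,
    mul_assoc, mul_assoc, div_mul_cancel₀ _ (real_Iic_gaussianReal_pos u).ne',
    div_mul_cancel₀ _ (real_Ioi_gaussianReal_pos u).ne']

/-- With `p` and `q` the masses of the two sides, the second moment is `f(u)² (1/p + 1/q) = f(u)² /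
(pq)`. -/
lemma integral_halfMean_sq_le (u : ℝ) :
    ∫ x, halfMean u x ^ 2 ∂gaussianReal 0 1 ≤ 2 / Real.pi := by
  have hp := real_Iic_gaussianReal_pos u
  have hq := real_Ioi_gaussianReal_pos u
  rw [integral_sides (fun x hx => by rw [halfMean_of_le hx]) (fun x hx => by rw [halfMean_of_lt hx])]
  have h := sq_gaussianPDFReal_le u
  have h1 : (gaussianReal 0 1).real (Set.Iic u) + (gaussianReal 0 1).real (Set.Ioi u) = 1 := by
    rw [real_Ioi_gaussianReal]; ring
  set p := (gaussianReal 0 1).real (Set.Iic u)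
  set q := (gaussianReal 0 1).real (Set.Ioi u)
  have h2 : (-gaussianPDFReal 0 1 u / p) ^ 2 * p + (gaussianPDFReal 0 1 u / q) ^ 2 * q =
      gaussianPDFReal 0 1 u ^ 2 * (p + q) / (p * q) := by
    field_simp
    ring
  rw [h2, h1, mul_one, div_le_iff₀ (by positivity)]
  exact h

lemma integrable_halfMean_sq (u : ℝ) :
    Integrable (fun x => halfMean u x ^ 2) (gaussianReal 0 1) :=
  integrable_of_sides (fun x hx => by rw [halfMean_of_le hx]) (fun x hx => by rw [halfMean_of_lt hx])

lemma measurable_halfMean : Measurable fun p : ℝ × ℝ => halfMean p.1 p.2 := by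
  have h1 : Measurable fun u : ℝ => (gaussianReal 0 1).real (Set.Iic u) := by
    have : Monotone fun u : ℝ => (gaussianReal 0 1).real (Set.Iic u) := fun u u' h =>
      measureReal_mono (Set.Iic_subset_Iic.2 h)
    exact this.measurable
  have h2 : Measurable fun u : ℝ => (gaussianReal 0 1).real (Set.Ioi u) := by
    simp_rw [real_Ioi_gaussianReal]
    exact measurable_const.sub h1
  have h3 := measurable_gaussianPDFReal 0 1
  unfold halfMean
  exact Measurable.ite (measurableSet_le measurable_snd measurable_fst)
    ((h3.neg.div h1).comp measurable_fst) ((h3.div h2).comp measurable_fst)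

end HalfMean

/-! ### Second moment of the score from coordinatewise conditional means -/

section CoordinateMeans

variable {X Q Ξ S : Type*} [DecidableEq Q] [MeasurableSpace X] [MeasurableSpace Ξ] [MeasurableSpace S]
  {m : ℕ} {P₀ : Measure Ξ} [IsProbabilityMeasure P₀]

/-- `M q` computes the mean of the `q`-th Gaussian coordinate given the value of `stat`, even
when the remaining randomness is fixed, with a conditional variance at most one; and of two
different coordinates, at least one does not influence the conditional mean of the other one. -/
structure IsCoordMean (stat : Ξ → (Q → ℝ) → S) (M : Q → S → ℝ) : Prop where
  measurable : ∀ q, Measurable (M q)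
  integral_eq : ∀ q ξ e (f : S → ℝ), ∫ x, f (stat ξ (Function.update e q x)) * x ∂gaussianReal 0 1 =
    ∫ x, f (stat ξ (Function.update e q x)) * M q (stat ξ (Function.update e q x)) ∂gaussianReal 0 1
  integrable_sq : ∀ q ξ e,
    Integrable (fun x => M q (stat ξ (Function.update e q x)) ^ 2) (gaussianReal 0 1)
  integral_sq_le : ∀ q ξ e, ∫ x, M q (stat ξ (Function.update e q x)) ^ 2 ∂gaussianReal 0 1 ≤ 1
  causal : ∀ q q', q ≠ q' →
    (∀ ξ e x, M q' (stat ξ (Function.update e q x)) = M q' (stat ξ e)) ∨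
    (∀ ξ e x, M q (stat ξ (Function.update e q' x)) = M q (stat ξ e))

lemma lintegral_update (q : Q) {F : Ξ × (Q → ℝ) → ℝ≥0∞} (hF : Measurable F) :
    ∫⁻ z, F z ∂(P₀.prod (stdGaussianPi Q)) =
      ∫⁻ z, ∫⁻ x, F (z.1, Function.update z.2 q x) ∂gaussianReal 0 1
        ∂(P₀.prod (stdGaussianPi Q)) := by
  have h1 : MeasurePreserving
      (fun w : Ξ × ((Q → ℝ) × ℝ) => (w.1, Function.update w.2.1 q w.2.2))
      (P₀.prod ((stdGaussianPi Q).prod (gaussianReal 0 1))) (P₀.prod (stdGaussianPi Q)) :=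
    (MeasurePreserving.id P₀).prod (measurePreserving_update q)
  have h2 : MeasurePreserving (MeasurableEquiv.prodAssoc : (Ξ × (Q → ℝ)) × ℝ ≃ᵐ _)
      ((P₀.prod (stdGaussianPi Q)).prod (gaussianReal 0 1))
      (P₀.prod ((stdGaussianPi Q).prod (gaussianReal 0 1))) :=
    ⟨MeasurableEquiv.measurable _, Measure.prodAssoc_prod⟩
  have h3 := h1.comp h2
  rw [← h3.lintegral_comp hF]
  exact lintegral_prod _ (hF.comp h3.measurable).aemeasurable

variable {out : X × Ξ × (Q → ℝ) → S} {M : Q → S → ℝ} {η : X}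

lemma IsCoordMean.memLp_comp (hout : Measurable out)
    (hM : IsCoordMean (fun ξ e => out (η, ξ, e)) M) (q : Q) :
    MemLp (fun z => M q (out (η, z))) 2 (P₀.prod (stdGaussianPi Q)) := by
  have hm : Measurable fun z : Ξ × (Q → ℝ) => M q (out (η, z)) :=
    (hM.measurable q).comp (hout.comp measurable_prodMk_left)
  refine (memLp_two_iff_integrable_sq hm.aestronglyMeasurable).2
    ⟨(hm.pow_const 2).aestronglyMeasurable, ?_⟩
  rw [hasFiniteIntegral_iff_ofReal (Eventually.of_forall fun _ => sq_nonneg _),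
    lintegral_update q (hm.pow_const 2).ennreal_ofReal]
  refine lt_of_le_of_lt (lintegral_mono (g := fun _ => 1) fun z => ?_) (by simp)
  rw [← ofReal_integral_eq_lintegral_ofReal (hM.integrable_sq q z.1 z.2)
    (Eventually.of_forall fun _ => sq_nonneg _)]
  exact ENNReal.ofReal_le_one.2 (hM.integral_sq_le q z.1 z.2)

lemma IsCoordMean.integral_sq_eq (hout : Measurable out)
    (hM : IsCoordMean (fun ξ e => out (η, ξ, e)) M) (q : Q) :
    ∫ s, M q s ^ 2 ∂(outKernel P₀ out η) =
      ∫ z, ∫ x, M q (out (η, z.1, Function.update z.2 q x)) ^ 2 ∂gaussianReal 0 1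
        ∂(P₀.prod (stdGaussianPi Q)) := by
  have hmp := measurePreserving_out (P₀ := P₀) hout η
  rw [← hmp.map_eq, integral_map hmp.measurable.aemeasurable
    ((hM.measurable q).pow_const 2).aestronglyMeasurable]
  exact integral_update P₀ q (hM.memLp_comp hout q).integrable_sq

/-- Integrate first over the coordinate on which the other conditional mean does not depend; the
factor that remains inside has mean zero in its own coordinate. -/
lemma IsCoordMean.integral_mul_eq_zero (hout : Measurable out)
    (hM : IsCoordMean (fun ξ e => out (η, ξ, e)) M) {q q' : Q} (h : q ≠ q') :
    ∫ s, M q s * M q' s ∂(outKernel P₀ out η) = 0 := by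
  have key : ∀ q q' : Q, (∀ ξ e x, M q' (out (η, ξ, Function.update e q x)) = M q' (out (η, ξ, e))) →
      ∫ s, M q s * M q' s ∂(outKernel P₀ out η) = 0 := by
    intro q q' hqq'
    have hmp := measurePreserving_out (P₀ := P₀) hout η
    have h1 := integral_map (μ := P₀.prod (stdGaussianPi Q)) (f := fun s => M q s * M q' s)
      hmp.measurable.aemeasurable ((hM.measurable q).mul (hM.measurable q')).aestronglyMeasurable
    rw [hmp.map_eq] at h1
    have h2 := integral_update P₀ q (F := fun z => M q (out (η, z)) * M q' (out (η, z)))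
      ((hM.memLp_comp hout q).integrable_mul (hM.memLp_comp hout q'))
    rw [h1, h2]
    refine integral_eq_zero_of_ae (Eventually.of_forall fun z => ?_)
    simp only [hqq', integral_mul_const]
    -- Testing with the constant `1` shows that `M q` and the coordinate have the same mean, namely
    -- zero.
    have := hM.integral_eq q z.1 z.2 fun _ => 1
    simp only [one_mul] at this
    rw [← this]
    simp [integral_id_gaussianReal]
  rcases hM.causal q q' h with h1 | h1
  · exact key q q' h1
  · simp_rw [mul_comm (M q _)]
    exact key q' q h1

/-- Resampling the `q`-th coordinate reduces this to `integral_eq` with the indicator of `A` as test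
function; it identifies `M q` as the conditional mean given the output. -/
lemma IsCoordMean.setIntegral_eq (hout : Measurable out)
    (hM : IsCoordMean (fun ξ e => out (η, ξ, e)) M) (q : Q) {A : Set S} (hA : MeasurableSet A) :
    ∫ z in (fun z => out (η, z)) ⁻¹' A, z.2 q ∂(P₀.prod (stdGaussianPi Q)) =
      ∫ s in A, M q s ∂(outKernel P₀ out η) := by
  have hmp := measurePreserving_out (P₀ := P₀) hout η
  have hind : ∀ g : Ξ × (Q → ℝ) → ℝ, ((fun z => out (η, z)) ⁻¹' A).indicator g =
      fun z => A.indicator (fun _ => (1 : ℝ)) (out (η, z)) * g z := by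
    intro g
    funext z
    by_cases hz : out (η, z) ∈ A
    · rw [Set.indicator_of_mem (show z ∈ (fun z => out (η, z)) ⁻¹' A from hz),
        Set.indicator_of_mem hz, one_mul]
    · rw [Set.indicator_of_notMem (show z ∉ (fun z => out (η, z)) ⁻¹' A from hz),
        Set.indicator_of_notMem hz, zero_mul]
  have hcoord : Integrable (fun z : Ξ × (Q → ℝ) => z.2 q) (P₀.prod (stdGaussianPi Q)) :=
    ((memLp_coord q).integrable (by norm_num)).comp_snd P₀
  have hMi := (hM.memLp_comp (P₀ := P₀) hout q).integrable (by norm_num)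
  have hpre := hmp.measurable hA
  rw [← hmp.map_eq, setIntegral_map hA (hM.measurable q).aestronglyMeasurable
    hmp.measurable.aemeasurable, ← integral_indicator hpre, ← integral_indicator hpre,
    integral_update P₀ q (hcoord.indicator hpre), integral_update P₀ q (hMi.indicator hpre)]
  refine integral_congr_ae (Eventually.of_forall fun z => ?_)
  simp only [hind, Function.update_self]
  exact hM.integral_eq q z.1 z.2 (A.indicator fun _ => 1)

lemma IsCoordMean.integrable_inner_sq (hout : Measurable out)
    (hM : IsCoordMean (fun ξ e => out (η, ξ, e)) M) (q : Q) :
    Integrable (fun z : Ξ × (Q → ℝ) => ∫ x, M q (out (η, z.1, Function.update z.2 q x)) ^ 2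
      ∂gaussianReal 0 1) (P₀.prod (stdGaussianPi Q)) := by
  have hmeas : Measurable fun p : (Ξ × (Q → ℝ)) × ℝ =>
      M q (out (η, p.1.1, Function.update p.1.2 q p.2)) ^ 2 := by
    have hup : Measurable fun p : (Ξ × (Q → ℝ)) × ℝ => Function.update p.1.2 q p.2 :=
      (measurePreserving_update q).measurable.comp
        ((measurable_snd.comp measurable_fst).prodMk measurable_snd)
    exact (((hM.measurable q).comp (hout.comp
      (measurable_const.prodMk ((measurable_fst.comp measurable_fst).prodMk hup))))).pow_const 2
  refine Integrable.of_bound (C := 1)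
    hmeas.stronglyMeasurable.integral_prod_right'.aestronglyMeasurable
    (Eventually.of_forall fun z => ?_)
  rw [Real.norm_of_nonneg (integral_nonneg fun _ => sq_nonneg _)]
  exact hM.integral_sq_le q z.1 z.2

variable [Countable Q] [MeasurableSpace.CountablyGenerated S]

/-- The second moment of the score in terms of the conditional means of the coordinates. -/
theorem IsCoordMean.hasSum_integral_scoreFun_sq (hout : Measurable out)
    (hM : IsCoordMean (fun ξ e => out (η, ξ, e)) M) {b : Q → Vec m}
    (hb : Summable fun q => ‖b q‖ ^ 2) (h : Vec m) :
    MemLp (fun s => inner ℝ (scoreFun (P₀ := P₀) b hout η s) h) 2 (outKernel P₀ out η) ∧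
      HasSum (fun q => inner ℝ (b q) h ^ 2 * ∫ s, M q s ^ 2 ∂(outKernel P₀ out η))
        (∫ s, inner ℝ (scoreFun (P₀ := P₀) b hout η s) h ^ 2 ∂(outKernel P₀ out η)) := by
  refine PrivEst.hasSum_integral_scoreFun_sq hb hout η (fun q => ?_)
    (fun q A hA => hM.setIntegral_eq hout q hA) (fun q q' hq => hM.integral_mul_eq_zero hout hq) h
  have hmp := measurePreserving_out (P₀ := P₀) hout η
  have h1 := hM.memLp_comp (P₀ := P₀) hout q
  rw [← hmp.map_eq]
  exact (memLp_map_measure_iff (hM.measurable q).aestronglyMeasurable hmp.measurable.aemeasurable).2 h1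

/-- Comparison of the second moments of the scores of two outputs driven by the same noise. -/
theorem IsCoordMean.integral_scoreFun_sq_le {S' : Type*} [MeasurableSpace S']
    [MeasurableSpace.CountablyGenerated S'] {out' : X × Ξ × (Q → ℝ) → S'} {M' : Q → S' → ℝ}
    (hout : Measurable out) (hout' : Measurable out')
    (hM : IsCoordMean (fun ξ e => out (η, ξ, e)) M) (hM' : IsCoordMean (fun ξ e => out' (η, ξ, e)) M')
    {C : ℝ} (hle : ∀ q ξ e, ∫ x, M q (out (η, ξ, Function.update e q x)) ^ 2 ∂gaussianReal 0 1 ≤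
      C * ∫ x, M' q (out' (η, ξ, Function.update e q x)) ^ 2 ∂gaussianReal 0 1)
    {b : Q → Vec m} (hb : Summable fun q => ‖b q‖ ^ 2) (h : Vec m) :
    ∫ s, inner ℝ (scoreFun (P₀ := P₀) b hout η s) h ^ 2 ∂(outKernel P₀ out η) ≤
      C * ∫ s, inner ℝ (scoreFun (P₀ := P₀) b hout' η s) h ^ 2 ∂(outKernel P₀ out' η) := by
  have h1 := (hM.hasSum_integral_scoreFun_sq (P₀ := P₀) hout hb h).2
  have h2 := (hM'.hasSum_integral_scoreFun_sq (P₀ := P₀) hout' hb h).2.mul_left C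
  refine hasSum_le (fun q => ?_) h1 h2
  rw [mul_left_comm]
  refine mul_le_mul_of_nonneg_left ?_ (sq_nonneg _)
  rw [hM.integral_sq_eq hout, hM'.integral_sq_eq hout', ← integral_const_mul]
  exact integral_mono (hM.integrable_inner_sq hout q) ((hM'.integrable_inner_sq hout' q).const_mul C)
    fun z => hle q z.1 z.2

end CoordinateMeans

/-! ### Uniqueness of scores -/

section Uniqueness

variable {S : Type*} [MeasurableSpace S] {m : ℕ}

/-- Two densities of the same measures with respect to two dominating measures are proportional. -/
lemma exists_proportional_densities {ι : Type*} [Countable ι] (L : ι → Measure S) (i₀ : ι)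
    (ν ν' : Measure S) [SigmaFinite ν] [SigmaFinite ν'] (p p' : ι → S → ℝ)
    (hpm : ∀ i, Measurable (p i)) (hpm' : ∀ i, Measurable (p' i))
    (hp0 : ∀ i s, 0 ≤ p i s) (hp0' : ∀ i s, 0 ≤ p' i s)
    (hp : ∀ i, L i = ν.withDensity fun s => ENNReal.ofReal (p i s))
    (hp' : ∀ i, L i = ν'.withDensity fun s => ENNReal.ofReal (p' i s)) :
    ∀ᵐ s ∂(L i₀), ∃ c c' : ℝ, 0 < c ∧ 0 < c' ∧ ∀ i, c * p i s = c' * p' i s := by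
  -- Both dominating measures have densities with respect to their sum, and these densities at `s`
  -- are the two proportionality constants.
  set τ := ν + ν'
  have h1 : ν ≪ τ := Measure.absolutelyContinuous_of_le (Measure.le_add_right le_rfl)
  have h1' : ν' ≪ τ := Measure.absolutelyContinuous_of_le (Measure.le_add_left le_rfl)
  have hr := Measure.withDensity_rnDeriv_eq ν τ h1
  have hr' := Measure.withDensity_rnDeriv_eq ν' τ h1'
  have hmr := Measure.measurable_rnDeriv ν τ
  have hmr' := Measure.measurable_rnDeriv ν' τ
  have hd : ∀ i, L i = τ.withDensity (ν.rnDeriv τ * fun s => ENNReal.ofReal (p i s)) := fun i => by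
    rw [withDensity_mul _ hmr (hpm i).ennreal_ofReal, hr, hp i]
  have hd' : ∀ i, L i = τ.withDensity (ν'.rnDeriv τ * fun s => ENNReal.ofReal (p' i s)) := fun i => by
    rw [withDensity_mul _ hmr' (hpm' i).ennreal_ofReal, hr', hp' i]
  have heq : ∀ᵐ s ∂τ, ∀ i, ν.rnDeriv τ s * ENNReal.ofReal (p i s) =
      ν'.rnDeriv τ s * ENNReal.ofReal (p' i s) := by
    refine ae_all_iff.2 fun i => ?_
    refine (withDensity_eq_iff_of_sigmaFinite (hmr.mul (hpm i).ennreal_ofReal).aemeasurable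
      (hmr'.mul (hpm' i).ennreal_ofReal).aemeasurable).1 ?_
    rw [← hd, ← hd']
  have hac : L i₀ ≪ τ := by
    rw [hd i₀]; exact withDensity_absolutelyContinuous _ _
  have hpos : ∀ᵐ s ∂(L i₀), ν.rnDeriv τ s * ENNReal.ofReal (p i₀ s) ≠ 0 := by
    rw [hd i₀, ae_withDensity_iff (hmr.mul (hpm i₀).ennreal_ofReal)]
    exact Eventually.of_forall fun s hs => hs
  filter_upwards [hac.ae_le heq, hpos, hac.ae_le (Measure.rnDeriv_lt_top ν τ),
    hac.ae_le (Measure.rnDeriv_lt_top ν' τ)] with s hs hs0 hfin hfin'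
  have hs0' := hs0
  rw [hs i₀] at hs0'
  refine ⟨(ν.rnDeriv τ s).toReal, (ν'.rnDeriv τ s).toReal,
    ENNReal.toReal_pos (left_ne_zero_of_mul hs0) hfin.ne,
    ENNReal.toReal_pos (left_ne_zero_of_mul hs0') hfin'.ne, fun i => ?_⟩
  have := congrArg ENNReal.toReal (hs i)
  rwa [ENNReal.toReal_mul, ENNReal.toReal_mul, ENNReal.toReal_ofReal (hp0 i s),
    ENNReal.toReal_ofReal (hp0' i s)] at this

lemma tendsto_slope_of_hasGradientAt {f : Vec m → ℝ} {g y : Vec m} (hf : HasGradientAt f g y)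
    (a : Fin m) : Tendsto (fun n : ℕ => ((n : ℝ) + 1) *
      (f (y + (1 / ((n : ℝ) + 1)) • EuclideanSpace.single a 1) - f y)) atTop (𝓝 (g a)) := by
  have h1 := (hf.hasFDerivAt.lim_real (EuclideanSpace.single a (1 : ℝ))).comp
    (tendsto_natCast_atTop_atTop.atTop_add (tendsto_const_nhds (x := (1 : ℝ))))
  rw [InnerProductSpace.toDual_apply_apply, EuclideanSpace.inner_single_right] at h1
  simpa [Function.comp_def] using h1

/-- Densities are determined only almost everywhere for each parameter, so likelihoods can be
compared at countably many parameters at once. This is enough: a gradient that exists is determined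
by difference quotients along a sequence in each coordinate direction, and proportionality constants
cancel in differences of logarithms. -/
theorem IsScoreAt.ae_eq {L : Vec m → Measure S} {y : Vec m} {ℓ ℓ' : S → Vec m}
    (h : IsScoreAt L y ℓ) (h' : IsScoreAt L y ℓ') : ℓ =ᵐ[L y] ℓ' := by
  obtain ⟨ν, p, _, hpm, hp0, hp, hs⟩ := h
  obtain ⟨ν', p', _, hpm', hp0', hp', hs'⟩ := h'
  -- `none` is the base point, `some (n, a)` the point `1 / (n + 1)` away in direction `a`.
  let pt : Option (ℕ × Fin m) → Vec m := fun o =>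
    o.elim y fun na => y + (1 / ((na.1 : ℝ) + 1)) • EuclideanSpace.single na.2 1
  have hprop := exists_proportional_densities (fun o => L (pt o)) none ν ν' (fun o => p (pt o))
    (fun o => p' (pt o)) (fun _ => hpm _) (fun _ => hpm' _) (fun _ => hp0 _) (fun _ => hp0' _)
    (fun _ => hp _) (fun _ => hp' _)
  filter_upwards [hs, hs', hprop] with s hs hs' ⟨c, c', hc, hc', hcc⟩
  ext a
  refine tendsto_nhds_unique_of_eventuallyEq (tendsto_slope_of_hasGradientAt hs.2 a)
    (tendsto_slope_of_hasGradientAt hs'.2 a) ?_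
  have hlim : Tendsto (fun n : ℕ => y + (1 / ((n : ℝ) + 1)) • EuclideanSpace.single a (1 : ℝ)) atTop
      (𝓝 y) := by
    have := (tendsto_one_div_add_atTop_nhds_zero_nat (𝕜 := ℝ)).smul_const
      (EuclideanSpace.single a (1 : ℝ))
    simpa using this.const_add y
  filter_upwards [hlim.eventually hs.1, hlim.eventually hs'.1] with n hn hn'
  have hy := hs.1.self_of_nhds
  have hy' := hs'.1.self_of_nhds
  have e1 := congrArg Real.log (hcc (some (n, a)))
  have e0 := congrArg Real.log (hcc none)
  simp only [pt, Option.elim] at e1 e0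
  rw [Real.log_mul hc.ne' hn.ne', Real.log_mul hc'.ne' hn'.ne'] at e1
  rw [Real.log_mul hc.ne' hy.ne', Real.log_mul hc'.ne' hy'.ne'] at e0
  congr 1
  linarith

end Uniqueness

/-! ### Conditional Fisher information -/

section CondFisher

variable {Ω S S' : Type*} [MeasurableSpace Ω] [MeasurableSpace S] [MeasurableSpace S'] {m k : ℕ}
  {μ : Measure Ω} [IsProbabilityMeasure μ] {obs : Ω → ℕ → Vec m} {Y : Ω → S} {Y' : Ω → S'}
  {L : (ℕ → Vec m) → Measure S} {L' : (ℕ → Vec m) → Measure S'}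

lemma IsCondScore.ae_eq {ℓ ℓ' : (ℕ → Vec m) → S → Vec m} (h : IsCondScore μ obs Y L k ℓ)
    (h' : IsCondScore μ obs Y L k ℓ') : ∀ᵐ ω ∂μ, ℓ (obs ω) (Y ω) = ℓ' (obs ω) (Y ω) := by
  obtain ⟨κ, _, hκ, hlaw⟩ := h.condLaw
  have hset : MeasurableSet {p : (ℕ → Vec m) × S | ℓ p.1 p.2 = ℓ' p.1 p.2} :=
    measurableSet_eq_fun h.measurable h'.measurable
  have h1 : ∀ᵐ p ∂(μ.map obs ⊗ₘ κ), ℓ p.1 p.2 = ℓ' p.1 p.2 := by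
    rw [Measure.ae_compProd_iff hset]
    filter_upwards [h.score, h'.score] with η h2 h3
    rw [hκ]
    have h4 := h2.ae_eq h3
    simp only [Function.update_eq_self] at h4
    exact h4
  rw [← hlaw.map_eq] at h1
  exact ae_of_ae_map hlaw.aemeasurable h1

/-- By uniqueness of scores, every version of the Fisher information can be computed from one
convenient score. -/
lemma IsCondFisherInfo.of_score {ℓ : (ℕ → Vec m) → S → Vec m} {I : Ω → Matrix (Fin m) (Fin m) ℝ}
    (hI : IsCondFisherInfo μ obs Y L k I) (h : IsCondScore μ obs Y L k ℓ) (a b : Fin m) :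
    Integrable (fun ω => ℓ (obs ω) (Y ω) a * ℓ (obs ω) (Y ω) b) μ ∧
      (fun ω => I ω a b) =ᵐ[μ]
        condExp (MeasurableSpace.comap (fun ω => obs ω k) inferInstance) μ
          (fun ω => ℓ (obs ω) (Y ω) a * ℓ (obs ω) (Y ω) b) := by
  obtain ⟨ℓ', h', hI⟩ := hI
  have h1 : (fun ω => ℓ' (obs ω) (Y ω) a * ℓ' (obs ω) (Y ω) b) =ᵐ[μ]
      fun ω => ℓ (obs ω) (Y ω) a * ℓ (obs ω) (Y ω) b := by
    filter_upwards [h'.ae_eq h] with ω hω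
    rw [hω]
  exact ⟨(hI a b).1.congr h1, (hI a b).2.trans (condExp_congr_ae h1)⟩

lemma condExp_comp_prodMk {κ : Kernel (ℕ → Vec m) S} [IsMarkovKernel κ] (hobs : Measurable obs)
    (hY : HasCondDistrib Y obs κ μ) {F : (ℕ → Vec m) × S → ℝ} (hF : Measurable F)
    (hi : Integrable (fun ω => F (obs ω, Y ω)) μ) :
    condExp (MeasurableSpace.comap obs inferInstance) μ (fun ω => F (obs ω, Y ω)) =ᵐ[μ]
      fun ω => ∫ s, F (obs ω, s) ∂(κ (obs ω)) := by
  have hpair := hY.aemeasurable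
  have hi' : Integrable F (μ.map obs ⊗ₘ κ) := by
    rw [← hY.map_eq]
    exact (integrable_map_measure hF.aestronglyMeasurable hpair).2 hi
  have hψ : StronglyMeasurable fun η => ∫ s, F (η, s) ∂(κ η) :=
    hF.stronglyMeasurable.integral_kernel_prod_right'
  have hψi : Integrable (fun ω => ∫ s, F (obs ω, s) ∂(κ (obs ω))) μ :=
    (integrable_map_measure hψ.aestronglyMeasurable hobs.aemeasurable).1 hi'.integral_compProd
  refine (ae_eq_condExp_of_forall_setIntegral_eq hobs.comap_le hi (fun s _ _ => hψi.integrableOn)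
    ?_ ?_).symm
  · rintro _ ⟨B, hB, rfl⟩ -
    rw [← setIntegral_map hB (f := fun η => ∫ s, F (η, s) ∂(κ η)) hψ.aestronglyMeasurable
      hobs.aemeasurable]
    have h1 := setIntegral_map (μ := μ) (f := F) (g := fun ω => (obs ω, Y ω))
      (hB.prod MeasurableSet.univ) hF.aestronglyMeasurable hpair
    rw [hY.map_eq, Measure.setIntegral_compProd hB MeasurableSet.univ hi'.integrableOn] at h1
    simp only [Measure.restrict_univ] at h1
    rw [h1]
    congr 2
    ext ω
    simp
  · exact (hψ.comp_measurable (comap_measurable obs)).aestronglyMeasurable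

lemma inner_sq_eq_sum (u h : Vec m) :
    inner ℝ u h ^ 2 = ∑ a, ∑ b, (h a * h b) • (u a * u b) := by
  rw [sq, PiLp.inner_apply, Finset.sum_mul_sum]
  refine Finset.sum_congr rfl fun a _ => Finset.sum_congr rfl fun b _ => ?_
  simp only [RCLike.inner_apply, conj_trivial, smul_eq_mul]
  ring

/-- The quadratic form of the conditional Fisher information. -/
lemma IsCondFisherInfo.quadForm_ae_eq {κ : Kernel (ℕ → Vec m) S} [IsMarkovKernel κ]
    (hobs : Measurable obs) (hY : HasCondDistrib Y obs κ μ) {ℓ : (ℕ → Vec m) → S → Vec m}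
    (hℓ : IsCondScore μ obs Y L k ℓ) {I : Ω → Matrix (Fin m) (Fin m) ℝ}
    (hI : IsCondFisherInfo μ obs Y L k I) (h : Vec m) :
    Integrable (fun ω => ∫ s, inner ℝ (ℓ (obs ω) s) h ^ 2 ∂(κ (obs ω))) μ ∧
    (fun ω => ∑ a, ∑ b, (h a * h b) • I ω a b) =ᵐ[μ]
      condExp (MeasurableSpace.comap (fun ω => obs ω k) inferInstance) μ
        (fun ω => ∫ s, inner ℝ (ℓ (obs ω) s) h ^ 2 ∂(κ (obs ω))) := by
  have hprod := fun a b => hI.of_score hℓ a b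
  have hint : Integrable (fun ω => inner ℝ (ℓ (obs ω) (Y ω)) h ^ 2) μ := by
    simp_rw [inner_sq_eq_sum]
    exact integrable_finsetSum _ fun a _ => integrable_finsetSum _ fun b _ =>
      (hprod a b).1.const_mul _
  have hF : Measurable fun p : (ℕ → Vec m) × S => inner ℝ (ℓ p.1 p.2) h ^ 2 :=
    (hℓ.measurable.inner_const (𝕜 := ℝ)).pow_const 2
  have hcond := condExp_comp_prodMk hobs hY hF hint
  have hle : MeasurableSpace.comap (fun ω => obs ω k) inferInstance ≤
      MeasurableSpace.comap obs inferInstance := by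
    have : (fun ω => obs ω k) = (fun η : ℕ → Vec m => η k) ∘ obs := rfl
    rw [this, ← MeasurableSpace.comap_comp]
    exact MeasurableSpace.comap_mono (measurable_pi_apply k).comap_le
  refine ⟨integrable_condExp.congr hcond, ?_⟩
  -- Tower property: condition first on the whole observation sequence, where the kernel computes
  -- the second moment, and then on its `k`-th entry.
  refine EventuallyEq.trans ?_ (((condExp_condExp_of_le hle hobs.comap_le).symm).trans
    (condExp_congr_ae hcond))
  have h1 : (fun ω => inner ℝ (ℓ (obs ω) (Y ω)) h ^ 2) =
      ∑ a, ∑ b, (h a * h b) • fun ω => (ℓ (obs ω) (Y ω) a * ℓ (obs ω) (Y ω) b) := by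
    funext ω
    simpa only [Finset.sum_apply, Pi.smul_apply] using inner_sq_eq_sum _ _
  rw [h1]
  have h2 := condExp_finsetSum (μ := μ) (s := Finset.univ) (f := fun a => ∑ b, (h a * h b) •
      fun ω => (ℓ (obs ω) (Y ω) a * ℓ (obs ω) (Y ω) b))
    (fun a _ => integrable_finsetSum' _ fun b _ => (hprod a b).1.smul _)
    (MeasurableSpace.comap (fun ω => obs ω k) inferInstance)
  have h3 := fun a => condExp_finsetSum (μ := μ) (s := Finset.univ) (f := fun b => (h a * h b) •
      fun ω => (ℓ (obs ω) (Y ω) a * ℓ (obs ω) (Y ω) b))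
    (fun b _ => (hprod a b).1.smul _) (MeasurableSpace.comap (fun ω => obs ω k) inferInstance)
  have h4 := fun a b => condExp_smul (μ := μ) (h a * h b)
    (fun ω => (ℓ (obs ω) (Y ω) a * ℓ (obs ω) (Y ω) b))
    (MeasurableSpace.comap (fun ω => obs ω k) inferInstance)
  filter_upwards [h2, ae_all_iff.2 h3, ae_all_iff.2 fun a => ae_all_iff.2 (h4 a),
    ae_all_iff.2 fun a => ae_all_iff.2 fun b => (hprod a b).2] with ω h2 h3 h4 h5
  rw [h2, Finset.sum_apply]
  refine Finset.sum_congr rfl fun a _ => ?_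
  rw [h3, Finset.sum_apply]
  refine Finset.sum_congr rfl fun b _ => ?_
  rw [h4, Pi.smul_apply, h5]

/-- Rational vectors are dense and countable in number, so inequalities that hold almost surely for
each vector can be merged outside a single null set. -/
lemma posSemidef_of_rat (J : Matrix (Fin m) (Fin m) ℝ) (hsymm : ∀ a b, J a b = J b a)
    (h : ∀ q : Fin m → ℚ, 0 ≤ ∑ a, ∑ b, ((q a : ℝ) * q b) • J a b) : J.PosSemidef := by
  refine Matrix.PosSemidef.of_dotProduct_mulVec_nonneg ?_ fun x => ?_
  · ext a b
    simp [hsymm a b]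
  · have hcont : Continuous fun x : Fin m → ℝ => ∑ a, ∑ b, (x a * x b) • J a b := by fun_prop
    have hdense : DenseRange fun q : Fin m → ℚ => fun a => (q a : ℝ) :=
      DenseRange.piMap fun _ => Rat.denseRange_cast
    have h1 : 0 ≤ ∑ a, ∑ b, (x a * x b) • J a b :=
      hdense.induction_on (p := fun x => 0 ≤ ∑ a, ∑ b, (x a * x b) • J a b) x
        (isClosed_Ici.preimage hcont) h
    refine h1.trans_eq ?_
    simp only [dotProduct, Matrix.mulVec, Finset.mul_sum, Pi.star_apply, star_trivial, smul_eq_mul]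
    exact Finset.sum_congr rfl fun a _ => Finset.sum_congr rfl fun b _ => by ring

theorem ae_posSemidef_of_integral_sq_le {κ : Kernel (ℕ → Vec m) S} {κ' : Kernel (ℕ → Vec m) S'}
    [IsMarkovKernel κ] [IsMarkovKernel κ'] (hobs : Measurable obs)
    (hY : HasCondDistrib Y obs κ μ) (hY' : HasCondDistrib Y' obs κ' μ)
    {ℓ : (ℕ → Vec m) → S → Vec m} {ℓ' : (ℕ → Vec m) → S' → Vec m}
    (hℓ : IsCondScore μ obs Y L k ℓ) (hℓ' : IsCondScore μ obs Y' L' k ℓ') {C : ℝ}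
    (hle : ∀ η h, ∫ s, inner ℝ (ℓ η s) h ^ 2 ∂(κ η) ≤ C * ∫ s, inner ℝ (ℓ' η s) h ^ 2 ∂(κ' η))
    {I I' : Ω → Matrix (Fin m) (Fin m) ℝ} (hI : IsCondFisherInfo μ obs Y L k I)
    (hI' : IsCondFisherInfo μ obs Y' L' k I') : ∀ᵐ ω ∂μ, (C • I' ω - I ω).PosSemidef := by
  have hquad := fun q : Fin m → ℚ =>
    hI.quadForm_ae_eq hobs hY hℓ (WithLp.toLp 2 fun a => (q a : ℝ))
  have hquad' := fun q : Fin m → ℚ =>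
    hI'.quadForm_ae_eq hobs hY' hℓ' (WithLp.toLp 2 fun a => (q a : ℝ))
  have hmono := fun q : Fin m → ℚ => condExp_mono (μ := μ)
    (m := MeasurableSpace.comap (fun ω => obs ω k) inferInstance) (hquad q).1
    ((hquad' q).1.smul C) (Eventually.of_forall fun ω => hle (obs ω) _)
  have hsmul := fun q : Fin m → ℚ => condExp_smul (μ := μ) C
    (fun ω => ∫ s, inner ℝ (ℓ' (obs ω) s) (WithLp.toLp 2 fun a => (q a : ℝ)) ^ 2 ∂(κ' (obs ω)))
    (MeasurableSpace.comap (fun ω => obs ω k) inferInstance)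
  filter_upwards [ae_all_iff.2 fun q => (hquad q).2, ae_all_iff.2 fun q => (hquad' q).2,
    ae_all_iff.2 hmono, ae_all_iff.2 hsmul,
    ae_all_iff.2 fun a => ae_all_iff.2 fun b => (hI.of_score hℓ a b).2,
    ae_all_iff.2 fun a => ae_all_iff.2 fun b => (hI'.of_score hℓ' a b).2] with ω h1 h2 h3 h4 h5 h6
  refine posSemidef_of_rat _ (fun a b => ?_) fun q => ?_
  · rw [Matrix.sub_apply, Matrix.sub_apply, Matrix.smul_apply, Matrix.smul_apply, h5 a b, h5 b a,
      h6 a b, h6 b a]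
    have e1 : (fun ω => ℓ (obs ω) (Y ω) a * ℓ (obs ω) (Y ω) b) =
        fun ω => ℓ (obs ω) (Y ω) b * ℓ (obs ω) (Y ω) a := funext fun ω => mul_comm _ _
    have e2 : (fun ω => ℓ' (obs ω) (Y' ω) a * ℓ' (obs ω) (Y' ω) b) =
        fun ω => ℓ' (obs ω) (Y' ω) b * ℓ' (obs ω) (Y' ω) a := funext fun ω => mul_comm _ _
    rw [e1, e2]
  · have h7 := h3 q
    rw [h4 q, Pi.smul_apply, ← h1 q, ← h2 q] at h7
    have h8 : ∑ a, ∑ b, ((q a : ℝ) * q b) • (C • I' ω - I ω) a b =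
        C • (∑ a, ∑ b, ((q a : ℝ) * q b) • I' ω a b) - ∑ a, ∑ b, ((q a : ℝ) * q b) • I ω a b := by
      simp only [Matrix.sub_apply, Matrix.smul_apply, smul_eq_mul, mul_sub, Finset.sum_sub_distrib,
        Finset.mul_sum, mul_left_comm C]
    rw [h8]
    exact sub_nonneg.2 h7

end CondFisher

/-! ### Fisher information of an output driven by shifted Gaussian noise -/

section Existence

variable {Ω Q Ξ S : Type*} [MeasurableSpace Ω] [MeasurableSpace Ξ] [MeasurableSpace S] {m k : ℕ}
  {μ : Measure Ω} {obs : Ω → ℕ → Vec m} {Y : Ω → S}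
  {L : (ℕ → Vec m) → Measure S} {P₀ : Measure Ξ} [IsProbabilityMeasure P₀]
  {out : (ℕ → Vec m) × Ξ × (Q → ℝ) → S} [Countable Q]
  [MeasurableSpace.CountablyGenerated S]
  {b : Q → Vec m} {M : (ℕ → Vec m) → Q → S → ℝ}

theorem isCondScore_scoreFun (hout : Measurable out) (hY : HasCondDistrib Y obs (outKernel P₀ out) μ)
    (hL : ∀ η, outKernel P₀ out η = L η) (hb : Summable fun q => ‖b q‖ ^ 2)
    (hshift : ∀ η y ξ e, out (Function.update η k y, ξ, e) =
      out (η, ξ, e + fun q => inner ℝ (b q) (y - η k))) :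
    IsCondScore μ obs Y L k (scoreFun (P₀ := P₀) b hout) := by
  refine ⟨⟨outKernel P₀ out, isMarkovKernel_outKernel hout, hL, hY⟩, measurable_scoreFun b hout,
    Eventually.of_forall fun η => ?_⟩
  simp_rw [← hL]
  exact isScoreAt_scoreFun hb hout η (fun y => Function.update η k y) (η k)
    (Function.update_eq_self k η) fun y ξ e => hshift η y ξ e

theorem exists_isCondFisherInfo [DecidableEq Q] [IsProbabilityMeasure μ] (hout : Measurable out)
    (hY : HasCondDistrib Y obs (outKernel P₀ out) μ)
    (hL : ∀ η, outKernel P₀ out η = L η) (hb : Summable fun q => ‖b q‖ ^ 2)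
    (hshift : ∀ η y ξ e, out (Function.update η k y, ξ, e) =
      out (η, ξ, e + fun q => inner ℝ (b q) (y - η k)))
    (hM : ∀ η, IsCoordMean (fun ξ e => out (η, ξ, e)) (M η)) :
    ∃ I, IsCondFisherInfo μ obs Y L k I := by
  have := isMarkovKernel_outKernel (P₀ := P₀) hout
  have hscore := isCondScore_scoreFun hout hY hL hb hshift
  refine ⟨_, _, hscore, fun a c => ⟨?_, Filter.EventuallyEq.rfl⟩⟩
  have hmem : ∀ a, MemLp (fun ω => scoreFun (P₀ := P₀) b hout (obs ω) (Y ω) a) 2 μ := by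
    intro a
    have hF : Measurable fun p : (ℕ → Vec m) × S => scoreFun (P₀ := P₀) b hout p.1 p.2 a :=
      (measurable_pi_apply a).comp ((WithLp.measurable_ofLp 2 _).comp hscore.measurable)
    suffices h : MemLp (fun p : (ℕ → Vec m) × S => scoreFun (P₀ := P₀) b hout p.1 p.2 a) 2
        (μ.map fun ω => (obs ω, Y ω)) from
      (memLp_map_measure_iff hF.aestronglyMeasurable hY.aemeasurable).1 h
    refine (memLp_two_iff_integrable_sq hF.aestronglyMeasurable).2
      ⟨(hF.pow_const 2).aestronglyMeasurable, ?_⟩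
    rw [hasFiniteIntegral_iff_ofReal (Eventually.of_forall fun _ => sq_nonneg _), hY.map_eq,
      Measure.lintegral_compProd (hF.pow_const 2).ennreal_ofReal]
    have hobs : IsProbabilityMeasure (μ.map obs) :=
      Measure.isProbabilityMeasure_map hY.aemeasurable.fst
    -- The bound is uniform in `η`: each `M q` has second moment at most one, so the score is
    -- controlled by the sum of squares of the shift directions.
    refine lt_of_le_of_lt (lintegral_mono
      (g := fun _ => ENNReal.ofReal (∑' q, inner ℝ (b q) (EuclideanSpace.single a (1 : ℝ)) ^ 2))
      fun η => ?_) (by simp)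
    obtain ⟨h1, h2⟩ := (hM η).hasSum_integral_scoreFun_sq (P₀ := P₀) hout hb
      (EuclideanSpace.single a (1 : ℝ))
    have hcoord : ∀ s, inner ℝ (scoreFun (P₀ := P₀) b hout η s) (EuclideanSpace.single a (1 : ℝ)) =
        scoreFun (P₀ := P₀) b hout η s a := fun s => by
      rw [EuclideanSpace.inner_single_right]; simp
    have h3 := h1.integrable_sq
    simp_rw [hcoord] at h2 h3
    dsimp only
    rw [← ofReal_integral_eq_lintegral_ofReal h3 (Eventually.of_forall fun _ => sq_nonneg _)]
    refine ENNReal.ofReal_le_ofReal ?_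
    refine hasSum_le (fun q => ?_) h2 (summable_inner_sq hb _).hasSum
    refine mul_le_of_le_one_right (sq_nonneg _) ?_
    rw [(hM η).integral_sq_eq hout]
    refine (integral_mono ((hM η).integrable_inner_sq hout q) (integrable_const 1)
      fun z => (hM η).integral_sq_le q z.1 z.2).trans (by simp)
  exact (hmem a).integrable_mul (hmem c)

end Existence

namespace Algorithm

variable {N n : ℕ} {dim : Fin N → ℕ} (P : Algorithm N n dim)
  {G : ℕ → Matrix (Fin N) (Fin N) ℝ} {d d' : Fin N → Fin N → ℕ → ℝ} {y y' : ∀ i, ℕ → Vec (dim i)}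

/-- The estimates depend on the noises only through the quantized signals. -/
lemma estimate_congr_of_quantize (hG : ∀ l, (G l).IsSymm) {T : ℕ}
    (h : ∀ t < T, ∀ a b, 0 < G t a b →
      quantize (P.threshold a b) (inner ℝ (compressor n t) (P.estimate G d y t a) + d a b t) =
        quantize (P.threshold a b) (inner ℝ (compressor n t) (P.estimate G d y t a) + d' a b t)) :
    ∀ t ≤ T, P.estimate G d y t = P.estimate G d' y t := by
  intro t ht
  induction t with
  | zero => rfl
  | succ t ih =>
    have ih := ih (by omega)
    funext a
    simp only [estimate]
    rw [← ih]
    congr 3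
    refine Finset.sum_congr rfl fun b _ => ?_
    split_ifs with hab
    -- The update uses both signals along an edge; by symmetry the reverse direction is active as
    -- well.
    · rw [h t ht a b hab, h t ht b a (by rwa [(hG t).apply])]
    · rfl

lemma estimate_congr (hG : ∀ l, (G l).IsSymm) {T : ℕ}
    (h : ∀ t < T, ∀ a b, 0 < G t a b → d a b t = d' a b t) :
    P.estimate G d y T = P.estimate G d' y T :=
  P.estimate_congr_of_quantize hG (fun t ht a b hab => by rw [h t ht a b hab]) T le_rfl

lemma noisySignals_congr (hG : ∀ l, (G l).IsSymm)
    (h : ∀ t a b, 0 < G t a b → d a b t = d' a b t) :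
    P.noisySignals G d y = P.noisySignals G d' y := by
  funext t a b
  simp only [noisySignals]
  split_ifs with hab
  · rw [P.estimate_congr hG fun t _ => h t, h t a b hab]
  · rfl

/-- Equality is required only after quantization, so this applies when a noise moves without
crossing its threshold. -/
lemma binarySignals_congr_of_quantize (hG : ∀ l, (G l).IsSymm)
    (h : ∀ t a b, 0 < G t a b →
      quantize (P.threshold a b) (inner ℝ (compressor n t) (P.estimate G d y t a) + d a b t) =
        quantize (P.threshold a b) (inner ℝ (compressor n t) (P.estimate G d y t a) + d' a b t)) :
    P.binarySignals G d y = P.binarySignals G d' y := by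
  funext t a b
  simp only [binarySignals]
  split_ifs with hab
  · rw [h t a b hab, P.estimate_congr_of_quantize hG (fun t _ => h t) t le_rfl]
  · rfl

lemma binarySignals_congr (hG : ∀ l, (G l).IsSymm)
    (h : ∀ t a b, 0 < G t a b → d a b t = d' a b t) :
    P.binarySignals G d y = P.binarySignals G d' y :=
  P.binarySignals_congr_of_quantize hG fun t a b hab => by rw [h t a b hab]

/-- The signals of all sensors after quantization of the noisy signals. -/
noncomputable def quantizeSignals (s : ℕ → Fin N → Fin N → Unit ⊕ ℝ) :
    ℕ → Fin N → Fin N → Unit ⊕ ℝ :=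
  fun t a b => Sum.map id (quantize (P.threshold a b)) (s t a b)

lemma quantizeSignals_noisySignals :
    P.quantizeSignals (P.noisySignals G d y) = P.binarySignals G d y := by
  funext t a b
  simp only [quantizeSignals, noisySignals, binarySignals]
  split_ifs <;> rfl

/-- The derivative of the estimate of sensor `i` at time `t` with respect to its `k`-th
observation, the signals being held fixed. -/
noncomputable def sensitivity (i : Fin N) (k : ℕ) : ℕ → (Vec (dim i) →L[ℝ] Vec n)
  | 0 => 0
  | t + 1 => sensitivity i k t - P.beta i t • (P.Q i).comp (sensitivity i k t) +
      if t = k then P.beta i t • ContinuousLinearMap.adjoint (P.Hbar i) else 0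

/-- A perturbation of one observation of sensor `i` is compensated by a shift of the privacy noises
of sensor `i`. -/
lemma estimate_perturb (hG : ∀ l, (G l).IsSymm) (i : Fin N) (k : ℕ) (h : Vec (dim i))
    (hy : ∀ j, j ≠ i → y' j = y j)
    (hyi : ∀ t, y' i t = y i t + if t = k then h else 0)
    (hd : ∀ t a b, 0 < G t a b → d a b t = d' a b t +
      if a = i then inner ℝ (compressor n t) (P.sensitivity i k t h) else 0) (t : ℕ) (a : Fin N) :
    P.estimate G d' y' t a = P.estimate G d y t a + if a = i then P.sensitivity i k t h else 0 := by
  induction t generalizing a with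
  | zero => simp [estimate, sensitivity]
  | succ t ih =>
    -- The change of the estimate and the change of the noise cancel in the noisy signal, so the
    -- exchanged signals agree and only the linear part of the recursion is perturbed.
    have hs : ∀ a b, 0 < G t a b →
        inner ℝ (compressor n t) (P.estimate G d' y' t a) + d' a b t =
          inner ℝ (compressor n t) (P.estimate G d y t a) + d a b t := by
      intro a b hab
      rw [ih a, hd t a b hab, inner_add_right]
      split_ifs
      · ring
      · rw [inner_zero_right]; ring
    have hsum : (∑ b, if 0 < G t a b then P.alpha a b t * G t a b *
        (quantize (P.threshold a b) (inner ℝ (compressor n t) (P.estimate G d' y' t a) + d' a b t) -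
        quantize (P.threshold b a) (inner ℝ (compressor n t) (P.estimate G d' y' t b) + d' b a t))
          else 0) = ∑ b, if 0 < G t a b then P.alpha a b t * G t a b *
        (quantize (P.threshold a b) (inner ℝ (compressor n t) (P.estimate G d y t a) + d a b t) -
        quantize (P.threshold b a) (inner ℝ (compressor n t) (P.estimate G d y t b) + d b a t))
          else 0 := by
      refine Finset.sum_congr rfl fun b _ => ?_
      split_ifs with hab
      · rw [hs a b hab, hs b a (by rwa [(hG t).apply])]
      · rfl
    simp only [estimate]
    rw [hsum, ih a]
    by_cases ha : a = i
    · subst ha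
      simp only [if_true, hyi, sensitivity, Q, add_apply,
        sub_apply, smul_apply,
        ContinuousLinearMap.comp_apply, map_add, map_sub, smul_add, smul_sub]
      split_ifs <;> simp <;> abel
    · simp only [ha, if_false, add_zero, hy a ha]

lemma noisySignals_perturb (hG : ∀ l, (G l).IsSymm) (i : Fin N) (k : ℕ) (h : Vec (dim i))
    (hy : ∀ j, j ≠ i → y' j = y j)
    (hyi : ∀ t, y' i t = y i t + if t = k then h else 0)
    (hd : ∀ t a b, 0 < G t a b → d a b t = d' a b t +
      if a = i then inner ℝ (compressor n t) (P.sensitivity i k t h) else 0) :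
    P.noisySignals G d' y' = P.noisySignals G d y := by
  funext t a b
  simp only [noisySignals]
  split_ifs with hab
  · rw [P.estimate_perturb hG i k h hy hyi hd, hd t a b hab, inner_add_right]
    split_ifs
    · congr 1; ring
    · congr 1; rw [inner_zero_right]; ring
  · rfl

/-! ### Measurability -/

lemma measurable_quantize (c : ℝ) : Measurable (quantize c) :=
  Measurable.ite measurableSet_Iic measurable_const measurable_const

section Measurability

variable {α : Type*} [MeasurableSpace α] {G : α → ℕ → Matrix (Fin N) (Fin N) ℝ}
  {d : α → Fin N → Fin N → ℕ → ℝ} {y : α → ∀ i, ℕ → Vec (dim i)}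

lemma measurable_estimate (hG : ∀ t a b, Measurable fun x => G x t a b)
    (hd : ∀ a b t, Measurable fun x => d x a b t) (hy : ∀ a t, Measurable fun x => y x a t)
    (t : ℕ) (a : Fin N) : Measurable fun x => P.estimate (G x) (d x) (y x) t a := by
  induction t generalizing a with
  | zero => exact measurable_const
  | succ t ih =>
    have hs : ∀ a b, Measurable fun x => quantize (P.threshold a b)
        (inner ℝ (compressor n t) (P.estimate (G x) (d x) (y x) t a) + d x a b t) := fun a b =>
      (measurable_quantize _).comp (((ih a).const_inner).add (hd a b t))
    simp only [estimate]
    refine ((ih a).add (Measurable.smul_const (Finset.measurable_sum _ fun b _ => ?_) _)).add ?_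
    · exact Measurable.ite (measurableSet_lt measurable_const (hG t a b))
        (((hG t a b).const_mul _).mul ((hs a b).sub (hs b a))) measurable_const
    · exact Measurable.const_smul ((ContinuousLinearMap.adjoint (P.Hbar a)).measurable.comp
        ((hy a t).sub ((P.Hbar a).measurable.comp (ih a)))) (P.beta a t)

lemma measurable_noisySignals (hG : ∀ t a b, Measurable fun x => G x t a b)
    (hd : ∀ a b t, Measurable fun x => d x a b t) (hy : ∀ a t, Measurable fun x => y x a t) :
    Measurable fun x => P.noisySignals (G x) (d x) (y x) := by
  refine measurable_pi_iff.2 fun t => measurable_pi_iff.2 fun a => measurable_pi_iff.2 fun b => ?_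
  exact Measurable.ite (measurableSet_lt measurable_const (hG t a b))
    (measurable_inr.comp (((P.measurable_estimate hG hd hy t a).const_inner).add (hd a b t)))
    measurable_const

lemma measurable_quantizeSignals : Measurable P.quantizeSignals := by
  refine measurable_pi_iff.2 fun t => measurable_pi_iff.2 fun a => measurable_pi_iff.2 fun b => ?_
  have h : Measurable (Sum.map id (quantize (P.threshold a b)) : Unit ⊕ ℝ → Unit ⊕ ℝ) :=
    (measurable_inl.sumElim (measurable_inr.comp (measurable_quantize _)))
  exact h.comp ((measurable_pi_apply b).comp ((measurable_pi_apply a).comp (measurable_pi_apply t)))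

lemma measurable_binarySignals (hG : ∀ t a b, Measurable fun x => G x t a b)
    (hd : ∀ a b t, Measurable fun x => d x a b t) (hy : ∀ a t, Measurable fun x => y x a t) :
    Measurable fun x => P.binarySignals (G x) (d x) (y x) := by
  simp_rw [← quantizeSignals_noisySignals]
  exact P.measurable_quantizeSignals.comp (P.measurable_noisySignals hG hd hy)

end Measurability

/-! ### Reconstruction of the estimates from the signals -/

section Reconstruction

variable {M : ℕ} (A : Fin M → Matrix (Fin N) (Fin N) ℝ)

open Classical in
/-- The weights belonging to a set of edges. -/
noncomputable def edgeWeight (E : Fin N → Fin N → Bool) : Matrix (Fin N) (Fin N) ℝ :=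
  if h : ∃ u, ∀ a b, 0 < A u a b ↔ E a b = true then A h.choose else 0

lemma edgeWeight_eq (hA : ∀ u v, (∀ i j, 0 < A u i j ↔ 0 < A v i j) → A u = A v) (u : Fin M)
    {E : Fin N → Fin N → Bool} (hE : ∀ a b, 0 < A u a b ↔ E a b = true) : edgeWeight A E = A u := by
  have h : ∃ u, ∀ a b, 0 < A u a b ↔ E a b = true := ⟨u, hE⟩
  rw [edgeWeight, dif_pos h]
  exact hA _ _ fun a b => (h.choose_spec a b).trans (hE a b).symm

/-- The value of a signal, zero for an inactive edge. -/
def signalValue : Unit ⊕ ℝ → ℝ := Sum.elim (fun _ => 0) id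

/-- The estimate of sensor `i` recovered from its observations and all binary signals. -/
noncomputable def reconstruct (i : Fin N) (η : ℕ → Vec (dim i)) (s : ℕ → Fin N → Fin N → Unit ⊕ ℝ) :
    ℕ → Vec n
  | 0 => P.init i
  | t + 1 => reconstruct i η s t
      + (∑ j, if (s t i j).isRight = true then
          P.alpha i j t * edgeWeight A (fun a b => (s t a b).isRight) i j *
            (signalValue (s t i j) - signalValue (s t j i)) else 0) • compressor n t
      + P.beta i t • ContinuousLinearMap.adjoint (P.Hbar i)
          (η t - P.Hbar i (reconstruct i η s t))

lemma isRight_binarySignals (t : ℕ) (a b : Fin N) :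
    (P.binarySignals G d y t a b).isRight = true ↔ 0 < G t a b := by
  simp only [binarySignals]
  split_ifs with h <;> simp [h]

lemma isRight_noisySignals (t : ℕ) (a b : Fin N) :
    (P.noisySignals G d y t a b).isRight = true ↔ 0 < G t a b := by
  simp only [noisySignals]
  split_ifs with h <;> simp [h]

/-- The entries of the form `Sum.inr` reveal the active edges, these determine the weights, and both
signals on each edge are visible; hence the recursion of sensor `i` can be replayed. -/
lemma reconstruct_binarySignals (hA : ∀ u v, (∀ i j, 0 < A u i j ↔ 0 < A v i j) → A u = A v)
    (hsymm : ∀ u, (A u).IsSymm) (g : ℕ → Fin M) (hG : ∀ l, G l = A (g l)) (i : Fin N) (t : ℕ) :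
    P.reconstruct A i (y i) (P.binarySignals G d y) t = P.estimate G d y t i := by
  induction t with
  | zero => rfl
  | succ t ih =>
    have hw : edgeWeight A (fun a b => (P.binarySignals G d y t a b).isRight) = G t := by
      rw [hG t]
      refine edgeWeight_eq A hA (g t) fun a b => ?_
      rw [isRight_binarySignals, hG t]
    simp only [reconstruct, estimate, isRight_binarySignals]
    rw [ih, hw]
    congr 3
    refine Finset.sum_congr rfl fun j _ => ?_
    split_ifs with hij
    · have hji : 0 < G t j i := by
        rw [hG t, (hsymm _).apply, ← hG t]; exact hij
      simp [binarySignals, hij, hji, signalValue]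
    · rfl

lemma measurable_isRight : Measurable (Sum.isRight : Unit ⊕ ℝ → Bool) := by
  have h : (Sum.isRight : Unit ⊕ ℝ → Bool) = Sum.elim (fun _ => false) fun _ => true := by
    funext x
    cases x <;> rfl
  rw [h]
  exact measurable_const.sumElim measurable_const

lemma measurable_signalValue : Measurable signalValue :=
  measurable_const.sumElim measurable_id

lemma measurable_reconstruct (i : Fin N) (η : ℕ → Vec (dim i)) (t : ℕ) :
    Measurable fun s => P.reconstruct A i η s t := by
  have hs : ∀ t a b, Measurable fun s : ℕ → Fin N → Fin N → Unit ⊕ ℝ => s t a b := fun t a b =>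
    (measurable_pi_apply b).comp ((measurable_pi_apply a).comp (measurable_pi_apply t))
  induction t with
  | zero => exact measurable_const
  | succ t ih =>
    have hE : Measurable fun (s : ℕ → Fin N → Fin N → Unit ⊕ ℝ) (a b : Fin N) => (s t a b).isRight :=
      measurable_pi_iff.2 fun a => measurable_pi_iff.2 fun b => measurable_isRight.comp (hs t a b)
    have hW : ∀ j, Measurable fun s : ℕ → Fin N → Fin N → Unit ⊕ ℝ =>
        edgeWeight A (fun a b => (s t a b).isRight) i j := fun j =>
      (measurable_of_finite fun E : Fin N → Fin N → Bool => edgeWeight A E i j).comp hE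
    simp only [reconstruct]
    refine (ih.add (Measurable.smul_const (Finset.measurable_sum _ fun b _ => ?_) _)).add ?_
    · exact Measurable.ite ((measurable_isRight.comp (hs t i b)) (measurableSet_singleton true))
        (((hW b).const_mul _).mul ((measurable_signalValue.comp (hs t i b)).sub
          (measurable_signalValue.comp (hs t b i)))) measurable_const
    · exact Measurable.const_smul ((ContinuousLinearMap.adjoint (P.Hbar i)).measurable.comp
        (measurable_const.sub ((P.Hbar i).measurable.comp ih))) (P.beta i t)

end Reconstruction

end Algorithm

/-! ### Countably generated signal spaces -/

section CountablyGenerated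

/-- Countable generation of the signal space is what permits the disintegration behind
`noiseKernel`. -/
instance {ι : Type*} [Countable ι] {E : ι → Type*} [m : ∀ i, MeasurableSpace (E i)]
    [∀ i, MeasurableSpace.CountablyGenerated (E i)] :
    MeasurableSpace.CountablyGenerated (∀ i, E i) := by
  refine ⟨⋃ i, (Function.eval i ⁻¹' ·) '' MeasurableSpace.countableGeneratingSet (E i),
    Set.countable_iUnion fun i => (MeasurableSpace.countable_countableGeneratingSet).image _, ?_⟩
  rw [← MeasurableSpace.iSup_generateFrom]
  refine iSup_congr fun i => ?_
  rw [← MeasurableSpace.comap_generateFrom, MeasurableSpace.generateFrom_countableGeneratingSet]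

instance : MeasurableSpace.CountablyGenerated (Unit ⊕ ℝ) := by
  set f : Unit ⊕ ℝ → Bool × ℝ := Sum.elim (fun _ => (false, 0)) fun x => (true, x)
  have hf : Measurable f := measurable_const.sumElim measurable_prodMk_left
  have h : (inferInstance : MeasurableSpace (Unit ⊕ ℝ)) =
      MeasurableSpace.comap f inferInstance := by
    refine le_antisymm (fun s hs => ?_) hf.comap_le
    refine ⟨(({false} : Set Bool) ×ˢ {_x : ℝ | Sum.inl () ∈ s}) ∪
      (({true} : Set Bool) ×ˢ (Sum.inr ⁻¹' s)), ?_, ?_⟩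
    · exact ((measurableSet_singleton _).prod (MeasurableSet.const _)).union
        ((measurableSet_singleton _).prod (measurable_inr hs))
    · ext x
      cases x <;> simp [f]
  have h1 := MeasurableSpace.CountablyGenerated.comap f
  rwa [← h] at h1

end CountablyGenerated

/-! ### The signals as functions of the observations and the privacy noises of one sensor -/

section Row

variable {N n M : ℕ} {dim : Fin N → ℕ} (P : Algorithm N n dim)
  (A : Fin M → Matrix (Fin N) (Fin N) ℝ) (i : Fin N)
  (c : Fin N → Fin N → ℕ → ℝ) (v : Fin N → Fin N → ℕ → ℝ≥0)

/-- The edges of the union graph that start at sensor `i`, at all times. -/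
abbrev RowIndex := {j : Fin N // UnionEdge A (i, j)} × ℕ

/-- The randomness that remains when the observations of sensor `i` and its privacy noises are
fixed: the graphs, the other noises and the observations of the other sensors. -/
abbrev Background (N M : ℕ) (dim : Fin N → ℕ) :=
  (ℕ → Fin M) × (Fin N → Fin N → ℕ → ℝ) × (∀ j : Fin N, ℕ → Vec (dim j))

open Classical in
/-- The privacy noises, those of sensor `i` being given by standardized coordinates. -/
noncomputable def rowNoise (d : Fin N → Fin N → ℕ → ℝ) (e : RowIndex A i → ℝ) :
    Fin N → Fin N → ℕ → ℝ :=
  fun a b t => if h : a = i ∧ UnionEdge A (i, b) then c i b t + √(v i b t) * e (⟨b, h.2⟩, t)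
    else d a b t

/-- The output `signals` as a function of the observations of sensor `i`, the background, and the
standardized privacy noises of sensor `i`. -/
noncomputable def rowOut {S : Type*} (signals : (ℕ → Matrix (Fin N) (Fin N) ℝ) →
    (Fin N → Fin N → ℕ → ℝ) → (∀ i, ℕ → Vec (dim i)) → S)
    (z : (ℕ → Vec (dim i)) × Background N M dim × (RowIndex A i → ℝ)) : S :=
  signals (fun l => A (z.2.1.1 l)) (rowNoise A i c v z.2.1.2.1 z.2.2)
    (Function.update z.2.1.2.2 i z.1)

variable {A i c v} {d : Fin N → Fin N → ℕ → ℝ} {e : RowIndex A i → ℝ}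

lemma rowNoise_apply (q : RowIndex A i) :
    rowNoise A i c v d e i q.1 q.2 = c i q.1 q.2 + √(v i q.1 q.2) * e q := by
  rw [rowNoise, dif_pos ⟨rfl, q.1.2⟩]

open Classical in
lemma rowNoise_update_of_ne {q : RowIndex A i} {x : ℝ} {a b : Fin N} {t : ℕ}
    (h : ¬ (a = i ∧ b = q.1 ∧ t = q.2)) :
    rowNoise A i c v d (Function.update e q x) a b t = rowNoise A i c v d e a b t := by
  simp only [rowNoise]
  split_ifs with h1
  · rw [Function.update_of_ne]
    rintro rfl
    exact h ⟨h1.1, rfl, rfl⟩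
  · rfl

lemma unionEdge_of_pos {g : ℕ → Fin M} {t : ℕ} {a b : Fin N} (h : 0 < A (g t) a b) :
    UnionEdge A (a, b) := ⟨g t, h⟩

lemma measurable_rowNoise (a b : Fin N) (t : ℕ) :
    Measurable fun z : (ℕ → Vec (dim i)) × Background N M dim × (RowIndex A i → ℝ) =>
      rowNoise A i c v z.2.1.2.1 z.2.2 a b t := by
  by_cases h : a = i ∧ UnionEdge A (i, b)
  · simp only [rowNoise, dif_pos h]
    fun_prop
  · simp only [rowNoise, dif_neg h]
    fun_prop

lemma measurable_rowGraph (t : ℕ) (a b : Fin N) :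
    Measurable fun z : (ℕ → Vec (dim i)) × Background N M dim × (RowIndex A i → ℝ) =>
      A (z.2.1.1 t) a b :=
  (measurable_of_finite fun u => A u a b).comp
    ((measurable_pi_apply t).comp measurable_snd.fst.fst)

lemma measurable_rowObs (a : Fin N) (t : ℕ) :
    Measurable fun z : (ℕ → Vec (dim i)) × Background N M dim × (RowIndex A i → ℝ) =>
      Function.update z.2.1.2.2 i z.1 a t := by
  by_cases h : a = i
  · subst h
    simp only [Function.update_self]
    exact (measurable_pi_apply t).comp measurable_fst
  · simp only [Function.update_of_ne h]
    exact (measurable_pi_apply t).comp ((measurable_pi_apply a).comp measurable_snd.fst.snd.snd)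

lemma measurable_rowOut_noisySignals : Measurable (rowOut (M := M) A i c v P.noisySignals) :=
  P.measurable_noisySignals measurable_rowGraph measurable_rowNoise measurable_rowObs

lemma measurable_rowOut_binarySignals : Measurable (rowOut (M := M) A i c v P.binarySignals) :=
  P.measurable_binarySignals measurable_rowGraph measurable_rowNoise measurable_rowObs

/-! ### Shifts -/

variable (A i v) in
/-- The direction in which a coordinate of the privacy noises of sensor `i` is shifted by a
perturbation of its `k`-th observation. -/
noncomputable def shiftDir (k : ℕ) (q : RowIndex A i) : Vec (dim i) :=
  (√(v i q.1 q.2))⁻¹ • ContinuousLinearMap.adjoint (P.sensitivity i k q.2) (compressor n q.2)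

lemma inner_shiftDir (k : ℕ) (q : RowIndex A i) (hv : v i q.1 q.2 ≠ 0) (h : Vec (dim i)) :
    √(v i q.1 q.2) * inner ℝ (shiftDir P A i v k q) h =
      inner ℝ (compressor n q.2) (P.sensitivity i k q.2 h) := by
  have : √(v i q.1 q.2 : ℝ) ≠ 0 := (Real.sqrt_pos.2 (by positivity)).ne'
  rw [shiftDir, real_inner_smul_left, ContinuousLinearMap.adjoint_inner_left,
    mul_inv_cancel_left₀ this]

lemma rowNoise_shift (hv : ∀ j t, UnionEdge A (i, j) → v i j t ≠ 0) (k : ℕ) (h : Vec (dim i)) (g : ℕ → Fin M) (t : ℕ) (a b : Fin N)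
    (hab : 0 < A (g t) a b) :
    rowNoise A i c v d (e + fun q => inner ℝ (shiftDir P A i v k q) h) a b t =
      rowNoise A i c v d e a b t +
      if a = i then inner ℝ (compressor n t) (P.sensitivity i k t h) else 0 := by
  by_cases ha : a = i
  · subst ha
    have hu := unionEdge_of_pos hab
    have := inner_shiftDir P k ((⟨b, hu⟩, t) : RowIndex A a) (hv b t hu) h
    simp only at this
    simp only [rowNoise, true_and, hu, dif_pos, if_true, Pi.add_apply, mul_add, this, add_assoc]
  · simp only [rowNoise, ha, false_and, dif_neg, not_false_eq_true, if_false, add_zero]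

lemma rowOut_noisySignals_shift (hA : ∀ u, (A u).IsSymm)
    (hv : ∀ j t, UnionEdge A (i, j) → v i j t ≠ 0) (k : ℕ) (η : ℕ → Vec (dim i)) (y : Vec (dim i))
    (ξ : Background N M dim) (e : RowIndex A i → ℝ) :
    rowOut A i c v P.noisySignals (Function.update η k y, ξ, e) =
      rowOut A i c v P.noisySignals
        (η, ξ, e + fun q => inner ℝ (shiftDir P A i v k q) (y - η k)) := by
  refine P.noisySignals_perturb (fun l => hA _) i k (y - η k) (fun j hj => ?_) (fun t => ?_)
    (rowNoise_shift P hv k _ ξ.1)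
  · simp [Function.update_of_ne hj]
  · simp only [Function.update_self]
    by_cases ht : t = k
    · subst ht; simp
    · simp [ht]

/-- The binary signals are a function of the noisy ones and inherit the shift identity. -/
lemma rowOut_binarySignals_shift (hA : ∀ u, (A u).IsSymm)
    (hv : ∀ j t, UnionEdge A (i, j) → v i j t ≠ 0) (k : ℕ) (η : ℕ → Vec (dim i)) (y : Vec (dim i))
    (ξ : Background N M dim) (e : RowIndex A i → ℝ) :
    rowOut A i c v P.binarySignals (Function.update η k y, ξ, e) =
      rowOut A i c v P.binarySignals
        (η, ξ, e + fun q => inner ℝ (shiftDir P A i v k q) (y - η k)) := by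
  have := rowOut_noisySignals_shift P hA hv (c := c) k η y ξ e
  simp only [rowOut] at this ⊢
  rw [← P.quantizeSignals_noisySignals, ← P.quantizeSignals_noisySignals, this]

end Row

/-! ### Conditional means of the privacy noises given the signals -/

section RowMeans

variable {N n M : ℕ} {dim : Fin N → ℕ} (P : Algorithm N n dim)
  (A : Fin M → Matrix (Fin N) (Fin N) ℝ) (i : Fin N)
  (c : Fin N → Fin N → ℕ → ℝ) (v : Fin N → Fin N → ℕ → ℝ≥0)

/-- The compressed estimate of sensor `i`. -/
noncomputable def rowState (η : ℕ → Vec (dim i)) (ξ : Background N M dim) (e : RowIndex A i → ℝ)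
    (t : ℕ) : ℝ :=
  inner ℝ (compressor n t) (P.estimate (fun l => A (ξ.1 l)) (rowNoise A i c v ξ.2.1 e)
    (Function.update ξ.2.2 i η) t i)

/-- The standardized privacy noise recovered from the unquantized signals. -/
noncomputable def noisyMean (η : ℕ → Vec (dim i)) (q : RowIndex A i)
    (s : ℕ → Fin N → Fin N → Unit ⊕ ℝ) : ℝ :=
  if (s q.2 i q.1).isRight = true then
    (Algorithm.signalValue (s q.2 i q.1) - inner ℝ (compressor n q.2)
      (P.reconstruct A i η (P.quantizeSignals s) q.2) - c i q.1 q.2) / √(v i q.1 q.2)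
  else 0

/-- The conditional mean of the standardized privacy noise given the binary signals. -/
noncomputable def binaryMean (η : ℕ → Vec (dim i)) (q : RowIndex A i)
    (s : ℕ → Fin N → Fin N → Unit ⊕ ℝ) : ℝ :=
  let u := (P.threshold i q.1 - c i q.1 q.2 -
    inner ℝ (compressor n q.2) (P.reconstruct A i η s q.2)) / √(v i q.1 q.2)
  if (s q.2 i q.1).isRight = true then
    -- The noise itself is not visible; `u` and `u + 1` are representatives of the two sides of the
    -- threshold.
    halfMean u (if Algorithm.signalValue (s q.2 i q.1) = 1 then u else u + 1)
  else 0

lemma measurable_signal (t : ℕ) (a b : Fin N) :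
    Measurable fun s : ℕ → Fin N → Fin N → Unit ⊕ ℝ => s t a b :=
  (measurable_pi_apply b).comp ((measurable_pi_apply a).comp (measurable_pi_apply t))

lemma measurable_noisyMean (η : ℕ → Vec (dim i)) (q : RowIndex A i) :
    Measurable (noisyMean P A i c v η q) := by
  refine Measurable.ite ((Algorithm.measurable_isRight.comp (measurable_signal _ _ _))
    (measurableSet_singleton true)) ?_ measurable_const
  exact ((((Algorithm.measurable_signalValue.comp (measurable_signal _ _ _)).sub
    (Measurable.const_inner ((P.measurable_reconstruct A i η q.2).comp
      P.measurable_quantizeSignals))).sub_const _).div_const _)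

lemma measurable_binaryMean (η : ℕ → Vec (dim i)) (q : RowIndex A i) :
    Measurable (binaryMean P A i c v η q) := by
  have hu : Measurable fun s : ℕ → Fin N → Fin N → Unit ⊕ ℝ =>
      (P.threshold i q.1 - c i q.1 q.2 -
        inner ℝ (compressor n q.2) (P.reconstruct A i η s q.2)) / √(v i q.1 q.2 : ℝ) :=
    ((measurable_const.sub (P.measurable_reconstruct A i η q.2).const_inner).div_const _)
  refine Measurable.ite ((Algorithm.measurable_isRight.comp (measurable_signal _ _ _))
    (measurableSet_singleton true)) ?_ measurable_const
  exact measurable_halfMean.comp (hu.prodMk (Measurable.ite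
    ((Algorithm.measurable_signalValue.comp (measurable_signal _ _ _)) (measurableSet_singleton 1))
    hu (hu.add_const 1)))

variable {A i c v} {η : ℕ → Vec (dim i)}

-- The estimate at time `t` involves only noises at times strictly before `t`, so resampling one at
-- a time `q.2 ≥ t` has no effect.
open Classical in
lemma rowState_update (hA : ∀ u, (A u).IsSymm) (ξ : Background N M dim) (e : RowIndex A i → ℝ)
    (q : RowIndex A i) (x : ℝ) {t : ℕ} (ht : t ≤ q.2) :
    rowState P A i c v η ξ (Function.update e q x) t = rowState P A i c v η ξ e t := by
  simp only [rowState]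
  rw [P.estimate_congr (fun l => hA _) fun l hl a b _ => rowNoise_update_of_ne fun h => ?_]
  omega

/-- Quantizing the noisy signals yields the binary ones, from which the estimate is reconstructed;
subtracting it from the noisy signal leaves exactly the noise. -/
lemma noisyMean_rowOut (hA : ∀ u, (A u).IsSymm)
    (hw : ∀ u v, (∀ i j, 0 < A u i j ↔ 0 < A v i j) → A u = A v)
    (hv : ∀ j t, UnionEdge A (i, j) → v i j t ≠ 0) (ξ : Background N M dim)
    (e : RowIndex A i → ℝ) (q : RowIndex A i) :
    noisyMean P A i c v η q (rowOut A i c v P.noisySignals (η, ξ, e)) =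
      if 0 < A (ξ.1 q.2) i q.1 then e q else 0 := by
  simp only [noisyMean, rowOut, P.isRight_noisySignals]
  split_ifs with h
  · have hs : √(v i q.1 q.2 : ℝ) ≠ 0 := by
      have := hv q.1 q.2 q.1.2
      exact (Real.sqrt_pos.2 (by positivity)).ne'
    have hr := P.reconstruct_binarySignals A hw hA ξ.1 (fun l => rfl) i q.2
      (y := Function.update ξ.2.2 i η) (d := rowNoise A i c v ξ.2.1 e)
    rw [Function.update_self] at hr
    rw [P.quantizeSignals_noisySignals, hr]
    simp only [Algorithm.noisySignals, h, if_true, Algorithm.signalValue, Sum.elim_inr, id,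
      rowNoise_apply]
    field_simp
    ring
  · rfl

lemma quantize_rowState (hv : ∀ j t, UnionEdge A (i, j) → v i j t ≠ 0) (q : RowIndex A i)
    (r x : ℝ) : r + (c i q.1 q.2 + √(v i q.1 q.2) * x) ≤ P.threshold i q.1 ↔
      x ≤ (P.threshold i q.1 - c i q.1 q.2 - r) / √(v i q.1 q.2) := by
  have hs : 0 < √(v i q.1 q.2 : ℝ) := by
    have := hv q.1 q.2 q.1.2
    exact Real.sqrt_pos.2 (by positivity)
  rw [le_div_iff₀ hs]
  constructor <;> intro h <;> linarith

lemma halfMean_congr {u x x' : ℝ} (h : x ≤ u ↔ x' ≤ u) : halfMean u x = halfMean u x' := by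
  simp only [halfMean, h]

lemma binaryMean_rowOut (hA : ∀ u, (A u).IsSymm)
    (hw : ∀ u v, (∀ i j, 0 < A u i j ↔ 0 < A v i j) → A u = A v)
    (hv : ∀ j t, UnionEdge A (i, j) → v i j t ≠ 0) (ξ : Background N M dim)
    (e : RowIndex A i → ℝ) (q : RowIndex A i) :
    binaryMean P A i c v η q (rowOut A i c v P.binarySignals (η, ξ, e)) =
      if 0 < A (ξ.1 q.2) i q.1 then
        halfMean ((P.threshold i q.1 - c i q.1 q.2 - rowState P A i c v η ξ e q.2) /
          √(v i q.1 q.2)) (e q) else 0 := by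
  simp only [binaryMean, rowOut, P.isRight_binarySignals]
  by_cases h : 0 < A (ξ.1 q.2) i q.1
  · have hr := P.reconstruct_binarySignals A hw hA ξ.1 (fun l => rfl) i q.2
      (y := Function.update ξ.2.2 i η) (d := rowNoise A i c v ξ.2.1 e)
    rw [Function.update_self] at hr
    rw [if_pos h, if_pos h, hr]
    have hval : Algorithm.signalValue (P.binarySignals (fun l => A (ξ.1 l))
        (rowNoise A i c v ξ.2.1 e) (Function.update ξ.2.2 i η) q.2 i q.1) = 1 ↔
        rowState P A i c v η ξ e q.2 + (c i q.1 q.2 + √(v i q.1 q.2) * e q) ≤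
          P.threshold i q.1 := by
      simp only [Algorithm.binarySignals, h, if_true, Algorithm.signalValue, Sum.elim_inr, id,
        rowNoise_apply, quantize, rowState]
      split_ifs with h1
      · simp [h1]
      · norm_num [h1]
    rw [quantize_rowState P hv] at hval
    refine halfMean_congr ?_
    rw [rowState] at hval
    simp only [hval]
    split_ifs with h1 <;> simp [h1]
  · rw [if_neg h, if_neg h]

open Classical in
lemma rowOut_noisySignals_update (hA : ∀ u, (A u).IsSymm) (ξ : Background N M dim)
    (e : RowIndex A i → ℝ) (q : RowIndex A i) (x x' : ℝ) (h : ¬ 0 < A (ξ.1 q.2) i q.1) :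
    rowOut A i c v P.noisySignals (η, ξ, Function.update e q x) =
      rowOut A i c v P.noisySignals (η, ξ, Function.update e q x') := by
  refine P.noisySignals_congr (fun l => hA _) fun t a b hab => ?_
  have : ¬ (a = i ∧ b = q.1 ∧ t = q.2) := by
    rintro ⟨rfl, rfl, rfl⟩
    exact h hab
  rw [rowNoise_update_of_ne this, rowNoise_update_of_ne this]

-- Earlier signals ignore the `q`-th noise, the signal it enters changes only when it crosses the
-- threshold, and later estimates depend on it only through that signal.
open Classical in
lemma rowOut_binarySignals_update (hA : ∀ u, (A u).IsSymm)
    (hv : ∀ j t, UnionEdge A (i, j) → v i j t ≠ 0) (ξ : Background N M dim)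
    (e : RowIndex A i → ℝ) (q : RowIndex A i) (x x' : ℝ) (h : 0 < A (ξ.1 q.2) i q.1 →
      (x ≤ (P.threshold i q.1 - c i q.1 q.2 - rowState P A i c v η ξ e q.2) / √(v i q.1 q.2) ↔
      x' ≤ (P.threshold i q.1 - c i q.1 q.2 - rowState P A i c v η ξ e q.2) / √(v i q.1 q.2))) :
    rowOut A i c v P.binarySignals (η, ξ, Function.update e q x) =
      rowOut A i c v P.binarySignals (η, ξ, Function.update e q x') := by
  refine P.binarySignals_congr_of_quantize (fun l => hA _) fun t a b hab => ?_
  by_cases hq : a = i ∧ b = q.1 ∧ t = q.2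
  · obtain ⟨rfl, rfl, rfl⟩ := hq
    have h1 := h hab
    rw [← quantize_rowState P hv, ← quantize_rowState P hv,
      ← rowState_update P hA ξ e q x le_rfl] at h1
    simp only [rowNoise_apply, Function.update_self, quantize]
    simp only [rowState] at h1
    simp only [h1]
  · rw [rowNoise_update_of_ne hq, rowNoise_update_of_ne hq]

open Classical in
lemma isCoordMean_noisySignals (hA : ∀ u, (A u).IsSymm)
    (hw : ∀ u v, (∀ i j, 0 < A u i j ↔ 0 < A v i j) → A u = A v)
    (hv : ∀ j t, UnionEdge A (i, j) → v i j t ≠ 0) (η : ℕ → Vec (dim i)) :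
    IsCoordMean (fun ξ e => rowOut A i c v P.noisySignals (η, ξ, e))
      (noisyMean P A i c v η) where
  measurable := measurable_noisyMean P A i c v η
  integral_eq q ξ e f := by
    simp only [noisyMean_rowOut P hA hw hv, Function.update_self]
    split_ifs with h
    · rfl
    · simp_rw [rowOut_noisySignals_update P hA ξ e q _ 0 h]
      rw [integral_const_mul]
      simp [integral_id_gaussianReal]
  integrable_sq q ξ e := by
    simp only [noisyMean_rowOut P hA hw hv, Function.update_self]
    split_ifs with h
    · exact (memLp_id_gaussianReal 2).integrable_sq
    · simp
  integral_sq_le q ξ e := by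
    simp only [noisyMean_rowOut P hA hw hv, Function.update_self]
    split_ifs with h
    · rw [integral_sq_gaussianReal]
    · simp
  causal q q' hqq' := by
    left
    intro ξ e x
    simp only [noisyMean_rowOut P hA hw hv, Function.update_of_ne hqq'.symm]

open Classical in
lemma isCoordMean_binarySignals (hA : ∀ u, (A u).IsSymm)
    (hw : ∀ u v, (∀ i j, 0 < A u i j ↔ 0 < A v i j) → A u = A v)
    (hv : ∀ j t, UnionEdge A (i, j) → v i j t ≠ 0) (η : ℕ → Vec (dim i)) :
    IsCoordMean (fun ξ e => rowOut A i c v P.binarySignals (η, ξ, e))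
      (binaryMean P A i c v η) where
  measurable := measurable_binaryMean P A i c v η
  integral_eq q ξ e f := by
    simp only [binaryMean_rowOut P hA hw hv, Function.update_self, rowState_update P hA ξ e q _ le_rfl]
    split_ifs with h
    · exact integral_mul_halfMean fun x x' hx => by
        rw [rowOut_binarySignals_update P hA hv ξ e q x x' fun _ => hx]
    · simp_rw [rowOut_binarySignals_update P hA hv ξ e q _ 0 fun h' => absurd h' h]
      rw [integral_const_mul]
      simp [integral_id_gaussianReal]
  integrable_sq q ξ e := by
    simp only [binaryMean_rowOut P hA hw hv, Function.update_self, rowState_update P hA ξ e q _ le_rfl]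
    split_ifs with h
    · exact integrable_halfMean_sq _
    · simp
  integral_sq_le q ξ e := by
    simp only [binaryMean_rowOut P hA hw hv, Function.update_self, rowState_update P hA ξ e q _ le_rfl]
    split_ifs with h
    · refine (integral_halfMean_sq_le _).trans ?_
      rw [div_le_one Real.pi_pos]
      exact Real.two_le_pi
    · simp
  causal q q' hqq' := by
    -- The noise with the later time leaves the other threshold alone. Equal times are included,
    -- since the thresholds depend on strictly earlier noises.
    have key : ∀ q q' : RowIndex A i, q ≠ q' → q'.2 ≤ q.2 → ∀ (ξ : Background N M dim)
        (e : RowIndex A i → ℝ) x,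
        binaryMean P A i c v η q' (rowOut A i c v P.binarySignals (η, ξ, Function.update e q x)) =
        binaryMean P A i c v η q' (rowOut A i c v P.binarySignals (η, ξ, e)) := by
      intro q q' hqq' hle ξ e x
      simp only [binaryMean_rowOut P hA hw hv, Function.update_of_ne hqq'.symm,
        rowState_update P hA ξ e q x hle]
    rcases le_total q'.2 q.2 with h | h
    · exact Or.inl (key q q' hqq' h)
    · exact Or.inr (key q' q hqq'.symm h)

open Classical in
lemma integral_binaryMean_sq_le (hA : ∀ u, (A u).IsSymm)
    (hw : ∀ u v, (∀ i j, 0 < A u i j ↔ 0 < A v i j) → A u = A v)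
    (hv : ∀ j t, UnionEdge A (i, j) → v i j t ≠ 0) (η : ℕ → Vec (dim i)) (q : RowIndex A i)
    (ξ : Background N M dim) (e : RowIndex A i → ℝ) :
    ∫ x, binaryMean P A i c v η q
        (rowOut A i c v P.binarySignals (η, ξ, Function.update e q x)) ^ 2 ∂gaussianReal 0 1 ≤
      2 / Real.pi * ∫ x, noisyMean P A i c v η q
        (rowOut A i c v P.noisySignals (η, ξ, Function.update e q x)) ^ 2 ∂gaussianReal 0 1 := by
  simp only [binaryMean_rowOut P hA hw hv, noisyMean_rowOut P hA hw hv, Function.update_self,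
    rowState_update P hA ξ e q _ le_rfl]
  split_ifs with h
  · rw [integral_sq_gaussianReal, mul_one]
    exact integral_halfMean_sq_le _
  · simp

end RowMeans

/-! ### Summability of the shift directions -/

section Summability

variable {N n M : ℕ} {dim : Fin N → ℕ} (P : Algorithm N n dim)

lemma le_norm_of_hasEigenvalue {T : Vec n →L[ℝ] Vec n} {l : ℝ}
    (hl : Module.End.HasEigenvalue T.toLinearMap l) : l ≤ ‖T‖ := by
  obtain ⟨x, hx⟩ := hl.exists_hasEigenvector
  have h1 : T x = l • x := hx.apply_eq_smul
  have h2 := T.le_opNorm x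
  rw [h1, norm_smul] at h2
  exact (le_abs_self l).trans (le_of_mul_le_mul_right h2 (norm_pos_iff.2 hx.2))

lemma le_lambdaMax {T : Vec n →L[ℝ] Vec n} {l : ℝ}
    (hl : Module.End.HasEigenvalue T.toLinearMap l) : l ≤ lambdaMax T :=
  le_csSup ⟨‖T‖, fun _ h => le_norm_of_hasEigenvalue h⟩ hl

lemma lambdaMinPos_le {T : Vec n →L[ℝ] Vec n} {l : ℝ} (h0 : 0 < l)
    (hl : Module.End.HasEigenvalue T.toLinearMap l) : lambdaMinPos T ≤ l :=
  csInf_le ⟨0, fun _ h => h.1.le⟩ ⟨h0, hl⟩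

/-! ### Contraction of a Gram step on the range of the adjoint -/

section Spectral

variable {m : ℕ} (B : Vec n →L[ℝ] Vec m)

lemma inner_gram (x y : Vec n) :
    inner ℝ x (((ContinuousLinearMap.adjoint B).comp B) y) = inner ℝ (B x) (B y) := by
  rw [ContinuousLinearMap.comp_apply, ContinuousLinearMap.adjoint_inner_right]

lemma isSymmetric_gram : ((ContinuousLinearMap.adjoint B).comp B).toLinearMap.IsSymmetric := by
  intro x y
  change inner ℝ (((ContinuousLinearMap.adjoint B).comp B) x) y =
    inner ℝ x (((ContinuousLinearMap.adjoint B).comp B) y)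
  rw [inner_gram, real_inner_comm, inner_gram, real_inner_comm]

/-- An orthonormal basis of eigenvectors of the Gram operator, with the eigenvalues. -/
lemma exists_gram_eigenbasis : ∃ (b : OrthonormalBasis (Fin n) ℝ (Vec n)) (l : Fin n → ℝ),
    (∀ j, ((ContinuousLinearMap.adjoint B).comp B) (b j) = l j • b j) ∧
    (∀ j, Module.End.HasEigenvalue ((ContinuousLinearMap.adjoint B).comp B).toLinearMap (l j)) ∧
    (∀ j, l j = ‖B (b j)‖ ^ 2) := by
  have hn : Module.finrank ℝ (Vec n) = n := by simp
  have hs := isSymmetric_gram B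
  have h1 : ∀ j, ((ContinuousLinearMap.adjoint B).comp B) (hs.eigenvectorBasis hn j) =
      hs.eigenvalues hn j • hs.eigenvectorBasis hn j := fun j => hs.apply_eigenvectorBasis hn j
  refine ⟨hs.eigenvectorBasis hn, hs.eigenvalues hn, h1, fun j => hs.hasEigenvalue_eigenvalues hn j,
    fun j => ?_⟩
  have h2 := inner_gram B (hs.eigenvectorBasis hn j) (hs.eigenvectorBasis hn j)
  rw [h1, real_inner_smul_right, real_inner_self_eq_norm_sq, real_inner_self_eq_norm_sq,
    OrthonormalBasis.norm_eq_one] at h2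
  simpa using h2

/-- A nonzero `B` has a positive Gram eigenvalue: otherwise every `‖B b_j‖²` would vanish on the
eigenbasis. -/
lemma lambdaMinPos_le_lambdaMax_gram (hB : B ≠ 0) :
    lambdaMinPos ((ContinuousLinearMap.adjoint B).comp B) ≤
      lambdaMax ((ContinuousLinearMap.adjoint B).comp B) := by
  obtain ⟨b, l, hb, hl, hlB⟩ := exists_gram_eigenbasis B
  by_contra! hlt
  refine hB (ContinuousLinearMap.ext fun x => ?_)
  have h0 : ∀ j, B (b j) = 0 := fun j => by
    by_contra hne
    have hpos : 0 < l j := by rw [hlB]; positivity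
    exact absurd ((lambdaMinPos_le hpos (hl j)).trans (le_lambdaMax (hl j))) (not_le.2 hlt)
  rw [← b.sum_repr x, map_sum]
  simp [h0]

/-- On the range of the adjoint, a step along the Gram operator contracts. -/
lemma norm_sub_smul_gram_le {β : ℝ} (hβ : 0 ≤ β)
    (hβ1 : β * lambdaMax ((ContinuousLinearMap.adjoint B).comp B) < 1) (hB : B ≠ 0) (u : Vec m) :
    ‖ContinuousLinearMap.adjoint B u - β • ((ContinuousLinearMap.adjoint B).comp B)
        (ContinuousLinearMap.adjoint B u)‖ ≤
      (1 - lambdaMinPos ((ContinuousLinearMap.adjoint B).comp B) * β) *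
        ‖ContinuousLinearMap.adjoint B u‖ := by
  obtain ⟨b, l, hb, hl, hlB⟩ := exists_gram_eigenbasis B
  set T := (ContinuousLinearMap.adjoint B).comp B
  set x := ContinuousLinearMap.adjoint B u
  have hle := lambdaMinPos_le_lambdaMax_gram B hB
  have hpos : 0 ≤ 1 - lambdaMinPos T * β := by nlinarith
  refine le_of_sq_le_sq ?_ (by positivity)
  rw [mul_pow, ← b.sum_sq_norm_inner_right, ← b.sum_sq_norm_inner_right, Finset.mul_sum]
  refine Finset.sum_le_sum fun j _ => ?_
  have h1 : inner ℝ (b j) (x - β • T x) = (1 - β * l j) * inner ℝ (b j) x := by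
    have : inner ℝ (b j) (T x) = l j * inner ℝ (b j) x := by
      have := isSymmetric_gram B (b j) x
      change inner ℝ (T (b j)) x = inner ℝ (b j) (T x) at this
      rw [← this, hb, real_inner_smul_left]
    rw [inner_sub_right, real_inner_smul_right, this]
    ring
  rw [h1, norm_mul, mul_pow, Real.norm_eq_abs, sq_abs]
  -- Vectors in the range of the adjoint have no component in the kernel of `B`; on the other
  -- eigenvectors `0 < 1 - β l ≤ 1 - λ⁺_min β`.
  by_cases h0 : B (b j) = 0
  · have : inner ℝ (b j) x = 0 := by
      rw [ContinuousLinearMap.adjoint_inner_right, h0, inner_zero_left]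
    simp [this]
  · have hlpos : 0 < l j := by rw [hlB]; positivity
    have h2 := lambdaMinPos_le hlpos (hl j)
    have h3 := le_lambdaMax (hl j)
    refine mul_le_mul_of_nonneg_right (pow_le_pow_left₀ ?_ ?_ 2) (sq_nonneg _)
    · nlinarith
    · nlinarith

end Spectral

/-! ### Decay of the sensitivities and summability -/

variable {P} {i : Fin N} {k : ℕ}

lemma sensitivity_of_le {t : ℕ} (ht : t ≤ k) : P.sensitivity i k t = 0 := by
  induction t with
  | zero => rfl
  | succ t ih =>
    rw [Algorithm.sensitivity, ih (by omega), if_neg (by omega)]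
    ext1 h
    simp

/-- Needed because `1 - β Q_i` is the identity on the kernel of `Q_i`: the decay takes place only in
the range of `H̄_iᵀ`. -/
lemma sensitivity_mem_range (t : ℕ) (h : Vec (dim i)) :
    ∃ u, P.sensitivity i k t h = ContinuousLinearMap.adjoint (P.Hbar i) u := by
  induction t with
  | zero => exact ⟨0, by simp [Algorithm.sensitivity]⟩
  | succ t ih =>
    obtain ⟨u, hu⟩ := ih
    refine ⟨u - P.beta i t • P.Hbar i (P.sensitivity i k t h) +
      if t = k then P.beta i t • h else 0, ?_⟩
    rw [map_add, map_sub, ← hu]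
    simp only [Algorithm.sensitivity, Algorithm.Q]
    split_ifs <;> simp

lemma sensitivity_eq_zero (hH : P.Hbar i = 0) (t : ℕ) : P.sensitivity i k t = 0 := by
  ext1 h
  obtain ⟨u, hu⟩ := sensitivity_mem_range (P := P) (i := i) (k := k) t h
  rw [hu, hH]
  simp

lemma norm_sensitivity_le (hH : P.Hbar i ≠ 0) (hβ : ∀ t, 0 ≤ P.beta i t)
    (hβ1 : ∀ t, P.beta i t * lambdaMax (P.Q i) < 1) :
    ∃ C, ∀ t, ‖P.sensitivity i k t‖ ≤
      C * ∏ l ∈ Finset.range t, (1 - lambdaMinPos (P.Q i) * P.beta i l) := by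
  have hpos : ∀ t, 0 < 1 - lambdaMinPos (P.Q i) * P.beta i t := fun t => by
    have h1 : lambdaMinPos (P.Q i) ≤ lambdaMax (P.Q i) := lambdaMinPos_le_lambdaMax_gram _ hH
    nlinarith [hβ t, hβ1 t]
  set p := fun t => ∏ l ∈ Finset.range t, (1 - lambdaMinPos (P.Q i) * P.beta i l)
  have hp : ∀ t, 0 < p t := fun t => Finset.prod_pos fun l _ => hpos l
  -- The sensitivity vanishes up to time `k`, so the constant is normalized at time `k + 1`, after
  -- which each step contracts.
  refine ⟨‖P.sensitivity i k (k + 1)‖ / p (k + 1), fun t => ?_⟩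
  rcases Nat.lt_or_ge k t with h | h
  · induction t, h using Nat.le_induction with
    | base => exact (div_mul_cancel₀ _ (hp (k + 1)).ne').ge
    | succ t ht ih =>
      have h1 : ‖P.sensitivity i k (t + 1)‖ ≤
          (1 - lambdaMinPos (P.Q i) * P.beta i t) * ‖P.sensitivity i k t‖ := by
        refine ContinuousLinearMap.opNorm_le_bound _ (mul_nonneg (hpos t).le (norm_nonneg _))
          fun h => ?_
        obtain ⟨u, hu⟩ := sensitivity_mem_range (P := P) (i := i) (k := k) t h
        have h2 : P.sensitivity i k (t + 1) h = P.sensitivity i k t h -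
            P.beta i t • P.Q i (P.sensitivity i k t h) := by
          rw [Algorithm.sensitivity, if_neg (by omega)]
          simp
        rw [h2, mul_assoc, hu]
        refine (norm_sub_smul_gram_le (P.Hbar i) (hβ t) (hβ1 t) hH u).trans ?_
        refine mul_le_mul_of_nonneg_left ?_ (hpos t).le
        rw [← hu]
        exact (P.sensitivity i k t).le_opNorm h
      refine h1.trans ((mul_le_mul_of_nonneg_left ih (hpos t).le).trans_eq ?_)
      rw [Finset.prod_range_succ]
      ring
  · rw [sensitivity_of_le h, norm_zero]
    have := (hp t).le
    have := (hp (k + 1)).le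
    positivity

lemma norm_compressor_le (n t : ℕ) : ‖compressor n t‖ ≤ 1 := by
  rw [EuclideanSpace.norm_eq, Real.sqrt_le_iff, one_pow]
  refine ⟨zero_le_one, ?_⟩
  rcases n.eq_zero_or_pos with rfl | hn
  · simp
  · rw [Finset.sum_eq_single (⟨t % n, Nat.mod_lt t hn⟩ : Fin n)]
    · simp [compressor]
    · intro l _ hl
      have : (l : ℕ) ≠ t % n := fun h => hl (Fin.ext h)
      simp [compressor, this]
    · simp

variable {A : Fin M → Matrix (Fin N) (Fin N) ℝ} {c : Fin N → Fin N → ℕ → ℝ}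
  {v : Fin N → Fin N → ℕ → ℝ≥0}

lemma norm_shiftDir_sq_le (k : ℕ) (q : RowIndex A i) :
    ‖shiftDir P A i v k q‖ ^ 2 ≤ (v i q.1 q.2 : ℝ)⁻¹ * ‖P.sensitivity i k q.2‖ ^ 2 := by
  rw [shiftDir, norm_smul, mul_pow, norm_inv, Real.norm_of_nonneg (Real.sqrt_nonneg _), inv_pow,
    Real.sq_sqrt (NNReal.coe_nonneg _)]
  refine mul_le_mul_of_nonneg_left (pow_le_pow_left₀ (norm_nonneg _) ?_ 2) (by positivity)
  refine ((ContinuousLinearMap.adjoint (P.sensitivity i k q.2)).le_opNorm _).trans ?_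
  rw [LinearIsometryEquiv.norm_map]
  exact mul_le_of_le_one_right (norm_nonneg _) (norm_compressor_le n q.2)

lemma summable_norm_shiftDir_sq (hstep : StepConditions P A c v)
    (hv : ∀ j t, UnionEdge A (i, j) → v i j t ≠ 0) (k : ℕ) :
    Summable fun q : RowIndex A i => ‖shiftDir P A i v k q‖ ^ 2 := by
  by_cases hH : P.Hbar i = 0
  · have : ∀ q : RowIndex A i, shiftDir P A i v k q = 0 := fun q => by
      simp [shiftDir, sensitivity_eq_zero hH]
    simp [this, summable_zero]
  have : Finite {j : Fin N // UnionEdge A (i, j)} := inferInstance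
  refine (summable_prod_of_nonneg fun q => sq_nonneg _).2 ⟨fun j => ?_, Summable.of_finite⟩
  obtain ⟨C, hC⟩ := norm_sensitivity_le (k := k) hH (hstep.beta_nonneg i) (hstep.beta_lt i)
  -- `π / 2` comes from `1 / v ≤ (π / 2) η`. The `4` pays for the one extra factor in the product of
  -- the hypothesis, which eventually is at least `1/4` because `β` tends to zero.
  have hsum := (hstep.eta_summable i j j.2 hH).mul_left (Real.pi / 2 * (C ^ 2 * 4))
  refine Summable.of_norm_bounded_eventually_nat hsum ?_
  have hβ : Tendsto (fun t => lambdaMinPos (P.Q i) * P.beta i t) atTop (𝓝 0) := by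
    have h1 := (hstep.beta_sq i).tendsto_atTop_zero.sqrt
    simp only [Real.sqrt_sq (hstep.beta_nonneg i _), Real.sqrt_zero] at h1
    simpa using h1.const_mul (lambdaMinPos (P.Q i))
  filter_upwards [hβ.eventually_le_const (show (0 : ℝ) < 1 / 2 by norm_num)] with t ht
  have hv' := hv j t j.2
  have hvpos : (0 : ℝ) < v i j t := by positivity
  set p := ∏ l ∈ Finset.range t, (1 - lambdaMinPos (P.Q i) * P.beta i l)
  have heta := two_div_pi_div_le_etaGaussian (c i j t) hv'
  have heta' : (v i j t : ℝ)⁻¹ ≤ Real.pi / 2 * etaGaussian (c i j t) (v i j t) := by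
    have hpi := Real.pi_pos
    calc (v i j t : ℝ)⁻¹ = Real.pi / 2 * (2 / Real.pi / v i j t) := by field_simp
      _ ≤ _ := mul_le_mul_of_nonneg_left heta (by positivity)
  have h1 : ‖P.sensitivity i k t‖ ^ 2 ≤ C ^ 2 * p ^ 2 := by
    rw [← mul_pow]
    exact pow_le_pow_left₀ (norm_nonneg _) (hC t) 2
  have h2 : p ^ 2 ≤ 4 * ∏ l ∈ Finset.range (t + 1), (1 - lambdaMinPos (P.Q i) * P.beta i l) ^ 2 := by
    rw [Finset.prod_pow, Finset.prod_range_succ, mul_pow]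
    have h3 : (1 : ℝ) / 4 ≤ (1 - lambdaMinPos (P.Q i) * P.beta i t) ^ 2 := by nlinarith
    nlinarith [sq_nonneg p]
  rw [Real.norm_of_nonneg (sq_nonneg _)]
  refine (norm_shiftDir_sq_le k (j, t)).trans ?_
  calc (v i j t : ℝ)⁻¹ * ‖P.sensitivity i k t‖ ^ 2
      ≤ (Real.pi / 2 * etaGaussian (c i j t) (v i j t)) * (C ^ 2 * (4 * ∏ l ∈ Finset.range (t + 1),
          (1 - lambdaMinPos (P.Q i) * P.beta i l) ^ 2)) := by
        refine mul_le_mul heta' (h1.trans (mul_le_mul_of_nonneg_left h2 (sq_nonneg _)))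
          (sq_nonneg _) ?_
        exact (inv_pos.2 hvpos).le.trans heta'
    _ = _ := by ring

end Summability

/-! ### The joint law of the observations, the background and the privacy noises -/

section JointLaw

lemma indepFun_prodMk_assoc {Ω α β γ : Type*} [MeasurableSpace Ω] [MeasurableSpace α]
    [MeasurableSpace β] [MeasurableSpace γ] {μ : Measure Ω} [IsProbabilityMeasure μ] {X : Ω → α}
    {Y : Ω → β} {Z : Ω → γ} (hX : Measurable X) (hY : Measurable Y) (hZ : Measurable Z)
    (h : IndepFun X Y μ) (h' : IndepFun (fun ω => (X ω, Y ω)) Z μ) :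
    IndepFun X (fun ω => (Y ω, Z ω)) μ := by
  have hYZ : IndepFun Y Z μ := h'.comp measurable_snd measurable_id
  rw [indepFun_iff_map_prod_eq_prod_map_map hX.aemeasurable hY.aemeasurable] at h
  rw [indepFun_iff_map_prod_eq_prod_map_map (hX.prodMk hY).aemeasurable hZ.aemeasurable, h] at h'
  rw [indepFun_iff_map_prod_eq_prod_map_map hY.aemeasurable hZ.aemeasurable] at hYZ
  rw [indepFun_iff_map_prod_eq_prod_map_map hX.aemeasurable (hY.prodMk hZ).aemeasurable, hYZ]
  have hX' : IsProbabilityMeasure (μ.map X) := Measure.isProbabilityMeasure_map hX.aemeasurable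
  have hY' : IsProbabilityMeasure (μ.map Y) := Measure.isProbabilityMeasure_map hY.aemeasurable
  have hZ' : IsProbabilityMeasure (μ.map Z) := Measure.isProbabilityMeasure_map hZ.aemeasurable
  rw [← Measure.prodAssoc_prod, ← h', Measure.map_map (MeasurableEquiv.measurable _)
    ((hX.prodMk hY).prodMk hZ)]
  rfl

/-! ### The independent sources of randomness and their σ-algebras -/

section Ingredients

variable {Ω : Type*} {m : MeasurableSpace Ω}
  {N n M : ℕ} {dim : Fin N → ℕ} {A : Fin M → Matrix (Fin N) (Fin N) ℝ}
  {r : ℕ → Ω → Fin M} {θ : Vec n} {H : ∀ i, ℕ → Ω → (Vec n →L[ℝ] Vec (dim i))}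
  {w : ∀ i, ℕ → Ω → Vec (dim i)} {d : Fin N → Fin N → ℕ → Ω → ℝ}
  {c : Fin N → Fin N → ℕ → ℝ} {v : Fin N → Fin N → ℕ → ℝ≥0} {i : Fin N}

/-- A representative of the current graph, chosen as a function of its weights. -/
noncomputable def graphIndex (A : Fin M → Matrix (Fin N) (Fin N) ℝ) (r : ℕ → Ω → Fin M) (ω : Ω) :
    ℕ → Fin M :=
  have : Nonempty (Fin M) := ⟨r 0 ω⟩
  fun t => Function.invFun A (A (r t ω))

lemma graphIndex_spec (t : ℕ) (ω : Ω) : A (graphIndex A r ω t) = A (r t ω) := by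
  have : Nonempty (Fin M) := ⟨r 0 ω⟩
  exact Function.invFun_eq ⟨r t ω, rfl⟩

/-- The independence hypotheses concern the weights `A (r t)` and not the chain `r` itself; an index
chosen as a function of the weights is measurable for the right σ-algebra. -/
lemma measurable_graphIndex [Nonempty Ω]
    (h : ∀ t, MeasurableSpace.comap (fun ω => A (r t ω)) ⊤ ≤ m) : Measurable (graphIndex A r) := by
  have : Nonempty (Fin M) := ⟨r 0 (Classical.arbitrary Ω)⟩
  refine measurable_pi_iff.2 fun t => ?_
  have h1 : @Measurable _ _ ⊤ _ (Function.invFun A) := measurable_from_top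
  have h2 : @Measurable _ _ m ⊤ (fun ω => A (r t ω)) := measurable_iff_comap_le.2 (h t)
  exact h1.comp h2

open Classical in
/-- The privacy noises of the sensors other than `i` along edges of the union graph. -/
noncomputable def otherNoise (A : Fin M → Matrix (Fin N) (Fin N) ℝ) (i : Fin N)
    (d : Fin N → Fin N → ℕ → Ω → ℝ) (ω : Ω) : Fin N → Fin N → ℕ → ℝ :=
  fun a b t => if a ≠ i ∧ UnionEdge A (a, b) then d a b t ω else 0

/-- The standardized privacy noises of sensor `i`. -/
noncomputable def stdNoise (A : Fin M → Matrix (Fin N) (Fin N) ℝ) (i : Fin N)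
    (d : Fin N → Fin N → ℕ → Ω → ℝ) (c : Fin N → Fin N → ℕ → ℝ) (v : Fin N → Fin N → ℕ → ℝ≥0)
    (ω : Ω) : RowIndex A i → ℝ :=
  fun q => (d i q.1 q.2 ω - c i q.1 q.2) / √(v i q.1 q.2)

/-- The observations of the other sensors. -/
noncomputable def otherObs (θ : Vec n) (H : ∀ i, ℕ → Ω → (Vec n →L[ℝ] Vec (dim i)))
    (w : ∀ i, ℕ → Ω → Vec (dim i)) (i : Fin N) (ω : Ω) : ∀ j, ℕ → Vec (dim j) :=
  Function.update (observation θ H w ω) i 0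

lemma measurable_observation (j : Fin N) (t : ℕ)
    (hH : MeasurableSpace.comap (H j t) inferInstance ≤ m)
    (hw : MeasurableSpace.comap (w j t) inferInstance ≤ m) :
    Measurable fun ω => observation θ H w ω j t := by
  have h1 : Measurable (H j t) := measurable_iff_comap_le.2 hH
  have h2 : Measurable (w j t) := measurable_iff_comap_le.2 hw
  have h3 : Measurable fun T : Vec n →L[ℝ] Vec (dim j) => T θ :=
    (ContinuousLinearMap.apply ℝ (Vec (dim j)) θ).continuous.measurable
  exact (h3.comp h1).add h2

lemma measurable_otherObs
    (hH : ∀ j t, j ≠ i → MeasurableSpace.comap (H j t) inferInstance ≤ m)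
    (hw : ∀ j t, j ≠ i → MeasurableSpace.comap (w j t) inferInstance ≤ m) :
    Measurable (otherObs θ H w i) := by
  refine measurable_pi_iff.2 fun j => measurable_pi_iff.2 fun t => ?_
  by_cases h : j = i
  · subst h
    simp only [otherObs, Function.update_self]
    exact measurable_const
  · simp only [otherObs, Function.update_of_ne h]
    exact measurable_observation j t (hH j t h) (hw j t h)

lemma measurable_otherNoise
    (h : ∀ a b t, a ≠ i → UnionEdge A (a, b) → MeasurableSpace.comap (d a b t) inferInstance ≤ m) :
    Measurable (otherNoise A i d) := by
  refine measurable_pi_iff.2 fun a => measurable_pi_iff.2 fun b => measurable_pi_iff.2 fun t => ?_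
  by_cases hab : a ≠ i ∧ UnionEdge A (a, b)
  · simp only [otherNoise, if_pos hab]
    exact measurable_iff_comap_le.2 (h a b t hab.1 hab.2)
  · simp only [otherNoise, if_neg hab]
    exact measurable_const

lemma measurable_stdNoise
    (h : ∀ b t, UnionEdge A (i, b) → MeasurableSpace.comap (d i b t) inferInstance ≤ m) :
    Measurable (stdNoise A i d c v) := by
  refine measurable_pi_iff.2 fun q => ?_
  have : Measurable (d i q.1 q.2) := measurable_iff_comap_le.2 (h q.1 q.2 q.1.2)
  exact (this.sub_const _).div_const _

lemma measurable_observation_pi (i : Fin N)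
    (hH : ∀ t, MeasurableSpace.comap (H i t) inferInstance ≤ m)
    (hw : ∀ t, MeasurableSpace.comap (w i t) inferInstance ≤ m) :
    Measurable fun ω => observation θ H w ω i :=
  measurable_pi_iff.2 fun t => measurable_observation i t (hH t) (hw t)

lemma comap_le_sourceSigma (j : Fin N) (t : ℕ) :
    MeasurableSpace.comap (H j t) inferInstance ≤ sourceSigma H w ∧
      MeasurableSpace.comap (w j t) inferInstance ≤ sourceSigma H w := by
  have h := le_iSup (fun q : Fin N × ℕ => MeasurableSpace.comap (w q.1 q.2) inferInstance ⊔
    MeasurableSpace.comap (H q.1 q.2) inferInstance) (j, t)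
  exact ⟨le_sup_right.trans h, le_sup_left.trans h⟩

lemma comap_le_graphSigma (t : ℕ) :
    MeasurableSpace.comap (fun ω => A (r t ω)) ⊤ ≤ graphSigma A r :=
  le_iSup (fun k => MeasurableSpace.comap (fun ω => A (r k ω)) ⊤) t

lemma measurable_observation_source (i : Fin N) :
    Measurable[sourceSigma H w] fun ω => observation θ H w ω i :=
  measurable_observation_pi i (fun t => (comap_le_sourceSigma i t).1)
    fun t => (comap_le_sourceSigma i t).2

lemma measurable_otherObs_source : Measurable[sourceSigma H w] (otherObs θ H w i) :=
  measurable_otherObs (fun j t _ => (comap_le_sourceSigma j t).1)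
    fun j t _ => (comap_le_sourceSigma j t).2

lemma measurable_graphIndex_graphSigma [Nonempty Ω] : Measurable[graphSigma A r] (graphIndex A r) :=
  measurable_graphIndex comap_le_graphSigma

end Ingredients

variable {Ω : Type*} [mΩ : MeasurableSpace Ω] {μ : Measure Ω}
  {N n M : ℕ} {dim : Fin N → ℕ} {A : Fin M → Matrix (Fin N) (Fin N) ℝ}
  {r : ℕ → Ω → Fin M} {θ : Vec n} {H : ∀ i, ℕ → Ω → (Vec n →L[ℝ] Vec (dim i))}
  {w : ∀ i, ℕ → Ω → Vec (dim i)} {d : Fin N → Fin N → ℕ → Ω → ℝ}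
  {c : Fin N → Fin N → ℕ → ℝ} {v : Fin N → Fin N → ℕ → ℝ≥0} {i : Fin N}
  {P : Algorithm N n dim}

lemma sourceSigma_le (hobs : ObservationModel μ P A r H w) : sourceSigma H w ≤ mΩ :=
  iSup_le fun q => sup_le (hobs.measurable_w q.1 q.2).comap_le (hobs.measurable_H q.1 q.2).comap_le

lemma graphSigma_le (hgraph : GraphModel μ A r) : graphSigma A r ≤ mΩ := by
  refine iSup_le fun t => ?_
  have h : @Measurable _ _ mΩ ⊤ (fun ω => A (r t ω)) :=
    (@measurable_of_finite _ _ _ ⊤ _ _ A).comp (hgraph.measurable t)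
  exact h.comap_le

lemma indepFun_of_indep {α β : Type*} [MeasurableSpace α] [MeasurableSpace β]
    {m m' : MeasurableSpace Ω} (h : Indep m m' μ) {X : Ω → α} {Y : Ω → β} (hX : Measurable[m] X)
    (hY : Measurable[m'] Y) : IndepFun X Y μ :=
  (IndepFun_iff_Indep X Y μ).2 (indep_of_indep_of_le_left
    (indep_of_indep_of_le_right h hY.comap_le) hX.comap_le)

lemma indepFun_observation_otherObs (hobs : ObservationModel μ P A r H w) :
    IndepFun (fun ω => observation θ H w ω i) (otherObs θ H w i) μ := by
  -- The sources are split into those of sensor `i` and those of all other sensors.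
  set s : Set ((Fin N × ℕ) ⊕ (Fin N × ℕ)) := {q | Sum.elim (fun a => a.1 = i) (fun a => a.1 = i) q}
  have h1 := indep_iSup_of_disjoint (fun q => by
    rcases q with q | q
    · exact (hobs.measurable_w q.1 q.2).comap_le
    · exact (hobs.measurable_H q.1 q.2).comap_le) hobs.indep
    (disjoint_compl_right (a := s))
  refine indepFun_of_indep h1 ?_ ?_
  · refine measurable_observation_pi i (fun t => ?_) fun t => ?_
    · exact le_iSup₂_of_le (Sum.inr (i, t)) (show i = i from rfl) le_rfl
    · exact le_iSup₂_of_le (Sum.inl (i, t)) (show i = i from rfl) le_rfl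
  · refine measurable_otherObs (fun j t hj => ?_) fun j t hj => ?_
    · exact le_iSup₂_of_le (Sum.inr (j, t)) (show ¬ j = i from hj) le_rfl
    · exact le_iSup₂_of_le (Sum.inl (j, t)) (show ¬ j = i from hj) le_rfl

lemma indepFun_otherNoise_stdNoise (hnoise : GaussianPrivacyNoise μ A r H w d c v) :
    IndepFun (stdNoise A i d c v) (otherNoise A i d) μ := by
  set s : Set ({e : Fin N × Fin N // UnionEdge A e} × ℕ) := {q | q.1.1.1 = i}
  have h1 := indep_iSup_of_disjoint (fun q => (hnoise.measurable _ _ _).comap_le)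
    hnoise.indep.iIndep (disjoint_compl_right (a := s))
  refine indepFun_of_indep h1 ?_ ?_
  · exact measurable_stdNoise fun b t hb => le_iSup₂_of_le (⟨(i, b), hb⟩, t) (show i = i from rfl) le_rfl
  · exact measurable_otherNoise fun a b t ha hb =>
      le_iSup₂_of_le (⟨(a, b), hb⟩, t) (show ¬ a = i from ha) le_rfl

lemma map_standardize (c : ℝ) {v : ℝ≥0} (hv : v ≠ 0) :
    (gaussianReal c v).map (fun x => (x - c) / √v) = gaussianReal 0 1 := by
  have hs : √(v : ℝ) ≠ 0 := (Real.sqrt_pos.2 (by positivity)).ne'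
  rw [gaussianReal_eq_map_std, Measure.map_map (by fun_prop) (by fun_prop)]
  have : (fun x => (x - c) / √(v : ℝ)) ∘ (fun x => √(v : ℝ) * x + c) = id := by
    funext x
    simp [hs]
  rw [this, Measure.map_id]

lemma map_stdNoise [IsProbabilityMeasure μ] (hnoise : GaussianPrivacyNoise μ A r H w d c v) :
    μ.map (stdNoise A i d c v) = stdGaussianPi (RowIndex A i) := by
  have hinj : Function.Injective fun q : RowIndex A i =>
      ((⟨(i, q.1), q.1.2⟩, q.2) : {e : Fin N × Fin N // UnionEdge A e} × ℕ) := by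
    rintro ⟨⟨j, hj⟩, t⟩ ⟨⟨j', hj'⟩, t'⟩ h
    simp only [Prod.mk.injEq, Subtype.mk.injEq, true_and] at h
    simp [h]
  have hmeas : ∀ q : RowIndex A i,
      Measurable fun x : ℝ => (x - c i q.1 q.2) / √(v i q.1 q.2 : ℝ) := fun q => by fun_prop
  have h1 := (hnoise.indep.precomp hinj).comp _ hmeas
  have h2 := (iIndepFun_iff_map_fun_eq_infinitePi_map fun q =>
    (hmeas q).comp (hnoise.measurable _ _ _)).1 h1
  rw [stdGaussianPi]
  refine h2.trans ?_
  congr 1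
  funext q
  rw [← Measure.map_map (hmeas q) (hnoise.measurable _ _ _), hnoise.law _ _ _ q.1.2,
    map_standardize _ (hnoise.var_ne_zero _ _ _ q.1.2)]

/-- The background of sensor `i`. -/
noncomputable def background (A : Fin M → Matrix (Fin N) (Fin N) ℝ) (r : ℕ → Ω → Fin M)
    (d : Fin N → Fin N → ℕ → Ω → ℝ) (θ : Vec n) (H : ∀ i, ℕ → Ω → (Vec n →L[ℝ] Vec (dim i)))
    (w : ∀ i, ℕ → Ω → Vec (dim i)) (i : Fin N) (ω : Ω) : Background N M dim :=
  (graphIndex A r ω, otherNoise A i d ω, otherObs θ H w i ω)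

lemma measurable_background [Nonempty Ω] (hgraph : GraphModel μ A r)
    (hobs : ObservationModel μ P A r H w)
    (hnoise : GaussianPrivacyNoise μ A r H w d c v) : Measurable (background A r d θ H w i) :=
  (measurable_graphIndex_graphSigma.mono (graphSigma_le hgraph) le_rfl).prodMk
    ((measurable_otherNoise fun _ _ _ _ _ => (hnoise.measurable _ _ _).comap_le).prodMk
      (measurable_otherObs_source.mono (sourceSigma_le hobs) le_rfl))

lemma measurable_stdNoise' (hnoise : GaussianPrivacyNoise μ A r H w d c v) :
    Measurable (stdNoise A i d c v) :=
  measurable_stdNoise fun _ _ _ => (hnoise.measurable _ _ _).comap_le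

/-- Four independences are chained: between sensors, between sources and graphs, between the noises
of sensor `i` and the other noises, and between noises and the rest of the model. -/
theorem indepFun_observation_background [IsProbabilityMeasure μ] (hgraph : GraphModel μ A r)
    (hobs : ObservationModel μ P A r H w) (hnoise : GaussianPrivacyNoise μ A r H w d c v) :
    IndepFun (fun ω => observation θ H w ω i)
        (fun ω => (background A r d θ H w i ω, stdNoise A i d c v ω)) μ ∧
      IndepFun (background A r d θ H w i) (stdNoise A i d c v) μ := by
  have hΩ : Nonempty Ω := μ.nonempty_of_neZero
  have hS := sourceSigma_le hobs
  have hG := graphSigma_le hgraph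
  have mo : Measurable fun ω => observation θ H w ω i :=
    (measurable_observation_source i).mono hS le_rfl
  have mb : Measurable (otherObs θ H w i) := measurable_otherObs_source.mono hS le_rfl
  have mg : Measurable (graphIndex A r) := measurable_graphIndex_graphSigma.mono hG le_rfl
  have md : Measurable (otherNoise A i d) :=
    measurable_otherNoise fun _ _ _ _ _ => (hnoise.measurable _ _ _).comap_le
  have me : Measurable (stdNoise A i d c v) := measurable_stdNoise' hnoise
  have h1 : IndepFun (fun ω => observation θ H w ω i)
      (fun ω => (otherObs θ H w i ω, graphIndex A r ω)) μ :=
    indepFun_prodMk_assoc mo mb mg (indepFun_observation_otherObs hobs)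
      (indepFun_of_indep hobs.indep_graph
        ((measurable_observation_source i).prodMk measurable_otherObs_source)
        measurable_graphIndex_graphSigma)
  have hle : ∀ a b t, UnionEdge A (a, b) → MeasurableSpace.comap (d a b t) inferInstance ≤
      ⨆ q : {e : Fin N × Fin N // UnionEdge A e} × ℕ,
        MeasurableSpace.comap (d q.1.1.1 q.1.1.2 q.2) inferInstance := fun a b t hab =>
    le_iSup (fun q : {e : Fin N × Fin N // UnionEdge A e} × ℕ =>
      MeasurableSpace.comap (d q.1.1.1 q.1.1.2 q.2) inferInstance) (⟨(a, b), hab⟩, t)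
  have h2 : IndepFun (fun ω => (stdNoise A i d c v ω, otherNoise A i d ω))
      (fun ω => (observation θ H w ω i, (otherObs θ H w i ω, graphIndex A r ω))) μ :=
    indepFun_of_indep hnoise.indep_model
      ((measurable_stdNoise fun b t hb => hle i b t hb).prodMk
        (measurable_otherNoise fun a b t _ hab => hle a b t hab))
      (((measurable_observation_source i).mono le_sup_left le_rfl).prodMk
        ((measurable_otherObs_source.mono le_sup_left le_rfl).prodMk
          (measurable_graphIndex_graphSigma.mono le_sup_right le_rfl)))
  have h3 := indepFun_prodMk_assoc mo (mb.prodMk mg) (me.prodMk md) h1 h2.symm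
  have h4 := indepFun_prodMk_assoc me md (mb.prodMk mg) (indepFun_otherNoise_stdNoise hnoise)
    (h2.comp measurable_id measurable_snd)
  constructor
  · exact h3.comp (φ := id) (ψ := fun p : (((∀ j, ℕ → Vec (dim j)) × (ℕ → Fin M)) ×
      ((RowIndex A i → ℝ) × (Fin N → Fin N → ℕ → ℝ))) => ((p.1.2, p.2.2, p.1.1), p.2.1))
      measurable_id (by fun_prop)
  · exact (h4.comp (φ := id) (ψ := fun p : (Fin N → Fin N → ℕ → ℝ) ×
      ((∀ j, ℕ → Vec (dim j)) × (ℕ → Fin M)) => ((p.2.2, p.1, p.2.1) : Background N M dim))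
      measurable_id (by fun_prop)).symm

end JointLaw

/-! ### The conditional law of the signals -/

/-- The remaining randomness is independent of the observations, so the conditional law is obtained
by freezing them. -/
lemma hasCondDistrib_outKernel {Ω X Q Ξ S : Type*} [MeasurableSpace Ω] [MeasurableSpace X]
    [MeasurableSpace Ξ] [MeasurableSpace S] {μ : Measure Ω} [IsProbabilityMeasure μ]
    {P₀ : Measure Ξ} [IsProbabilityMeasure P₀] {out : X × Ξ × (Q → ℝ) → S} (hout : Measurable out)
    {obs : Ω → X} {Z : Ω → Ξ × (Q → ℝ)} (hobs : Measurable obs) (hZ : Measurable Z)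
    (hind : IndepFun obs Z μ) (hlaw : μ.map Z = P₀.prod (stdGaussianPi Q)) :
    HasCondDistrib (fun ω => out (obs ω, Z ω)) obs (outKernel P₀ out) μ := by
  have hκ := isMarkovKernel_outKernel (P₀ := P₀) hout
  have hp : IsProbabilityMeasure (μ.map obs) := Measure.isProbabilityMeasure_map hobs.aemeasurable
  have hm := hobs.prodMk (hout.comp (hobs.prodMk hZ))
  refine ⟨hm.aemeasurable, ?_⟩
  rw [indepFun_iff_map_prod_eq_prod_map_map hobs.aemeasurable hZ.aemeasurable, hlaw] at hind
  have hg : Measurable fun p : X × Ξ × (Q → ℝ) => (p.1, out p) := measurable_fst.prodMk hout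
  have h1 : μ.map (fun ω => (obs ω, out (obs ω, Z ω))) =
      ((μ.map obs).prod (P₀.prod (stdGaussianPi Q))).map fun p => (p.1, out p) := by
    rw [← hind, Measure.map_map hg (hobs.prodMk hZ)]
    rfl
  rw [h1]
  ext s hs
  rw [Measure.map_apply hg hs, Measure.prod_apply (hg hs), Measure.compProd_apply hs]
  refine lintegral_congr fun η => ?_
  rw [outKernel_apply hout, Measure.map_apply (f := fun z => out (η, z))
    (hout.comp measurable_prodMk_left) (measurable_prodMk_left hs)]
  rfl

section SignalLaw

variable {Ω : Type*} [MeasurableSpace Ω] {μ : Measure Ω}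
  {N n M : ℕ} {dim : Fin N → ℕ} {P : Algorithm N n dim} {A : Fin M → Matrix (Fin N) (Fin N) ℝ}
  {r : ℕ → Ω → Fin M} {θ : Vec n} {H : ∀ i, ℕ → Ω → (Vec n →L[ℝ] Vec (dim i))}
  {w : ∀ i, ℕ → Ω → Vec (dim i)} {d : Fin N → Fin N → ℕ → Ω → ℝ}
  {c : Fin N → Fin N → ℕ → ℝ} {v : Fin N → Fin N → ℕ → ℝ≥0} {i : Fin N}
  {S : Type*} {signals : (ℕ → Matrix (Fin N) (Fin N) ℝ) →
    (Fin N → Fin N → ℕ → ℝ) → (∀ i, ℕ → Vec (dim i)) → S}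

/-- By `hsig` the signals see noises only on active edges, which belong to the union graph. Hence
nothing is lost by `otherNoise` being zero elsewhere, and on the row of sensor `i` undoing the
standardization returns the original noise. -/
lemma rowOut_background (hgraph : GraphModel μ A r) (hnoise : GaussianPrivacyNoise μ A r H w d c v)
    (hsig : ∀ (G : ℕ → Matrix (Fin N) (Fin N) ℝ) d d' y, (∀ l, (G l).IsSymm) →
      (∀ t a b, 0 < G t a b → d a b t = d' a b t) → signals G d y = signals G d' y)
    (η : ℕ → Vec (dim i)) (ω : Ω) :
    rowOut A i c v signals (η, background A r d θ H w i ω, stdNoise A i d c v ω) =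
      signals (fun l => A (r l ω)) (fun a b l => d a b l ω)
        (Function.update (observation θ H w ω) i η) := by
  simp only [rowOut, background, graphIndex_spec, otherObs, Function.update_idem]
  refine hsig _ _ _ _ (fun l => hgraph.symm _) fun t a b hab => ?_
  have hu : UnionEdge A (a, b) := ⟨r t ω, hab⟩
  by_cases ha : a = i
  · subst ha
    have hs : √(v a b t : ℝ) ≠ 0 := by
      have := hnoise.var_ne_zero a b t hu
      exact (Real.sqrt_pos.2 (by positivity)).ne'
    simp only [rowNoise, true_and, hu, dif_pos, stdNoise]
    field_simp
    ring
  · simp only [rowNoise, ha, false_and, dif_neg, not_false_eq_true, otherNoise, ne_eq, true_and, hu,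
      if_true]

lemma map_background_stdNoise [IsProbabilityMeasure μ] (hgraph : GraphModel μ A r) (hobs : ObservationModel μ P A r H w)
    (hnoise : GaussianPrivacyNoise μ A r H w d c v) :
    μ.map (fun ω => (background A r d θ H w i ω, stdNoise A i d c v ω)) =
      (μ.map (background A r d θ H w i)).prod (stdGaussianPi (RowIndex A i)) := by
  have hΩ : Nonempty Ω := μ.nonempty_of_neZero
  have h := (indepFun_observation_background (θ := θ) (i := i) hgraph hobs hnoise).2
  rw [indepFun_iff_map_prod_eq_prod_map_map (measurable_background hgraph hobs hnoise).aemeasurable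
    (measurable_stdNoise' hnoise).aemeasurable, map_stdNoise hnoise] at h
  exact h

lemma measurable_observation_row (hobs : ObservationModel μ P A r H w) :
    Measurable fun ω => observation θ H w ω i :=
  (measurable_observation_source i).mono (sourceSigma_le hobs) le_rfl

lemma hasCondDistrib_signals [IsProbabilityMeasure μ] [MeasurableSpace S]
    (hgraph : GraphModel μ A r) (hobs : ObservationModel μ P A r H w)
    (hnoise : GaussianPrivacyNoise μ A r H w d c v)
    (hsig : ∀ (G : ℕ → Matrix (Fin N) (Fin N) ℝ) d d' y, (∀ l, (G l).IsSymm) →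
      (∀ t a b, 0 < G t a b → d a b t = d' a b t) → signals G d y = signals G d' y)
    (hout : Measurable (rowOut A i c v signals)) :
    HasCondDistrib (fun ω => signals (fun l => A (r l ω)) (fun a b l => d a b l ω)
        (observation θ H w ω)) (fun ω => observation θ H w ω i)
      (outKernel (μ.map (background A r d θ H w i)) (rowOut A i c v signals)) μ := by
  have hΩ : Nonempty Ω := μ.nonempty_of_neZero
  have hb := measurable_background (θ := θ) (i := i) hgraph hobs hnoise
  have hP : IsProbabilityMeasure (μ.map (background A r d θ H w i)) :=
    Measure.isProbabilityMeasure_map hb.aemeasurable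
  have h := hasCondDistrib_outKernel hout (measurable_observation_row hobs)
    (hb.prodMk (measurable_stdNoise' hnoise))
    (indepFun_observation_background hgraph hobs hnoise).1
    (map_background_stdNoise hgraph hobs hnoise)
  convert h using 2 with ω
  rw [rowOut_background hgraph hnoise hsig, Function.update_eq_self]

lemma outKernel_eq_lawGivenObs [IsProbabilityMeasure μ] [MeasurableSpace S]
    (hgraph : GraphModel μ A r) (hobs : ObservationModel μ P A r H w)
    (hnoise : GaussianPrivacyNoise μ A r H w d c v)
    (hsig : ∀ (G : ℕ → Matrix (Fin N) (Fin N) ℝ) d d' y, (∀ l, (G l).IsSymm) →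
      (∀ t a b, 0 < G t a b → d a b t = d' a b t) → signals G d y = signals G d' y)
    (hout : Measurable (rowOut A i c v signals)) (η : ℕ → Vec (dim i)) :
    outKernel (μ.map (background A r d θ H w i)) (rowOut A i c v signals) η =
      lawGivenObs μ signals A r d θ H w i η := by
  have hΩ : Nonempty Ω := μ.nonempty_of_neZero
  have hb := measurable_background (θ := θ) (i := i) hgraph hobs hnoise
  have hP : IsProbabilityMeasure (μ.map (background A r d θ H w i)) :=
    Measure.isProbabilityMeasure_map hb.aemeasurable
  rw [outKernel_apply hout, ← map_background_stdNoise hgraph hobs hnoise,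
    Measure.map_map (g := fun z => rowOut A i c v signals (η, z))
      (hout.comp measurable_prodMk_left) (hb.prodMk (measurable_stdNoise' hnoise)),
    lawGivenObs]
  congr 1
  funext ω
  exact rowOut_background hgraph hnoise hsig η ω

end SignalLaw

/-- Binary signals carry at most `2 / π` times the conditional Fisher information of the
unquantized noisy signals; both exist. -/
theorem exists_fisherInfo_and_binarySignals_le {Ω : Type*} [MeasurableSpace Ω] (μ : Measure Ω)
    [IsProbabilityMeasure μ] {N n M : ℕ} {dim : Fin N → ℕ}
    (P : Algorithm N n dim) (A : Fin M → Matrix (Fin N) (Fin N) ℝ)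
    (r : ℕ → Ω → Fin M) (θ : Vec n)
    (H : ∀ i, ℕ → Ω → (Vec n →L[ℝ] Vec (dim i)))
    (w : ∀ i, ℕ → Ω → Vec (dim i))
    (d : Fin N → Fin N → ℕ → Ω → ℝ)
    (c : Fin N → Fin N → ℕ → ℝ) (v : Fin N → Fin N → ℕ → ℝ≥0)
    (hgraph : GraphModel μ A r)
    (hobs : ObservationModel μ P A r H w)
    (hnoise : GaussianPrivacyNoise μ A r H w d c v)
    (hstep : StepConditions P A c v)
    (i : Fin N) (k : ℕ) :
    (∃ IS, IsSignalFisherInfo μ P.binarySignals A r d θ H w i k IS) ∧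
    (∃ IX, IsSignalFisherInfo μ P.noisySignals A r d θ H w i k IX) ∧
    ∀ IS IX, IsSignalFisherInfo μ P.binarySignals A r d θ H w i k IS →
      IsSignalFisherInfo μ P.noisySignals A r d θ H w i k IX →
      ∀ᵐ ω ∂μ, ((2 / Real.pi) • IX ω - IS ω).PosSemidef := by
  classical
  have hΩ : Nonempty Ω := μ.nonempty_of_neZero
  have hP : IsProbabilityMeasure (μ.map (background A r d θ H w i)) :=
    Measure.isProbabilityMeasure_map
      (measurable_background hgraph hobs hnoise).aemeasurable
  have hv : ∀ j t, UnionEdge A (i, j) → v i j t ≠ 0 := fun j t h => hnoise.var_ne_zero i j t h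
  have hsigS : ∀ (G : ℕ → Matrix (Fin N) (Fin N) ℝ) (d d' : Fin N → Fin N → ℕ → ℝ)
      (y : ∀ i, ℕ → Vec (dim i)), (∀ l, (G l).IsSymm) →
      (∀ t a b, 0 < G t a b → d a b t = d' a b t) → P.binarySignals G d y = P.binarySignals G d' y :=
    fun G d d' y hG h => P.binarySignals_congr hG h
  have hsigX : ∀ (G : ℕ → Matrix (Fin N) (Fin N) ℝ) (d d' : Fin N → Fin N → ℕ → ℝ)
      (y : ∀ i, ℕ → Vec (dim i)), (∀ l, (G l).IsSymm) →
      (∀ t a b, 0 < G t a b → d a b t = d' a b t) → P.noisySignals G d y = P.noisySignals G d' y :=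
    fun G d d' y hG h => P.noisySignals_congr hG h
  have houtS := measurable_rowOut_binarySignals P (A := A) (i := i) (c := c) (v := v)
  have houtX := measurable_rowOut_noisySignals P (A := A) (i := i) (c := c) (v := v)
  have hb := summable_norm_shiftDir_sq hstep hv k
  have hMS := isCoordMean_binarySignals P (c := c) hgraph.symm hgraph.weights_of_edges hv
  have hMX := isCoordMean_noisySignals P (c := c) hgraph.symm hgraph.weights_of_edges hv
  have hYS := hasCondDistrib_signals (θ := θ) hgraph hobs hnoise hsigS houtS
  have hYX := hasCondDistrib_signals (θ := θ) hgraph hobs hnoise hsigX houtX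
  have hLS := outKernel_eq_lawGivenObs (θ := θ) hgraph hobs hnoise hsigS houtS
  have hLX := outKernel_eq_lawGivenObs (θ := θ) hgraph hobs hnoise hsigX houtX
  have hshiftS := rowOut_binarySignals_shift P hgraph.symm hv (c := c) k
  have hshiftX := rowOut_noisySignals_shift P hgraph.symm hv (c := c) k
  refine ⟨exists_isCondFisherInfo houtS hYS hLS hb hshiftS hMS,
    exists_isCondFisherInfo houtX hYX hLX hb hshiftX hMX, fun IS IX hIS hIX => ?_⟩
  have hκS := isMarkovKernel_outKernel (P₀ := μ.map (background A r d θ H w i)) houtS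
  have hκX := isMarkovKernel_outKernel (P₀ := μ.map (background A r d θ H w i)) houtX
  refine ae_posSemidef_of_integral_sq_le (measurable_observation_row hobs) hYS hYX
    (isCondScore_scoreFun houtS hYS hLS hb hshiftS) (isCondScore_scoreFun houtX hYX hLX hb hshiftX)
    (fun η h => ?_) hIS hIX
  exact (hMS η).integral_scoreFun_sq_le houtS houtX (hMX η)
    (integral_binaryMean_sq_le P hgraph.symm hgraph.weights_of_edges hv η) hb h

end PrivEst

theorem theorem2 {Ω : Type*} [MeasurableSpace Ω] (μ : MeasureTheory.Measure Ω)
    [MeasureTheory.IsProbabilityMeasure μ] {N n M : ℕ} {dim : Fin N → ℕ}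
    (P : PrivEst.Algorithm N n dim) (A : Fin M → Matrix (Fin N) (Fin N) ℝ)
    (r : ℕ → Ω → Fin M) (θ : PrivEst.Vec n)
    (H : ∀ i, ℕ → Ω → (PrivEst.Vec n →L[ℝ] PrivEst.Vec (dim i)))
    (w : ∀ i, ℕ → Ω → PrivEst.Vec (dim i))
    (d : Fin N → Fin N → ℕ → Ω → ℝ)
    (c : Fin N → Fin N → ℕ → ℝ) (v : Fin N → Fin N → ℕ → ℝ≥0)
    (hgraph : PrivEst.GraphModel μ A r)
    (hobs : PrivEst.ObservationModel μ P A r H w)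
    (hnoise : PrivEst.GaussianPrivacyNoise μ A r H w d c v)
    (hstep : PrivEst.StepConditions P A c v)
    (i : Fin N) (k : ℕ) :
    (∃ IS, PrivEst.IsSignalFisherInfo μ P.binarySignals A r d θ H w i k IS) ∧
    (∃ IX, PrivEst.IsSignalFisherInfo μ P.noisySignals A r d θ H w i k IX) ∧
    ∀ IS IX, PrivEst.IsSignalFisherInfo μ P.binarySignals A r d θ H w i k IS →
      PrivEst.IsSignalFisherInfo μ P.noisySignals A r d θ H w i k IX →
      ∀ᵐ ω ∂μ, ((2 / Real.pi) • IX ω - IS ω).PosSemidef :=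
  PrivEst.exists_fisherInfo_and_binarySignals_le μ P A r θ H w d c v hgraph hobs hnoise hstep i k
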